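/- **Setting.** Let $(M,\omega)$ be a closed symplectic manifold with an almost complex structure $J$ such that $g^{TM}(u,v)=\omega(u,Jv)$ is a Riemannian metric, and let $\nabla^{TM}$ be its Levi-Civita connection. Write $TM\otimes\mathbf C=T^{(1,0)}M\oplus T^{(0,1)}M$ for the $\pm\sqrt{-1}$-eigenbundles of $J$, and $X=X_1+X_2$ for the corresponding decomposition of $X\in TM$. Put $\wedge^{p,q}(T^*M)=\wedge^p(T^{(1,0)*}M)\otimes\wedge^q(T^{(0,1)*}M)$. Let $\nabla^{T^{(1,0)}M}$ be the projection of $\nabla^{TM}$ to $T^{(1,0)}M$; it induces a connection on $\wedge^{p,0}(T^*M)$. Let $\nabla^{\wedge^{0,*}(T^*M)}$ be the canonical lift of $\nabla^{TM}$ to $\wedge^{0,*}(T^*M)$, which is locally $S(TM)\otimes(\det T^{(1,0)}M)^{1/2}$ with the tensor product of the spin connection of $\nabla^{TM}$ and of the connection induced by $\nabla^{T^{(1,0)}M}$. Let $E$ be a Hermitian vector bundle over $M$ with a Hermitian connection $\nabla^E$. For $p\ge 0$ let $\Omega^{p,*}(M,E)$ be the space of smooth sections of $\wedge^{p,*}(T^*M)\otimes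 E=\wedge^{p,0}(T^*M)\otimes\wedge^{0,*}(T^*M)\otimes E$, with the tensor product connection $\nabla$. With $g^{TM}$ extended complex bilinearly, $\overline{X}_1^*=g^{TM}(X_1,\cdot)\in T^{(0,1)*}M$ and $\overline{X}_2^*=g^{TM}(X_2,\cdot)\in T^{(1,0)*}M$, set $$c(X)=\sqrt2\,\overline{X}_1^*\wedge-\sqrt2\,i_{X_2}\ \text{ on }\wedge^{0,*}(T^*M),\qquad A(X,Y)=\overline{X}_2^*\wedge i_{Y_1}\ \text{ on }\wedge^{p,0}(T^*M),$$ and let these operators act on the corresponding factors of $\wedge^{p,*}(T^*M)\otimes E$. For $e_1,\dots,e_{\dim M}$ an orthonormal basis of $TM$, let $D=\sum_j c(e_j)\nabla_{e_j}:\Omega^{p,*}(M,E)\to\Omega^{p,*}(M,E)$ be the twisted Spin$^c$ Dirac operator. Let a compact connected Lie group $G$ with Lie algebra $\mathfrak g$ act on $(M,\omega)$ in a Hamiltonian way, preserving $J$, with moment map $\mu:M\to\mathfrak g^*$, that is, $\mu$ is smooth and equivariant and $d\langle\mu,V\rangle=i_V\omega$ for $V\in\mathfrak g$, where $V$ also denotes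 the vector field on $M$ it generates. Let the action lift to an action on $E$ that preserves the Hermitian metric and $\nabla^E$. Let $L_V$ (on $E$ also $L_V^E$) be the infinitesimal action of $V$ on sections, the derivative at $t=0$ of pulling back by $\exp(tV)$, and let $r^E_V=L^E_V-\nabla^E_V$, an endomorphism of $E$. Fix an $\mathrm{Ad}\,G$-invariant metric on $\mathfrak g$ and the dual metric on $\mathfrak g^*$, an orthonormal basis $h_1,\dots,h_{\dim G}$ of $\mathfrak g^*$ with dual basis $V_1,\dots,V_{\dim G}$ of $\mathfrak g$, and write $\mu=\sum_i\mu_ih_i$. Let $\mathcal H=|\mu|^2$, let $X^{\mathcal H}$ be its Hamiltonian vector field ($i_{X^{\mathcal H}}\omega=d\mathcal H$), and let $\mathrm{Tr}[\nabla^{T^{(1,0)}M}X^{\mathcal H}]$ be the trace of the endomorphism $Y\mapsto\nabla^{T^{(1,0)}M}_Y X^{\mathcal H}_1$ of $T^{(1,0)}M$. For $T\in\mathbf R$ let $$D_T=D+\frac{\sqrt{-1}\,T}{2}\,c(X^{\mathcal H}).$$ **Theorem 1.4.** For every $p\ge0$ and every $T\in\mathbf R$, the operators $D$ and $D_T$ map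 $\Omega^{p,*}(M,E)$ into itself, and on $\Omega^{p,*}(M,E)$ $$\begin{aligned}D_T^2={}&D^2-2\sqrt{-1}\,T\sum_{i=1}^{\dim G}\mu_iL_{V_i}-\frac{\sqrt{-1}\,T}{2}\mathrm{Tr}\big[\nabla^{T^{(1,0)}M}X^{\mathcal H}\big]+2\sqrt{-1}\,T\sum_{i=1}^{\dim G}\mu_i\,r^E_{V_i}\\&+\frac T2\sum_{i=1}^{\dim G}\Big(\sqrt{-1}\,c(JV_i)c(V_i)+|V_i|^2-4\sqrt{-1}\,A(JV_i,V_i)\Big)\\&+\frac{\sqrt{-1}\,T}{4}\sum_{j=1}^{\dim M}\Big(c(e_j)c(\nabla^{TM}_{e_j}X^{\mathcal H})+4A(e_j,\nabla^{TM}_{e_j}X^{\mathcal H})\Big)+\frac{T^2}{4}|X^{\mathcal H}|^2 .\end{aligned}$$ -/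

import Mathlib

open scoped Manifold ContDiff TensorProduct
open Bundle

noncomputable section

namespace TwistedSpinc

/-! ## Pointwise algebra

`T` is a tangent space `T_x M`, `N` a complex vector space (the fibre `E_x`), `J` the complex
structure on `T` and `g` the metric on `T`. The complexification of `T` is `ℂ ⊗[ℝ] T`. -/

section Algebra

variable {T : Type*} [AddCommGroup T] [Module ℝ T] {N : Type*} [AddCommGroup N] [Module ℂ N]

/-- The element `♯ξ` of `T` with `b (♯ξ, w) = ξ w` for all `w`: it exists and is unique when `T` is
finite-dimensional and `b` is a nondegenerate bilinear form. For a metric this is the metric dual of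
`ξ`; for a symplectic form and `ξ = df` it is the Hamiltonian vector of `f`. -/
def sharp (b : T →ₗ[ℝ] T →ₗ[ℝ] ℝ) (ξ : T →ₗ[ℝ] ℝ) : T :=
  Classical.epsilon fun u => ∀ w, b u w = ξ w

/-- `J` extended complex linearly to `ℂ ⊗[ℝ] T`. -/
def complexJ (J : T →ₗ[ℝ] T) : (ℂ ⊗[ℝ] T) →ₗ[ℂ] (ℂ ⊗[ℝ] T) := J.baseChange ℂ

/-- `T^{(1,0)} = {z ; J z = √-1 z}`. -/
def T10 (J : T →ₗ[ℝ] T) : Submodule ℂ (ℂ ⊗[ℝ] T) :=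
  Module.End.eigenspace (complexJ J) Complex.I

/-- The projection of the complexification onto `T^{(1,0)}` along `T^{(0,1)}`. -/
def pr10 (J : T →ₗ[ℝ] T) : (ℂ ⊗[ℝ] T) →ₗ[ℂ] (ℂ ⊗[ℝ] T) :=
  (1 / 2 : ℂ) • (LinearMap.id - Complex.I • complexJ J)

/-- The projection of the complexification onto `T^{(0,1)}` along `T^{(1,0)}`. -/
def pr01 (J : T →ₗ[ℝ] T) : (ℂ ⊗[ℝ] T) →ₗ[ℂ] (ℂ ⊗[ℝ] T) :=
  (1 / 2 : ℂ) • (LinearMap.id + Complex.I • complexJ J)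

theorem complexJ_complexJ {J : T →ₗ[ℝ] T} (hJ : ∀ v, J (J v) = -v) (z : ℂ ⊗[ℝ] T) :
    complexJ J (complexJ J z) = -z := by
  induction z using TensorProduct.induction_on with
  | zero => simp
  | tmul a v => simp [complexJ, hJ, TensorProduct.tmul_neg]
  | add a b ha hb => rw [map_add, map_add, ha, hb, neg_add]

theorem pr10_mem {J : T →ₗ[ℝ] T} (hJ : ∀ v, J (J v) = -v) (z : ℂ ⊗[ℝ] T) :
    pr10 J z ∈ T10 J := by
  rw [T10, Module.End.mem_eigenspace_iff]
  simp only [pr10, LinearMap.smul_apply, LinearMap.sub_apply, LinearMap.id_coe, id_eq, map_smul,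
    map_sub, complexJ_complexJ hJ, smul_sub, smul_neg, smul_smul]
  have h : Complex.I * (1 / 2 * Complex.I) = -(1 / 2) := by
    linear_combination (1 / 2 : ℂ) * Complex.I_mul_I
  rw [h, mul_comm Complex.I (1 / 2)]
  module

/-- The trace over `T^{(1,0)}` of the endomorphism `Y ↦ pr^{(1,0)} (K Y)` of `T^{(1,0)}`. -/
def trace10 {J : T →ₗ[ℝ] T} (hJ : ∀ v, J (J v) = -v)
    (K : (ℂ ⊗[ℝ] T) →ₗ[ℂ] (ℂ ⊗[ℝ] T)) : ℂ :=
  LinearMap.trace ℂ (T10 J)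
    ((pr10 J ∘ₗ K ∘ₗ (T10 J).subtype).codRestrict (T10 J) fun z => pr10_mem hJ (K z))

/-- The metric dual `g(w, ·)` of a complex tangent vector `w`, where `g` is extended complex
bilinearly; as a complex-valued form on `T`. The dual of a vector in `T^{(1,0)}` is a
`(0,1)`-form, that of a vector in `T^{(0,1)}` is a `(1,0)`-form. -/
def dualForm (g : T →ₗ[ℝ] T →ₗ[ℝ] ℝ) (w : ℂ ⊗[ℝ] T) : T →ₗ[ℝ] ℂ :=
  LinearMap.liftBaseChange ℂ (LinearMap.compRight ℝ Complex.ofRealCLM.toLinearMap ∘ₗ g) w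

/-- Exterior multiplication `α ∧ ·` by a complex one-form:
`(α ∧ η)(v_0, …, v_n) = ∑ i, (-1)^i α(v_i) η(v_0, …, v̂_i, …, v_n)`. -/
def wedge {n : ℕ} (α : T →ₗ[ℝ] ℂ) : (T [⋀^Fin n]→ₗ[ℝ] N) →ₗ[ℝ] (T [⋀^Fin (n + 1)]→ₗ[ℝ] N) where
  toFun η := AlternatingMap.alternatizeUncurryFin
    (((LinearMap.toSpanSingleton ℂ (T [⋀^Fin n]→ₗ[ℝ] N) η).restrictScalars ℝ) ∘ₗ α)
  map_add' η θ := by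
    ext v
    simp [AlternatingMap.alternatizeUncurryFin_apply, Finset.sum_add_distrib]
  map_smul' r η := by
    ext v
    simp only [AlternatingMap.alternatizeUncurryFin_apply, LinearMap.comp_apply,
      LinearMap.restrictScalars_apply, LinearMap.toSpanSingleton_apply, AlternatingMap.smul_apply,
      RingHom.id_apply, Finset.smul_sum]
    exact Finset.sum_congr rfl fun i _ => by
      rw [smul_comm (α (v i)) r, smul_comm r ((-1) ^ (i : ℕ) : ℤ)]

/-- Interior multiplication `i_w`, for `w` in the complexification of `T`; it is complex linear in
`w`, and `i_v η = η(v, …)` for real `v`. -/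
def contract {n : ℕ} (w : ℂ ⊗[ℝ] T) :
    (T [⋀^Fin (n + 1)]→ₗ[ℝ] N) →ₗ[ℝ] (T [⋀^Fin n]→ₗ[ℝ] N) where
  toFun η := LinearMap.liftBaseChange ℂ η.curryLeft w
  map_add' η θ := by
    induction w using TensorProduct.induction_on with
    | zero => simp
    | tmul a v => simp
    | add a b ha hb => rw [map_add, map_add, map_add, ha, hb]; abel
  map_smul' r η := by
    induction w using TensorProduct.induction_on with
    | zero => simp
    | tmul a v =>
      simp only [LinearMap.liftBaseChange_tmul, AlternatingMap.curryLeft_smul, LinearMap.smul_apply,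
        RingHom.id_apply]
      rw [smul_comm]
    | add a b ha hb => rw [map_add, map_add, ha, hb, smul_add]

/-- Families, indexed by `q`, of alternating `p`-forms on `T` with values in the alternating
`q`-forms on `T` with values in `N`. The fibre of `⋀^{p,*}(T^*M) ⊗ E` is the subspace `IsTypeP`. -/
abbrev Forms (T N : Type*) [AddCommGroup T] [Module ℝ T] [AddCommGroup N] [Module ℂ N]
    (p : ℕ) : Type _ :=
  ∀ q : ℕ, T [⋀^Fin p]→ₗ[ℝ] (T [⋀^Fin q]→ₗ[ℝ] N)

/-- `η` lies in `⋀^p(T^{(1,0)*}) ⊗ ⋀^*(T^{(0,1)*}) ⊗ N`. A complex linear form on `T^{(1,0)}` is the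
same as a complex linear form on `ℂ ⊗ T` that vanishes on `T^{(0,1)}`, that is, a real linear map
`α : T → ℂ` with `α ∘ J = √-1 α`; similarly for `T^{(0,1)}`, with `-√-1`. -/
def IsTypeP (J : T →ₗ[ℝ] T) {p : ℕ} (η : Forms T N p) : Prop :=
  ∀ (q : ℕ) (Y : Fin p → T) (Z : Fin q → T),
    (∀ i, η q (Function.update Y i (J (Y i))) Z = Complex.I • η q Y Z) ∧
    (∀ j, η q Y (Function.update Z j (J (Z j))) = -(Complex.I • η q Y Z))

/-- The Clifford action `c(X) = √2 X̄₁^* ∧ - √2 i_{X₂}` on the factor `⋀^{0,*}`, where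
`X = X₁ + X₂` with `X₁ ∈ T^{(1,0)}` and `X₂ ∈ T^{(0,1)}`. -/
def cliff (g : T →ₗ[ℝ] T →ₗ[ℝ] ℝ) (J : T →ₗ[ℝ] T) (X : T) {p : ℕ} (η : Forms T N p) :
    Forms T N p
  | 0 => -(√2 : ℝ) • (contract (pr01 J (1 ⊗ₜ X))).compAlternatingMap (η 1)
  | q + 1 => (√2 : ℝ) • (wedge (dualForm g (pr10 J (1 ⊗ₜ X)))).compAlternatingMap (η q)
      - (√2 : ℝ) • (contract (pr01 J (1 ⊗ₜ X))).compAlternatingMap (η (q + 2))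

/-- The endomorphism `A(X, Y) = X̄₂^* ∧ i_{Y₁}` of the factor `⋀^{p,0}`. -/
def opA (g : T →ₗ[ℝ] T →ₗ[ℝ] ℝ) (J : T →ₗ[ℝ] T) (X Y : T) :
    ∀ {p : ℕ}, Forms T N p → Forms T N p
  | 0, _ => 0
  | _ + 1, η => fun q => wedge (dualForm g (pr01 J (1 ⊗ₜ X))) (contract (pr10 J (1 ⊗ₜ Y)) (η q))

/-- The form whose values are given by `f`, if there is one (and `0` otherwise). -/
def ofValues {p : ℕ} (f : ∀ q : ℕ, (Fin p → T) → (Fin q → T) → N) : Forms T N p := by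
  classical
  exact fun q =>
    if h : ∃ η : T [⋀^Fin p]→ₗ[ℝ] (T [⋀^Fin q]→ₗ[ℝ] N), ∀ Y Z, η Y Z = f q Y Z then h.choose else 0

end Algebra

/-! ## Almost complex symplectic manifolds -/

section Manifold

variable {EM : Type*} [NormedAddCommGroup EM] [NormedSpace ℝ EM]
  {M : Type*} [TopologicalSpace M] [ChartedSpace EM M] [IsManifold 𝓘(ℝ, EM) ∞ M]

/-- The tangent space of `M` at `x`. -/
abbrev TM (EM : Type*) [NormedAddCommGroup EM] [NormedSpace ℝ EM]
    {M : Type*} [TopologicalSpace M] [ChartedSpace EM M] (x : M) : Type _ :=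
  TangentSpace 𝓘(ℝ, EM) x

/-- The vector field `Y` is smooth at `x`. -/
def SmoothFieldAt (Y : ∀ x : M, TM EM x) (x : M) : Prop :=
  ContMDiffAt 𝓘(ℝ, EM) (𝓘(ℝ, EM).prod 𝓘(ℝ, EM)) ∞ 
    (fun y => (TotalSpace.mk' EM y (Y y) : TangentBundle 𝓘(ℝ, EM) M)) x

/-- `g^{TM}(u, v) = Ω(u, J v)`. -/
def metric (Ω : ∀ x : M, TM EM x →L[ℝ] TM EM x →L[ℝ] ℝ) (J : ∀ x : M, TM EM x →L[ℝ] TM EM x)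
    (x : M) : TM EM x →ₗ[ℝ] TM EM x →ₗ[ℝ] ℝ :=
  LinearMap.mk₂ ℝ (fun u v => Ω x u (J x v)) (by simp) (by simp) (by simp) (by simp)

/-- `Ω` is a symplectic form: a smooth nondegenerate alternating form that is closed, where
closedness is stated by the invariant formula for `dΩ` on smooth vector fields. -/
structure IsSymplectic (Ω : ∀ x : M, TM EM x →L[ℝ] TM EM x →L[ℝ] ℝ) : Prop where
  smooth : ∀ (x : M) (X Y : ∀ y : M, TM EM y), SmoothFieldAt X x → SmoothFieldAt Y x →
    ContMDiffAt 𝓘(ℝ, EM) 𝓘(ℝ, ℝ) ∞ (fun y => Ω y (X y) (Y y)) x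
  alt : ∀ (x : M) (v : TM EM x), Ω x v v = 0
  nondegenerate : ∀ (x : M) (u : TM EM x), (∀ v, Ω x u v = 0) → u = 0
  closed : ∀ (x : M) (X Y Z : ∀ y : M, TM EM y),
    SmoothFieldAt X x → SmoothFieldAt Y x → SmoothFieldAt Z x →
    mvfderiv 𝓘(ℝ, EM) (fun y => Ω y (Y y) (Z y)) x (X x)
      + mvfderiv 𝓘(ℝ, EM) (fun y => Ω y (Z y) (X y)) x (Y x)
      + mvfderiv 𝓘(ℝ, EM) (fun y => Ω y (X y) (Y y)) x (Z x)
      - Ω x (VectorField.mlieBracket 𝓘(ℝ, EM) X Y x) (Z x)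
      - Ω x (VectorField.mlieBracket 𝓘(ℝ, EM) Y Z x) (X x)
      - Ω x (VectorField.mlieBracket 𝓘(ℝ, EM) Z X x) (Y x) = 0

/-- `J` is an almost complex structure such that `Ω(u, J v)` is a Riemannian metric. -/
structure IsCompatible (Ω : ∀ x : M, TM EM x →L[ℝ] TM EM x →L[ℝ] ℝ)
    (J : ∀ x : M, TM EM x →L[ℝ] TM EM x) : Prop where
  smooth : ∀ (x : M) (X : ∀ y : M, TM EM y), SmoothFieldAt X x →
    SmoothFieldAt (fun y => J y (X y)) x
  sq : ∀ (x : M) (v : TM EM x), J x (J x v) = -v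
  symm : ∀ (x : M) (u v : TM EM x), metric Ω J x u v = metric Ω J x v u
  pos : ∀ (x : M) (v : TM EM x), v ≠ 0 → 0 < metric Ω J x v v

/-- An affine connection on `TM`; `nab Y x v` is `∇_v Y` at `x`. -/
abbrev AffineConn (EM M : Type*) [NormedAddCommGroup EM] [NormedSpace ℝ EM]
    [TopologicalSpace M] [ChartedSpace EM M] [IsManifold 𝓘(ℝ, EM) ∞ M] : Type _ :=
  CovariantDerivative 𝓘(ℝ, EM) EM (TangentSpace 𝓘(ℝ, EM) : M → Type _)

/-- `nab` is the Levi-Civita connection of the Riemannian metric `g`: the smooth connection that is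
torsion free and metric. -/
structure IsLeviCivita (g : ∀ x : M, TM EM x →ₗ[ℝ] TM EM x →ₗ[ℝ] ℝ)
    (nab : AffineConn EM M) : Prop where
  smooth : CovariantDerivative.ContMDiffCovariantDerivative nab ∞
  torsionFree : ∀ (x : M) (X Y : ∀ y : M, TM EM y), SmoothFieldAt X x → SmoothFieldAt Y x →
    nab Y x (X x) - nab X x (Y x) = VectorField.mlieBracket 𝓘(ℝ, EM) X Y x
  metric : ∀ (x : M) (v : TM EM x) (Y Z : ∀ y : M, TM EM y),
    SmoothFieldAt Y x → SmoothFieldAt Z x →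
    mvfderiv 𝓘(ℝ, EM) (fun y => g y (Y y) (Z y)) x v = g x (nab Y x v) (Z x) + g x (Y x) (nab Z x v)

/-- `K ↦ ∇_K (X^{(1,0)})` at `x`, with `X^{(1,0)} = (X - √-1 J X) / 2` the `(1,0)`-component of the
real vector field `X` and `∇` extended complex linearly in both arguments. -/
def covX10 (nab : AffineConn EM M) (J : ∀ x : M, TM EM x →L[ℝ] TM EM x) (X : ∀ y : M, TM EM y)
    (x : M) : (ℂ ⊗[ℝ] TM EM x) →ₗ[ℂ] (ℂ ⊗[ℝ] TM EM x) :=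
  (1 / 2 : ℂ) • ((nab X x).toLinearMap.baseChange ℂ
    - Complex.I • (nab (fun y => J y (X y)) x).toLinearMap.baseChange ℂ)

/-- `Tr[∇^{T^{(1,0)}M} X]`: the trace of the endomorphism `K ↦ ∇^{T^{(1,0)}M}_K (X^{(1,0)})` of
`T^{(1,0)}M`, where `∇^{T^{(1,0)}M} = pr^{(1,0)} ∘ ∇` is the projected Levi-Civita connection. -/
def traceNabla10 {Ω : ∀ x : M, TM EM x →L[ℝ] TM EM x →L[ℝ] ℝ}
    {J : ∀ x : M, TM EM x →L[ℝ] TM EM x} (hJ : IsCompatible Ω J)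
    (nab : AffineConn EM M) (X : ∀ y : M, TM EM y) (x : M) : ℂ :=
  trace10 (J := (J x).toLinearMap) (hJ.sq x) (covX10 nab J X x)

/-- The connection `∇^{T^{(1,0)}M}` on `T^{(1,0)}M`, transported to real vector fields by the
isomorphism `(TM, J) ≅ T^{(1,0)}M`, `Y ↦ Y^{(1,0)}`; see `pr10_nablaJ`. The complex conjugate
isomorphism `TM ≅ T^{(0,1)}M` transports the projected connection on `T^{(0,1)}M` to the same
connection. -/
def nablaJ (nab : AffineConn EM M) (J : ∀ x : M, TM EM x →L[ℝ] TM EM x) (Y : ∀ y : M, TM EM y)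
    (x : M) (v : TM EM x) : TM EM x :=
  (1 / 2 : ℝ) • (nab Y x v - J x (nab (fun y => J y (Y y)) x v))

theorem pr10_nablaJ {Ω : ∀ x : M, TM EM x →L[ℝ] TM EM x →L[ℝ] ℝ}
    {J : ∀ x : M, TM EM x →L[ℝ] TM EM x} (hJ : IsCompatible Ω J) (nab : AffineConn EM M)
    (Y : ∀ y : M, TM EM y) (x : M) (v : TM EM x) :
    pr10 (J x).toLinearMap (1 ⊗ₜ nablaJ nab J Y x v)
      = pr10 (J x).toLinearMap (covX10 nab J Y x (1 ⊗ₜ v)) := by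
  have hI : ∀ w : TM EM x, pr10 (J x).toLinearMap ((1 : ℂ) ⊗ₜ[ℝ] J x w)
      = Complex.I • pr10 (J x).toLinearMap ((1 : ℂ) ⊗ₜ[ℝ] w) := by
    intro w
    have h := pr10_mem (J := (J x).toLinearMap) (hJ.sq x) ((1 : ℂ) ⊗ₜ[ℝ] w)
    rw [T10, Module.End.mem_eigenspace_iff] at h
    rw [← h]
    simp [pr10, complexJ]
  simp only [nablaJ, covX10, TensorProduct.tmul_smul, TensorProduct.tmul_sub,
    LinearMap.smul_apply, LinearMap.sub_apply, LinearMap.baseChange_tmul, map_smul, map_sub,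
    ContinuousLinearMap.coe_coe]
  have hr : ∀ z : ℂ ⊗[ℝ] TM EM x, (1 / 2 : ℝ) • z = (1 / 2 : ℂ) • z := fun z => by
    rw [← algebraMap_smul ℂ (1 / 2 : ℝ) z]; norm_num
  rw [hr, map_smul, map_sub, hI]

end Manifold

/-! ## Twisted forms, connections and the Dirac operator -/

section Dirac

variable {EM : Type*} [NormedAddCommGroup EM] [NormedSpace ℝ EM]
  {M : Type*} [TopologicalSpace M] [ChartedSpace EM M] [IsManifold 𝓘(ℝ, EM) ∞ M]
  {F : Type*} [NormedAddCommGroup F] [NormedSpace ℂ F]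
  {E : M → Type*} [TopologicalSpace (TotalSpace F E)]
  [∀ x, AddCommGroup (E x)] [∀ x, Module ℂ (E x)] [∀ x, TopologicalSpace (E x)]
  [FiberBundle F E]

/-- The section `σ` of the bundle `E` is smooth at `x`. -/
def SmoothSecAt (EM F : Type*) [NormedAddCommGroup EM] [NormedSpace ℝ EM]
    {M : Type*} [TopologicalSpace M] [ChartedSpace EM M]
    [NormedAddCommGroup F] [NormedSpace ℂ F]
    {E : M → Type*} [TopologicalSpace (TotalSpace F E)]
    [∀ x, TopologicalSpace (E x)] [FiberBundle F E] (σ : ∀ x : M, E x) (x : M) : Prop :=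
  ContMDiffAt 𝓘(ℝ, EM) (𝓘(ℝ, EM).prod 𝓘(ℝ, F)) ∞ (fun y => TotalSpace.mk' F y (σ y)) x

/-- `h` is a smooth Hermitian metric on the complex vector bundle `E`. -/
structure IsHermitianMetric (EM F : Type*) [NormedAddCommGroup EM] [NormedSpace ℝ EM]
    {M : Type*} [TopologicalSpace M] [ChartedSpace EM M]
    [NormedAddCommGroup F] [NormedSpace ℂ F]
    {E : M → Type*} [TopologicalSpace (TotalSpace F E)]
    [∀ x, AddCommGroup (E x)] [∀ x, Module ℂ (E x)] [∀ x, TopologicalSpace (E x)]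
    [FiberBundle F E] (h : ∀ x : M, E x →ₗ⋆[ℂ] E x →ₗ[ℂ] ℂ) : Prop where
  smooth : ∀ (x : M) (σ τ : ∀ y : M, E y), SmoothSecAt EM F σ x → SmoothSecAt EM F τ x →
    ContMDiffAt 𝓘(ℝ, EM) 𝓘(ℝ, ℂ) ∞ (fun y => h y (σ y) (τ y)) x
  conj_symm : ∀ (x : M) (a b : E x), h x a b = starRingEnd ℂ (h x b a)
  pos : ∀ (x : M) (a : E x), a ≠ 0 → 0 < (h x a a).re

variable [∀ x, IsTopologicalAddGroup (E x)]
  [∀ x, ContinuousSMul ℝ (E x)] [VectorBundle ℝ F E]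

/-- `covE` is a smooth complex linear connection that preserves the Hermitian metric `h`;
`covE σ x v` is `∇^E_v σ` at `x`. -/
structure IsHermitianConnection (h : ∀ x : M, E x →ₗ⋆[ℂ] E x →ₗ[ℂ] ℂ)
    (covE : CovariantDerivative 𝓘(ℝ, EM) F E) : Prop where
  smooth : CovariantDerivative.ContMDiffCovariantDerivative covE ∞
  complexLinear : ∀ (x : M) (v : TM EM x) (σ : ∀ y : M, E y), SmoothSecAt EM F σ x →
    covE (fun y => Complex.I • σ y) x v = Complex.I • covE σ x v
  metric : ∀ (x : M) (v : TM EM x) (σ τ : ∀ y : M, E y),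
    SmoothSecAt EM F σ x → SmoothSecAt EM F τ x →
    mvfderiv 𝓘(ℝ, EM) (fun y => h y (σ y) (τ y)) x v
      = h x (covE σ x v) (τ x) + h x (σ x) (covE τ x v)

/-- `s ∈ Ω^{p,*}(M, E)`: a smooth section of `⋀^{p,*}(T^*M) ⊗ E`. Smoothness means that evaluation
on smooth vector fields gives smooth sections of `E`. -/
structure IsSmoothForm (F : Type*) [NormedAddCommGroup F] [NormedSpace ℂ F]
    {E : M → Type*} [TopologicalSpace (TotalSpace F E)]
    [∀ x, AddCommGroup (E x)] [∀ x, Module ℂ (E x)] [∀ x, TopologicalSpace (E x)]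
    [FiberBundle F E] (J : ∀ x : M, TM EM x →L[ℝ] TM EM x) {p : ℕ}
    (s : ∀ x : M, Forms (TM EM x) (E x) p) : Prop where
  isType : ∀ x : M, IsTypeP (J x).toLinearMap (s x)
  smooth : ∀ (q : ℕ) (x : M) (Y : Fin p → ∀ y : M, TM EM y) (Z : Fin q → ∀ y : M, TM EM y),
    (∀ i, SmoothFieldAt (Y i) x) → (∀ j, SmoothFieldAt (Z j) x) →
    SmoothSecAt EM F (fun y => s y q (fun i => Y i y) (fun j => Z j y)) x

/-- The connection on `⋀^{p,*}(T^*M) ⊗ E` induced, by duality, exterior powers and tensor products,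
from the projected connections on `T^{(1,0)}M` and `T^{(0,1)}M` and from `∇^E`:
`(∇_v s)(Y; Z) = ∇^E_v (s(Y; Z)) - ∑ i, s(…, ∇_v Y_i, …; Z) - ∑ j, s(Y; …, ∇_v Z_j, …)`,
where vectors at `x` are extended to local smooth vector fields. -/
def cov0 (nab : AffineConn EM M) (J : ∀ x : M, TM EM x →L[ℝ] TM EM x)
    (covE : CovariantDerivative 𝓘(ℝ, EM) F E) {p : ℕ} (s : ∀ x : M, Forms (TM EM x) (E x) p)
    (x : M) (v : TM EM x) : Forms (TM EM x) (E x) p :=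
  ofValues fun q Y Z =>
    covE (fun y => s y q (fun i => FiberBundle.extend EM (Y i) y)
        (fun j => FiberBundle.extend EM (Z j) y)) x v
      - ∑ i, s x q (Function.update Y i (nablaJ nab J (FiberBundle.extend EM (Y i)) x v)) Z
      - ∑ j, s x q Y (Function.update Z j (nablaJ nab J (FiberBundle.extend EM (Z j)) x v))

/-- The connection `∇^{⋀^{p,*}(T^*M) ⊗ E}`: the tensor product of the connection on
`⋀^{p,0}(T^*M)` induced by `∇^{T^{(1,0)}M}`, of the lift of the Levi-Civita connection to
`⋀^{0,*}(T^*M)`, and of `∇^E`. Locally `⋀^{0,*}(T^*M) = S(TM) ⊗ (det T^{(1,0)}M)^{1/2}`, and the lift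
is the tensor product of the spin connection of `∇^{TM}` with the connection of
`(det T^{(1,0)}M)^{1/2}` induced by `∇^{T^{(1,0)}M}`. Taking instead of `∇^{TM}` the projected
connection `nablaJ` gives the connection of `cov0`; as `B_v = ∇^{TM}_v - nablaJ_v` is a
skew-symmetric endomorphism of `TM`, the two spin connections differ by
`(1/4) ∑ j, c(e_j) c(B_v e_j)`. Here `e` is a `g`-orthonormal basis at each point; the sum does not
depend on it. -/
def cov (Ω : ∀ x : M, TM EM x →L[ℝ] TM EM x →L[ℝ] ℝ) (J : ∀ x : M, TM EM x →L[ℝ] TM EM x)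
    (nab : AffineConn EM M) {m : ℕ} (e : ∀ x : M, Module.Basis (Fin m) ℝ (TM EM x))
    (covE : CovariantDerivative 𝓘(ℝ, EM) F E) {p : ℕ} (s : ∀ x : M, Forms (TM EM x) (E x) p)
    (x : M) (v : TM EM x) : Forms (TM EM x) (E x) p :=
  cov0 nab J covE s x v
    + (1 / 4 : ℂ) • ∑ j, cliff (metric Ω J x) (J x).toLinearMap (e x j)
        (cliff (metric Ω J x) (J x).toLinearMap
          (nab (FiberBundle.extend EM (e x j)) x v
            - nablaJ nab J (FiberBundle.extend EM (e x j)) x v) (s x))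

/-- The twisted Spin^c Dirac operator `D = ∑ j, c(e_j) ∇_{e_j}`. -/
def dirac (Ω : ∀ x : M, TM EM x →L[ℝ] TM EM x →L[ℝ] ℝ) (J : ∀ x : M, TM EM x →L[ℝ] TM EM x)
    (nab : AffineConn EM M) {m : ℕ} (e : ∀ x : M, Module.Basis (Fin m) ℝ (TM EM x))
    (covE : CovariantDerivative 𝓘(ℝ, EM) F E) {p : ℕ} (s : ∀ x : M, Forms (TM EM x) (E x) p)
    (x : M) : Forms (TM EM x) (E x) p :=
  ∑ j, cliff (metric Ω J x) (J x).toLinearMap (e x j) (cov Ω J nab e covE s x (e x j))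

/-- The deformed operator `D_t = D + (√-1 t / 2) c(X)`, for a vector field `X`. -/
def diracT (Ω : ∀ x : M, TM EM x →L[ℝ] TM EM x →L[ℝ] ℝ) (J : ∀ x : M, TM EM x →L[ℝ] TM EM x)
    (nab : AffineConn EM M) {m : ℕ} (e : ∀ x : M, Module.Basis (Fin m) ℝ (TM EM x))
    (covE : CovariantDerivative 𝓘(ℝ, EM) F E) (X : ∀ x : M, TM EM x) (t : ℝ) {p : ℕ}
    (s : ∀ x : M, Forms (TM EM x) (E x) p) (x : M) : Forms (TM EM x) (E x) p :=
  dirac Ω J nab e covE s x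
    + (Complex.I * t / 2) • cliff (metric Ω J x) (J x).toLinearMap (X x) (s x)

end Dirac

/-! ## Hamiltonian actions -/

section Action

variable {EG : Type*} [NormedAddCommGroup EG] [NormedSpace ℝ EG]
  {G : Type*} [TopologicalSpace G] [ChartedSpace EG G] [Group G]
  {EM : Type*} [NormedAddCommGroup EM] [NormedSpace ℝ EM]
  {M : Type*} [TopologicalSpace M] [ChartedSpace EM M] [IsManifold 𝓘(ℝ, EM) ∞ M] [MulAction G M]

/-- The Lie algebra of `G`, as a vector space. -/
abbrev LieAlg (EG G : Type*) [NormedAddCommGroup EG] [NormedSpace ℝ EG]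
    [TopologicalSpace G] [ChartedSpace EG G] [Group G] : Type _ :=
  GroupLieAlgebra 𝓘(ℝ, EG) G

/-- The adjoint representation: the derivative at `1` of `b ↦ a b a⁻¹`. -/
def Ad (a : G) (V : LieAlg EG G) : LieAlg EG G :=
  cast (congrArg (TangentSpace 𝓘(ℝ, EG)) (by simp))
    (mfderiv 𝓘(ℝ, EG) 𝓘(ℝ, EG) (fun b : G => a * b * a⁻¹) 1 V)

/-- The differential at `x` of the action of `a` on `M`. -/
def dAct (EM : Type*) [NormedAddCommGroup EM] [NormedSpace ℝ EM]
    {M : Type*} [TopologicalSpace M] [ChartedSpace EM M] [MulAction G M] (a : G) (x : M) :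
    TM EM x →L[ℝ] TM EM (a • x) :=
  mfderiv 𝓘(ℝ, EM) 𝓘(ℝ, EM) (fun y : M => a • y) x

/-- The vector field on `M` generated by `V ∈ 𝔤`, that is `x ↦ d/dt exp(tV) x` at `t = 0`: the
derivative at `1` of `a ↦ a • x` in the direction `V`. -/
def killing (EM : Type*) [NormedAddCommGroup EM] [NormedSpace ℝ EM]
    {M : Type*} [TopologicalSpace M] [ChartedSpace EM M] [MulAction G M] (V : LieAlg EG G) (x : M) :
    TM EM x :=
  cast (congrArg (TangentSpace 𝓘(ℝ, EM)) (one_smul G x))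
    (mfderiv 𝓘(ℝ, EG) 𝓘(ℝ, EM) (fun a : G => a • x) 1 V)

/-- `G` preserves `Ω` and `J` (hence also `g^{TM}`). -/
structure IsInvariant (G : Type*) [Group G] [MulAction G M]
    (Ω : ∀ x : M, TM EM x →L[ℝ] TM EM x →L[ℝ] ℝ) (J : ∀ x : M, TM EM x →L[ℝ] TM EM x) :
    Prop where
  symplectic : ∀ (a : G) (x : M) (u v : TM EM x),
    Ω (a • x) (dAct EM a x u) (dAct EM a x v) = Ω x u v
  complexStructure : ∀ (a : G) (x : M) (u : TM EM x),
    J (a • x) (dAct EM a x u) = dAct EM a x (J x u)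

/-- `b` is an `Ad G`-invariant inner product on `𝔤`. -/
structure IsAdInvariantMetric (b : LieAlg EG G →ₗ[ℝ] LieAlg EG G →ₗ[ℝ] ℝ) : Prop where
  symm : ∀ U V, b U V = b V U
  pos : ∀ V, V ≠ 0 → 0 < b V V
  invariant : ∀ (a : G) (U V : LieAlg EG G), b (Ad a U) (Ad a V) = b U V

/-- `μ : M → 𝔤^*` is a moment map: it is smooth, `d⟨μ, V⟩ = i_V Ω` for every `V ∈ 𝔤`, and it is
equivariant for the coadjoint action. -/
structure IsMomentMap (Ω : ∀ x : M, TM EM x →L[ℝ] TM EM x →L[ℝ] ℝ)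
    (μ : M → LieAlg EG G →ₗ[ℝ] ℝ) : Prop where
  smooth : ∀ V, ContMDiff 𝓘(ℝ, EM) 𝓘(ℝ, ℝ) ∞ fun x => μ x V
  deriv : ∀ (V : LieAlg EG G) (x : M) (w : TM EM x),
    mvfderiv 𝓘(ℝ, EM) (fun y => μ y V) x w = Ω x (killing EM V x) w
  equivariant : ∀ (a : G) (x : M) (V : LieAlg EG G), μ (a • x) (Ad a V) = μ x V

/-- `ℋ = |μ|²`, for the metric on `𝔤^*` dual to `b`. -/
def normSqMoment (b : LieAlg EG G →ₗ[ℝ] LieAlg EG G →ₗ[ℝ] ℝ) (μ : M → LieAlg EG G →ₗ[ℝ] ℝ)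
    (x : M) : ℝ :=
  b (sharp b (μ x)) (sharp b (μ x))

/-- The Hamiltonian vector field of a function `f`: `i_X Ω = df`. For a compatible `J` this is
`X = -J (df)^*`. -/
def hamField (Ω : ∀ x : M, TM EM x →L[ℝ] TM EM x →L[ℝ] ℝ) (f : M → ℝ) (x : M) : TM EM x :=
  sharp (LinearMap.mk₂ ℝ (fun u v => Ω x u v) (by simp) (by simp) (by simp) (by simp))
    (mvfderiv 𝓘(ℝ, EM) f x).toLinearMap

variable {F : Type*} [NormedAddCommGroup F] [NormedSpace ℂ F]
  {E : M → Type*} [TopologicalSpace (TotalSpace F E)]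
  [∀ x, AddCommGroup (E x)] [∀ x, Module ℂ (E x)] [∀ x, TopologicalSpace (E x)]
  [FiberBundle F E] [∀ x, IsTopologicalAddGroup (E x)] [∀ x, ContinuousSMul ℝ (E x)]

/-- A lift of the `G`-action on `M` to a smooth action on `E` by complex linear maps `E_x → E_{ax}`
that preserves the Hermitian metric `h` and the connection `covE`. -/
structure IsLift (EG : Type*) [NormedAddCommGroup EG] [NormedSpace ℝ EG]
    {G : Type*} [TopologicalSpace G] [ChartedSpace EG G] [Group G] [MulAction G M]
    (h : ∀ x : M, E x →ₗ⋆[ℂ] E x →ₗ[ℂ] ℂ)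
    (covE : CovariantDerivative 𝓘(ℝ, EM) F E)
    (ρ : ∀ (a : G) (x : M), E x ≃ₗ[ℂ] E (a • x)) : Prop where
  one : ∀ (x : M) (v : E x), TotalSpace.mk' F ((1 : G) • x) (ρ 1 x v) = TotalSpace.mk' F x v
  mul : ∀ (a b : G) (x : M) (v : E x),
    TotalSpace.mk' F ((a * b) • x) (ρ (a * b) x v)
      = TotalSpace.mk' F (a • b • x) (ρ a (b • x) (ρ b x v))
  smooth : ContMDiff (𝓘(ℝ, EG).prod (𝓘(ℝ, EM).prod 𝓘(ℝ, F))) (𝓘(ℝ, EM).prod 𝓘(ℝ, F)) ∞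
    fun z : G × TotalSpace F E => TotalSpace.mk' F (z.1 • z.2.proj) (ρ z.1 z.2.proj z.2.2)
  metric : ∀ (a : G) (x : M) (v w : E x), h (a • x) (ρ a x v) (ρ a x w) = h x v w
  connection : ∀ (a : G) (x : M) (v : TM EM x) (σ : ∀ y : M, E y), (∀ y, SmoothSecAt EM F σ y) →
    covE (fun y => (ρ a y).symm (σ (a • y))) x v
      = (ρ a x).symm (covE σ (a • x) (dAct EM a x v))

variable [VectorBundle ℝ F E]

/-- The derivative at `1`, in the direction `V`, of a map `f` from `G` to the fibre `E_x`; the fibre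
is identified with `F` by a linear isomorphism, on which the result does not depend. -/
def fibreDeriv (F : Type*) [NormedAddCommGroup F] [NormedSpace ℂ F]
    {E : M → Type*} [TopologicalSpace (TotalSpace F E)]
    [∀ x, AddCommGroup (E x)] [∀ x, Module ℂ (E x)] [∀ x, TopologicalSpace (E x)]
    [FiberBundle F E] [VectorBundle ℝ F E] {x : M} (f : G → E x) (V : LieAlg EG G) : E x :=
  let φ : E x ≃L[ℝ] F := (trivializationAt F E x).continuousLinearEquivAt ℝ x
    (FiberBundle.mem_baseSet_trivializationAt' x)
  φ.symm (mvfderiv 𝓘(ℝ, EG) (fun a => φ (f a)) 1 V)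

/-- The infinitesimal action `L_V^E` on sections of `E`: the derivative at `a = 1` of the sections
`x ↦ a⁻¹ · σ(a x)`, so that `L_V` differentiates along the vector field generated by `V`. -/
def lieE (F : Type*) [NormedAddCommGroup F] [NormedSpace ℂ F]
    {E : M → Type*} [TopologicalSpace (TotalSpace F E)]
    [∀ x, AddCommGroup (E x)] [∀ x, Module ℂ (E x)] [∀ x, TopologicalSpace (E x)]
    [FiberBundle F E] [VectorBundle ℝ F E]
    (ρ : ∀ (a : G) (x : M), E x ≃ₗ[ℂ] E (a • x)) (V : LieAlg EG G)
    (σ : ∀ x : M, E x) (x : M) : E x :=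
  fibreDeriv F (fun a : G => (ρ a x).symm (σ (a • x))) V

/-- The infinitesimal action `L_V` on sections of `⋀^{p,*}(T^*M) ⊗ E`: the derivative at `a = 1` of
`a⁻¹ · s(a x)(da Y; da Z)`, the pull back of `s` by the action of `a`. -/
def lieForms (F : Type*) [NormedAddCommGroup F] [NormedSpace ℂ F]
    {E : M → Type*} [TopologicalSpace (TotalSpace F E)]
    [∀ x, AddCommGroup (E x)] [∀ x, Module ℂ (E x)] [∀ x, TopologicalSpace (E x)]
    [FiberBundle F E] [VectorBundle ℝ F E]
    (ρ : ∀ (a : G) (x : M), E x ≃ₗ[ℂ] E (a • x)) (V : LieAlg EG G) {p : ℕ}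
    (s : ∀ x : M, Forms (TM EM x) (E x) p) (x : M) : Forms (TM EM x) (E x) p :=
  ofValues fun q Y Z => fibreDeriv F (fun a : G => (ρ a x).symm
    (s (a • x) q (fun i => dAct EM a x (Y i)) (fun j => dAct EM a x (Z j)))) V

/-- The endomorphism `r_V^E = L_V^E - ∇^E_V` of `E`, at `v ∈ E_x` (extended to a local smooth
section). -/
def rE (covE : CovariantDerivative 𝓘(ℝ, EM) F E)
    (ρ : ∀ (a : G) (x : M), E x ≃ₗ[ℂ] E (a • x)) (V : LieAlg EG G) {x : M} (v : E x) : E x :=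
  lieE F ρ V (FiberBundle.extend F v) x - covE (FiberBundle.extend F v) x (killing EM V x)

/-- `r_V^E` acting on the factor `E` of `⋀^{p,*}(T^*M) ⊗ E`. -/
def rEForms (covE : CovariantDerivative 𝓘(ℝ, EM) F E)
    (ρ : ∀ (a : G) (x : M), E x ≃ₗ[ℂ] E (a • x)) (V : LieAlg EG G) {p : ℕ} {x : M}
    (η : Forms (TM EM x) (E x) p) : Forms (TM EM x) (E x) p :=
  ofValues fun q Y Z => rE covE ρ V (η q Y Z)

end Action

end TwistedSpinc

end

open scoped Manifold ContDiff TensorProduct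
open Bundle

noncomputable section

set_option linter.unusedSectionVars false

namespace TwistedSpinc

/-! ### Exterior and Clifford algebra on one tangent space -/

section Algebra

variable {T : Type*} [AddCommGroup T] [Module ℝ T] {N : Type*} [AddCommGroup N] [Module ℂ N]

/-! Write X = X^ℋ. Expanding the square gives D_T² = D² + (√-1 T/2){D, c(X)} - (T²/4) c(X)². The
Clifford relation says c(X)² = -|X|². Since the connection on forms is a Clifford connection
(`cov_cliffF`), the anticommutator is ∑ c(e_j) c(∇_{e_j} X) - 2∇_X (`dirac_anticommutator`,
`diracT_diracT`). The moment map equation gives X = 2 ∑ μ_i V_i (`hamField_normSqMoment`), so what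
remains is to express ∇_V, for a field V generated by the action, through the infinitesimal action
L_V.

This is `cov_killing`. Decompose ∇^{TM}_v = ∇^J_v + B_v, where ∇^J is the projected connection
`nablaJ` and B_v = (1/2) J (∇_v J) is skew and anticommutes with J. Both ∇^J_V and the bracket [V,
·] are compatible with g and J, so they differ by an endomorphism S that is skew and commutes with
J; vanishing torsion gives ∇V = S + B_V (`exists_nablaJ_sub_mlieBracket`). On E-valued forms, ∇_V -
L_V is therefore -r_V, minus the insertion of S into every argument, plus the spin correction (1/4)
∑ c(e_j) c(B_V e_j). Inserting S into the (1,0) arguments is ∑ A(e_j, ∇_{e_j} V), because A sees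
only the part of an endomorphism that commutes with J (`IsTypeP.sum_opA`). Inserting S into the
(0,1) arguments is -(1/4) ∑ c(e_j) c(S e_j) minus half the complex trace of S
(`IsTypeP.sum_cliffF`). The two Clifford sums merge into (1/4) ∑ c(e_j) c(∇_{e_j} V).

Finally the product rule is applied to X = 2 ∑ μ_i V_i. As dμ_i = g(JV_i, ·), each contraction of ∇X
differs from the combination of the same contractions of ∇V_i with coefficients 2μ_i by a rank-one
term, and these terms are c(JV_i) c(V_i), A(JV_i, V_i) and |V_i|². Closedness of the symplectic form
serves one purpose: it makes v ↦ B_v X anticommute with J (`diffB_J_left`), so that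
Tr[∇^{T^{(1,0)}M} X] is the complex trace of ∇X (`traceNabla10_eq`).

The covariant derivative and the infinitesimal action on forms are both handled through
`HasFormDeriv`, the derivative of a field of forms attached to a derivation of vector fields and a
derivation of sections of E. It exists by tensoriality and is unique, so formulas for it are checked
on smooth arguments and two such derivatives can be compared slot by slot. Smoothness of D s cannot
be read off from the basis e, which is only chosen pointwise; sums over e are rewritten in smooth
frames by Gram matrices (`sum_orthonormal_eq_gram`). -/

theorem wedge_apply {n : ℕ} (α : T →ₗ[ℝ] ℂ) (η : T [⋀^Fin n]→ₗ[ℝ] N) (v : Fin (n + 1) → T) :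
    wedge α η v = ∑ i : Fin (n + 1), (-1) ^ (i : ℕ) • α (v i) • η (i.removeNth v) := by
  simp [wedge, AlternatingMap.alternatizeUncurryFin_apply]

theorem contract_tmul {n : ℕ} (a : ℂ) (w : T) (η : T [⋀^Fin (n + 1)]→ₗ[ℝ] N) :
    contract (a ⊗ₜ[ℝ] w) η = a • η.curryLeft w := by
  simp [contract]

theorem contract_add {n : ℕ} (w z : ℂ ⊗[ℝ] T) (η : T [⋀^Fin (n + 1)]→ₗ[ℝ] N) :
    contract (w + z) η = contract w η + contract z η := by
  simp [contract]

theorem contract_smul {n : ℕ} (a : ℂ) (w : ℂ ⊗[ℝ] T) (η : T [⋀^Fin (n + 1)]→ₗ[ℝ] N) :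
    contract (a • w) η = a • contract w η := by
  simp [contract]

theorem contract_complex_smul {n : ℕ} (a : ℂ) (w : ℂ ⊗[ℝ] T) (η : T [⋀^Fin (n + 1)]→ₗ[ℝ] N) :
    contract w (a • η) = a • contract w η := by
  induction w using TensorProduct.induction_on with
  | zero => simp [contract]
  | tmul b v =>
    rw [contract_tmul, contract_tmul, smul_comm a b]
    rfl
  | add w z hw hz => rw [contract_add, contract_add, hw, hz, smul_add]

theorem wedge_complex_smul {n : ℕ} (a : ℂ) (α : T →ₗ[ℝ] ℂ) (η : T [⋀^Fin n]→ₗ[ℝ] N) :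
    wedge α (a • η) = a • wedge α η := by
  ext v
  simp only [wedge_apply, AlternatingMap.smul_apply, Finset.smul_sum]
  exact Finset.sum_congr rfl fun i _ => by
    rw [smul_comm (α (v i)) a, smul_comm _ a]

/-- The sign of removing slot k cancels the sign of moving w from the front into slot k. Hence α ∧
i_w is the derivation induced by the rank-one endomorphism v ↦ α(v) w; this is how the Clifford sums
and A become insertions of endomorphisms into the arguments. -/
theorem wedge_contract_tmul {n : ℕ} (α : T →ₗ[ℝ] ℂ) (w : T) (η : T [⋀^Fin (n + 1)]→ₗ[ℝ] N)
    (v : Fin (n + 1) → T) :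
    wedge α (contract ((1 : ℂ) ⊗ₜ[ℝ] w) η) v
      = ∑ k, α (v k) • η (Function.update v k w) := by
  rw [wedge_apply]
  refine Finset.sum_congr rfl fun k _ => ?_
  rw [contract_tmul, one_smul, AlternatingMap.curryLeft_apply_apply, smul_comm,
    ← AlternatingMap.neg_one_pow_smul_map_insertNth, smul_smul, ← pow_add, Even.neg_one_pow ⟨_, rfl⟩,
    one_smul, Fin.insertNth_removeNth]

/-- Both double products are alternatizations of α ⊗ β ⊗ η and β ⊗ α ⊗ η; their sum is symmetric in
the first two variables and is killed by alternatization. -/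
theorem wedge_wedge {n : ℕ} (α β : T →ₗ[ℝ] ℂ) (η : T [⋀^Fin n]→ₗ[ℝ] N) :
    wedge α (wedge β η) + wedge β (wedge α η) = 0 := by
  let f (α β : T →ₗ[ℝ] ℂ) : T →ₗ[ℝ] T →ₗ[ℝ] T [⋀^Fin n]→ₗ[ℝ] N :=
    LinearMap.mk₂ ℝ (fun x y => α x • β y • η)
      (fun _ _ _ => by rw [map_add, add_smul]) (fun _ _ _ => by rw [map_smul, smul_assoc])
      (fun _ _ _ => by rw [map_add, add_smul, smul_add])
      (fun _ _ _ => by rw [map_smul, smul_assoc, smul_comm])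
  have key : ∀ α β : T →ₗ[ℝ] ℂ, wedge α (wedge β η) = AlternatingMap.alternatizeUncurryFin
      (AlternatingMap.alternatizeUncurryFinLM ∘ₗ f α β) := by
    intro α β
    ext v
    rw [wedge_apply, AlternatingMap.alternatizeUncurryFin_apply]
    refine Finset.sum_congr rfl fun i _ => ?_
    rw [LinearMap.comp_apply, AlternatingMap.alternatizeUncurryFinLM_apply, wedge_apply,
      AlternatingMap.alternatizeUncurryFin_apply, Finset.smul_sum]
    congr 1
    refine Finset.sum_congr rfl fun j _ => ?_
    simp only [f, LinearMap.mk₂_apply, AlternatingMap.smul_apply]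
    rw [smul_comm]
  rw [key, key, ← AlternatingMap.alternatizeUncurryFin_add, ← LinearMap.comp_add]
  apply AlternatingMap.alternatizeUncurryFin_alternatizeUncurryFinLM_comp_of_symmetric
  intro x y
  simp only [f, LinearMap.add_apply, LinearMap.mk₂_apply]
  rw [smul_comm (α x), smul_comm (β x), add_comm]

theorem contract_contract {n : ℕ} (w z : ℂ ⊗[ℝ] T) (η : T [⋀^Fin (n + 2)]→ₗ[ℝ] N) :
    contract w (contract z η) + contract z (contract w η) = 0 := by
  induction w using TensorProduct.induction_on with
  | zero => simp [contract]
  | add w₁ w₂ h₁ h₂ =>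
    rw [contract_add, contract_add, map_add, add_add_add_comm, h₁, h₂, add_zero]
  | tmul a v =>
    induction z using TensorProduct.induction_on with
    | zero => simp [contract]
    | add w₁ w₂ h₁ h₂ =>
      rw [contract_add, contract_add, map_add, add_add_add_comm, h₁, h₂, add_zero]
    | tmul b u =>
      have h : (η.curryLeft u).curryLeft v + (η.curryLeft v).curryLeft u = 0 := by
        have h := AlternatingMap.curryLeft_same η (u + v)
        simpa [add_comm] using h
      simp only [contract_tmul, contract_complex_smul]
      rw [smul_comm b a, ← smul_add, ← smul_add, h, smul_zero, smul_zero]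

/-- Expand α ∧ η with w in the first argument: the term where α eats w is α(w) η, and each of the
others cancels a term of α ∧ i_w η. -/
theorem contract_wedge {n : ℕ} (α : T →ₗ[ℝ] ℂ) (w : ℂ ⊗[ℝ] T) (η : T [⋀^Fin (n + 1)]→ₗ[ℝ] N) :
    contract w (wedge α η) + wedge α (contract w η) = α.liftBaseChange ℂ w • η := by
  induction w using TensorProduct.induction_on with
  | zero => simp [contract]
  | add w₁ w₂ h₁ h₂ =>
    rw [contract_add, contract_add, map_add, map_add, add_add_add_comm, h₁, h₂, add_smul]
  | tmul a v =>
    rw [contract_tmul, contract_tmul, wedge_complex_smul, LinearMap.liftBaseChange_tmul,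
      smul_assoc, ← smul_add]
    congr 1
    ext u
    rw [AlternatingMap.add_apply, AlternatingMap.curryLeft_apply_apply, wedge_apply, wedge_apply,
      Fin.sum_univ_succ, AlternatingMap.smul_apply, add_assoc, ← Finset.sum_add_distrib]
    rw [Finset.sum_eq_zero, add_zero]
    · simp [Matrix.vecCons]
    · intro i _
      have h : Fin.removeNth i.succ (Matrix.vecCons v u) = Matrix.vecCons v (i.removeNth u) := by
        ext j
        cases j using Fin.cases <;> simp [Fin.removeNth]
      rw [AlternatingMap.curryLeft_apply_apply, h, Fin.val_succ, pow_succ, Matrix.cons_val_succ]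
      simp

theorem contract_wedge_zero (α : T →ₗ[ℝ] ℂ) (w : ℂ ⊗[ℝ] T) (η : T [⋀^Fin 0]→ₗ[ℝ] N) :
    contract w (wedge α η) = α.liftBaseChange ℂ w • η := by
  induction w using TensorProduct.induction_on with
  | zero => simp [contract]
  | add w₁ w₂ h₁ h₂ =>
    rw [contract_add, map_add, h₁, h₂, add_smul]
  | tmul a v =>
    rw [contract_tmul, LinearMap.liftBaseChange_tmul, smul_assoc]
    congr 1
    ext u
    rw [AlternatingMap.curryLeft_apply_apply, wedge_apply]
    simp [Matrix.vecCons]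

/-- `wedge` acting on the second factor of `Forms`, as a complex linear endomorphism. -/
def wedgeF {p : ℕ} (α : T →ₗ[ℝ] ℂ) : Module.End ℂ (Forms T N p) where
  toFun η
    | 0 => 0
    | q + 1 => (wedge α).compAlternatingMap (η q)
  map_add' η θ := by
    funext q
    cases q with
    | zero => simp
    | succ q => ext; simp
  map_smul' a η := by
    funext q
    cases q with
    | zero => simp
    | succ q =>
      refine AlternatingMap.ext fun Y => ?_
      simp [wedge_complex_smul]

/-- `contract` acting on the second factor of `Forms`, as a complex linear endomorphism. -/
def contractF {p : ℕ} (w : ℂ ⊗[ℝ] T) : Module.End ℂ (Forms T N p) where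
  toFun η q := (contract w).compAlternatingMap (η (q + 1))
  map_add' η θ := by
    funext q
    ext; simp
  map_smul' a η := by
    funext q
    refine AlternatingMap.ext fun Y => ?_
    simp [contract_complex_smul]

theorem wedgeF_apply_zero {p : ℕ} (α : T →ₗ[ℝ] ℂ) (η : Forms T N p) : wedgeF α η 0 = 0 := rfl

theorem wedgeF_apply_succ {p : ℕ} (α : T →ₗ[ℝ] ℂ) (η : Forms T N p) (q : ℕ) (Y : Fin p → T) :
    wedgeF α η (q + 1) Y = wedge α (η q Y) := rfl

theorem contractF_apply {p : ℕ} (w : ℂ ⊗[ℝ] T) (η : Forms T N p) (q : ℕ) (Y : Fin p → T) :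
    contractF w η q Y = contract w (η (q + 1) Y) := rfl

theorem wedgeF_mul_add {p : ℕ} (α β : T →ₗ[ℝ] ℂ) :
    wedgeF α * wedgeF β + wedgeF β * wedgeF α = (0 : Module.End ℂ (Forms T N p)) := by
  refine LinearMap.ext fun η => funext fun q => AlternatingMap.ext fun Y => ?_
  match q with
  | 0 => simp [wedgeF_apply_zero]
  | 1 =>
    change wedge α (wedgeF β η 0 Y) + wedge β (wedgeF α η 0 Y) = 0
    simp [wedgeF_apply_zero]
  | q + 2 => exact wedge_wedge α β (η q Y)

theorem contractF_mul_add {p : ℕ} (w z : ℂ ⊗[ℝ] T) :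
    contractF w * contractF z + contractF z * contractF w
      = (0 : Module.End ℂ (Forms T N p)) :=
  LinearMap.ext fun η => funext fun q => AlternatingMap.ext fun Y =>
    contract_contract w z (η (q + 2) Y)

/-- In degree zero there is no form left to contract. Since `wedgeF` produces 0 in that degree, the
relation keeps the same shape in all degrees. -/
theorem contractF_mul_wedgeF {p : ℕ} (α : T →ₗ[ℝ] ℂ) (w : ℂ ⊗[ℝ] T) :
    contractF w * wedgeF α + wedgeF α * contractF w
      = α.liftBaseChange ℂ w • (1 : Module.End ℂ (Forms T N p)) := by
  refine LinearMap.ext fun η => funext fun q => AlternatingMap.ext fun Y => ?_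
  match q with
  | 0 =>
    change contract w (wedge α (η 0 Y)) + 0 = α.liftBaseChange ℂ w • η 0 Y
    rw [add_zero, contract_wedge_zero]
  | q + 1 => exact contract_wedge α w (η (q + 1) Y)

theorem wedgeF_add {p : ℕ} (α β : T →ₗ[ℝ] ℂ) :
    wedgeF (α + β) = (wedgeF α + wedgeF β : Module.End ℂ (Forms T N p)) := by
  refine LinearMap.ext fun η => funext fun q => AlternatingMap.ext fun Y => ?_
  match q with
  | 0 => simp [wedgeF_apply_zero]
  | q + 1 =>
    change wedge (α + β) (η q Y) = wedge α (η q Y) + wedge β (η q Y)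
    ext Z
    simp [wedge_apply, add_smul, Finset.sum_add_distrib]

theorem wedgeF_smul {p : ℕ} (a : ℂ) (α : T →ₗ[ℝ] ℂ) :
    wedgeF (a • α) = (a • wedgeF α : Module.End ℂ (Forms T N p)) := by
  refine LinearMap.ext fun η => funext fun q => AlternatingMap.ext fun Y => ?_
  match q with
  | 0 => simp [wedgeF_apply_zero]
  | q + 1 =>
    change wedge (a • α) (η q Y) = a • wedge α (η q Y)
    ext Z
    simp only [wedge_apply, LinearMap.smul_apply, smul_assoc, AlternatingMap.smul_apply,
      Finset.smul_sum]
    exact Finset.sum_congr rfl fun i _ => by rw [smul_comm]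

theorem contractF_add {p : ℕ} (w z : ℂ ⊗[ℝ] T) :
    contractF (w + z) = (contractF w + contractF z : Module.End ℂ (Forms T N p)) :=
  LinearMap.ext fun _ => funext fun _ => AlternatingMap.ext fun _ => contract_add w z _

theorem contractF_smul {p : ℕ} (a : ℂ) (w : ℂ ⊗[ℝ] T) :
    contractF (a • w) = (a • contractF w : Module.End ℂ (Forms T N p)) :=
  LinearMap.ext fun _ => funext fun _ => AlternatingMap.ext fun _ => contract_smul a w _

theorem dualForm_pr10 (g : T →ₗ[ℝ] T →ₗ[ℝ] ℝ) (J : T →ₗ[ℝ] T) (X Z : T) :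
    dualForm g (pr10 J (1 ⊗ₜ X)) Z = (1 / 2 : ℂ) * (g X Z - Complex.I * g (J X) Z) := by
  simp [dualForm, pr10, complexJ, mul_sub]

theorem dualForm_pr01 (g : T →ₗ[ℝ] T →ₗ[ℝ] ℝ) (J : T →ₗ[ℝ] T) (X Z : T) :
    dualForm g (pr01 J (1 ⊗ₜ X)) Z = (1 / 2 : ℂ) * (g X Z + Complex.I * g (J X) Z) := by
  simp [dualForm, pr01, complexJ, mul_add]

theorem liftBaseChange_pr01 (α : T →ₗ[ℝ] ℂ) (J : T →ₗ[ℝ] T) (X : T) :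
    α.liftBaseChange ℂ (pr01 J (1 ⊗ₜ X)) = (1 / 2 : ℂ) * (α X + Complex.I * α (J X)) := by
  simp [pr01, complexJ, mul_add]

/-- `X ↦ X̄₁^* ∧ ·`. -/
def wedgeL (g : T →ₗ[ℝ] T →ₗ[ℝ] ℝ) (J : T →ₗ[ℝ] T) {p : ℕ} :
    T →ₗ[ℝ] Module.End ℂ (Forms T N p) where
  toFun X := wedgeF (dualForm g (pr10 J (1 ⊗ₜ X)))
  map_add' X Y := by
    rw [← wedgeF_add]
    simp [dualForm, TensorProduct.tmul_add]
  map_smul' r X := by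
    have h : dualForm g ((r : ℂ) • pr10 J (1 ⊗ₜ X)) = (r : ℂ) • dualForm g (pr10 J (1 ⊗ₜ X)) := by
      simp [dualForm]
    have h1 : (1 : ℂ) ⊗ₜ[ℝ] (r • X) = (r : ℂ) • ((1 : ℂ) ⊗ₜ[ℝ] X) := by
      simp [TensorProduct.smul_tmul', TensorProduct.tmul_smul]
    rw [h1, map_smul, h, wedgeF_smul]
    rfl

/-- `X ↦ i_{X₂}`. -/
def contractL (J : T →ₗ[ℝ] T) {p : ℕ} : T →ₗ[ℝ] Module.End ℂ (Forms T N p) where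
  toFun X := contractF (pr01 J (1 ⊗ₜ X))
  map_add' X Y := by
    rw [← contractF_add, TensorProduct.tmul_add, map_add]
  map_smul' r X := by
    have h1 : (1 : ℂ) ⊗ₜ[ℝ] (r • X) = (r : ℂ) • ((1 : ℂ) ⊗ₜ[ℝ] X) := by
      simp [TensorProduct.smul_tmul', TensorProduct.tmul_smul]
    rw [h1, map_smul, contractF_smul]
    rfl

theorem wedgeL_apply (g : T →ₗ[ℝ] T →ₗ[ℝ] ℝ) (J : T →ₗ[ℝ] T) {p : ℕ} (X : T) :
    wedgeL g J X = (wedgeF (dualForm g (pr10 J (1 ⊗ₜ X))) : Module.End ℂ (Forms T N p)) := rfl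

theorem contractL_apply (J : T →ₗ[ℝ] T) {p : ℕ} (X : T) :
    contractL J X = (contractF (pr01 J (1 ⊗ₜ X)) : Module.End ℂ (Forms T N p)) := rfl

/-- The Clifford action as a complex linear endomorphism, linear in the vector. -/
def cliffF (g : T →ₗ[ℝ] T →ₗ[ℝ] ℝ) (J : T →ₗ[ℝ] T) {p : ℕ} :
    T →ₗ[ℝ] Module.End ℂ (Forms T N p) where
  toFun X := ((√2 : ℝ) : ℂ) • (wedgeF (dualForm g (pr10 J (1 ⊗ₜ X))) - contractF (pr01 J (1 ⊗ₜ X)))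
  map_add' X Y := by
    rw [← wedgeL_apply, ← contractL_apply, map_add, map_add, wedgeL_apply, wedgeL_apply,
      contractL_apply, contractL_apply]
    module
  map_smul' r X := by
    rw [← wedgeL_apply, ← contractL_apply, map_smul, map_smul, wedgeL_apply, contractL_apply]
    refine LinearMap.ext fun η => ?_
    have h2 : ∀ θ : Forms T N p, r • θ = (r : ℂ) • θ := fun θ => rfl
    simp only [LinearMap.smul_apply, LinearMap.sub_apply, RingHom.id_apply, h2]
    module

theorem cliffF_eq (g : T →ₗ[ℝ] T →ₗ[ℝ] ℝ) (J : T →ₗ[ℝ] T) (X : T) {p : ℕ} :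
    cliffF (N := N) (p := p) g J X = ((√2 : ℝ) : ℂ) •
      (wedgeF (dualForm g (pr10 J (1 ⊗ₜ X))) - contractF (pr01 J (1 ⊗ₜ X))) := rfl

theorem cliffF_apply (g : T →ₗ[ℝ] T →ₗ[ℝ] ℝ) (J : T →ₗ[ℝ] T) (X : T) {p : ℕ}
    (η : Forms T N p) (q : ℕ) (Y : Fin p → T) :
    cliffF g J X η q Y = ((√2 : ℝ) : ℂ) • (wedgeF (dualForm g (pr10 J (1 ⊗ₜ X))) η q Y
      - contract (pr01 J (1 ⊗ₜ X)) (η (q + 1) Y)) := rfl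

theorem cliff_eq_cliffF (g : T →ₗ[ℝ] T →ₗ[ℝ] ℝ) (J : T →ₗ[ℝ] T) (X : T) {p : ℕ}
    (η : Forms T N p) : cliff g J X η = cliffF g J X η := by
  funext q
  refine AlternatingMap.ext fun Y => ?_
  match q with
  | 0 =>
    rw [cliffF_apply, wedgeF_apply_zero, AlternatingMap.zero_apply, zero_sub, smul_neg, ← neg_smul,
      ← Complex.ofReal_neg, Complex.coe_smul]
    rfl
  | q + 1 =>
    rw [cliffF_apply, wedgeF_apply_succ, Complex.coe_smul, smul_sub]
    rfl

/-- Of the four anticommutators in the product only the two mixed ones survive; r = √2 supplies the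
factor 2. -/
theorem anticomm_of_car {V : Type*} [AddCommGroup V] [Module ℂ V] {a b w z : Module.End ℂ V}
    {r k l m : ℂ} (h1 : a * b + b * a = 0) (h2 : w * z + z * w = 0) (h3 : z * a + a * z = k • 1)
    (h4 : w * b + b * w = l • 1) (hr : r * r = 2) (hm : -2 * (k + l) = m) :
    (r • (a - w)) * (r • (b - z)) + (r • (b - z)) * (r • (a - w)) = m • 1 := by
  have : (a - w) * (b - z) + (b - z) * (a - w)
      = (a * b + b * a) + (w * z + z * w) - (z * a + a * z) - (w * b + b * w) := by
    noncomm_ring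
  rw [smul_mul_smul_comm, smul_mul_smul_comm, hr, ← smul_add, this, h1, h2, h3, h4, ← hm]
  module

/-- Pairing the dual form of X₁ with Y₂ gives (g(X,Y) - √-1 g(JX,Y))/2. The Clifford relation adds
the same pairing with X and Y exchanged, and the imaginary parts cancel because g(JX,Y) is skew in X
and Y. -/
theorem cliffF_mul_add {g : T →ₗ[ℝ] T →ₗ[ℝ] ℝ} {J : T →ₗ[ℝ] T} (hJ : ∀ v, J (J v) = -v)
    (hs : ∀ u v, g u v = g v u) (hg : ∀ u v, g (J u) (J v) = g u v) (X Y : T) {p : ℕ} :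
    cliffF g J X * cliffF g J Y + cliffF g J Y * cliffF g J X
      = ((-2 * g X Y : ℝ) : ℂ) • (1 : Module.End ℂ (Forms T N p)) := by
  have hg' : ∀ u v, g u (J v) = -g (J u) v := fun u v => by
    rw [← hg u (J v), hJ, map_neg]
  have hα : ∀ X Y, (dualForm g (pr10 J (1 ⊗ₜ X))).liftBaseChange ℂ (pr01 J (1 ⊗ₜ Y))
      = (1 / 2 : ℂ) * (g X Y - Complex.I * g (J X) Y) := by
    intro X Y
    rw [liftBaseChange_pr01, dualForm_pr10, dualForm_pr10, hg, hg']
    push_cast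
    linear_combination (-(1 / 4 : ℂ) * g X Y) * Complex.I_mul_I
  have h2 : ((√2 : ℝ) : ℂ) * ((√2 : ℝ) : ℂ) = 2 := by
    rw [← Complex.ofReal_mul, Real.mul_self_sqrt (by norm_num)]; norm_num
  have hs' : (g (J Y) X : ℂ) = -g (J X) Y := by
    rw [hs, hg' X Y]; push_cast; ring
  set a := dualForm g (pr10 J (1 ⊗ₜ X)) with ha
  set b := dualForm g (pr10 J (1 ⊗ₜ Y)) with hb
  set w := pr01 J (1 ⊗ₜ X) with hw
  set z := pr01 J (1 ⊗ₜ Y) with hz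
  have e1 := wedgeF_mul_add (N := N) (p := p) a b
  have e2 := contractF_mul_add (N := N) (p := p) w z
  have e3 := contractF_mul_wedgeF (N := N) (p := p) a z
  have e4 := contractF_mul_wedgeF (N := N) (p := p) b w
  rw [ha, hz, hα] at e3
  rw [hb, hw, hα, hs, hs'] at e4
  rw [cliffF_eq, cliffF_eq]
  refine anticomm_of_car e1 e2 e3 e4 h2 ?_
  push_cast
  ring

end Algebra

/-! ### Orthonormal contractions and forms of given type -/

section Algebra

variable {T : Type*} [AddCommGroup T] [Module ℝ T] {N : Type*} [AddCommGroup N] [Module ℂ N]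

/-- `J` is a complex structure and `g` a symmetric form for which `J` is orthogonal. -/
structure IsHermitianPair (g : T →ₗ[ℝ] T →ₗ[ℝ] ℝ) (J : T →ₗ[ℝ] T) : Prop where
  sq : ∀ v, J (J v) = -v
  symm : ∀ u v, g u v = g v u
  orth : ∀ u v, g (J u) (J v) = g u v

theorem IsHermitianPair.skew {g : T →ₗ[ℝ] T →ₗ[ℝ] ℝ} {J : T →ₗ[ℝ] T} (h : IsHermitianPair g J)
    (u v : T) : g u (J v) = -g (J u) v := by
  rw [← h.orth u (J v), h.sq, map_neg]

theorem eq_zero_of_neg_eq {W : Type*} [AddCommGroup W] [Module ℂ W] {x : W} (h : -x = x) :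
    x = 0 := by
  have h1 : x = (1 / 2 : ℂ) • (x + x) := by module
  rw [h1]
  nth_rewrite 1 [← h]
  rw [neg_add_cancel, smul_zero]

section Orthonormal

variable {m : ℕ} {g : T →ₗ[ℝ] T →ₗ[ℝ] ℝ} {e : Module.Basis (Fin m) ℝ T}

theorem repr_eq_of_orthonormal (he : ∀ i j, g (e i) (e j) = if i = j then 1 else 0) (v : T)
    (j : Fin m) : e.repr v j = g (e j) v := by
  conv_rhs => rw [← e.sum_repr v, map_sum]
  simp only [map_smul, he, smul_eq_mul, mul_ite, mul_one, mul_zero, Finset.sum_ite_eq,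
    Finset.mem_univ, if_true]

theorem sum_inner_smul (he : ∀ i j, g (e i) (e j) = if i = j then 1 else 0) (v : T) :
    ∑ j, g (e j) v • e j = v := by
  conv_rhs => rw [← e.sum_repr v]
  simp only [repr_eq_of_orthonormal he]

theorem trace_eq_sum_inner (he : ∀ i j, g (e i) (e j) = if i = j then 1 else 0) (S : T →ₗ[ℝ] T) :
    LinearMap.trace ℝ T S = ∑ j, g (e j) (S (e j)) := by
  rw [LinearMap.trace_eq_matrix_trace ℝ e, Matrix.trace]
  simp [LinearMap.toMatrix_apply, repr_eq_of_orthonormal he]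

/-- Expand S e_j in the basis: the matrix of S is skew, so exchanging the two summation indices
changes the sign. -/
theorem sum_skew_left {V : Type*} [AddCommGroup V] [Module ℝ V]
    (he : ∀ i j, g (e i) (e j) = if i = j then 1 else 0) (hs : ∀ u v, g u v = g v u)
    (S : T →ₗ[ℝ] T) (hS : ∀ u v, g (S u) v = -g u (S v)) (β : T →ₗ[ℝ] T →ₗ[ℝ] V) :
    ∑ j, β (S (e j)) (e j) = -∑ j, β (e j) (S (e j)) := by
  have h : ∀ j, β (S (e j)) (e j) = ∑ k, g (e k) (S (e j)) • β (e k) (e j) := fun j => by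
    conv_lhs => rw [← sum_inner_smul he (S (e j))]
    simp
  have h' : ∀ j, β (e j) (S (e j)) = ∑ k, g (e k) (S (e j)) • β (e j) (e k) := fun j => by
    conv_lhs => rw [← sum_inner_smul he (S (e j))]
    simp
  simp only [h, h']
  rw [Finset.sum_comm, ← Finset.sum_neg_distrib]
  refine Finset.sum_congr rfl fun j _ => ?_
  rw [← Finset.sum_neg_distrib]
  refine Finset.sum_congr rfl fun k _ => ?_
  rw [← neg_smul, hs (e k), hS, neg_neg]

/-- J carries an orthonormal basis to an orthonormal basis. Formally this is the previous lemma for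
the skew map J itself, using J² = -1. -/
theorem sum_complex_invariant {V : Type*} [AddCommGroup V] [Module ℝ V] {J : T →ₗ[ℝ] T}
    (h : IsHermitianPair g J)
    (he : ∀ i j, g (e i) (e j) = if i = j then 1 else 0) (β : T →ₗ[ℝ] T →ₗ[ℝ] V) :
    ∑ j, β (J (e j)) (J (e j)) = ∑ j, β (e j) (e j) := by
  have := sum_skew_left he h.symm J (fun u v => by rw [h.skew, neg_neg]) (β.compl₂ J)
  simpa [h.sq] using this

/-- Here a models u ↦ ū₁^* ∧ and w models u ↦ i_{u₂}. Replacing e_j by J e_j leaves the contractions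
unchanged, but multiplies the a·a and w·w sums by (±√-1)² = -1, so these vanish. The two mixed sums
agree, by skewness of S, up to the scalar produced by the relation between w and a. -/
theorem sum_mul_of_car {V : Type*} [AddCommGroup V] [Module ℂ V] {J : T →ₗ[ℝ] T}
    (h : IsHermitianPair g J) (he : ∀ i j, g (e i) (e j) = if i = j then 1 else 0)
    {a w : T → Module.End ℂ V} (ha : ∀ u v, a (u + v) = a u + a v)
    (ha' : ∀ (r : ℝ) u, a (r • u) = (r : ℂ) • a u) (hw : ∀ u v, w (u + v) = w u + w v)
    (hw' : ∀ (r : ℝ) u, w (r • u) = (r : ℂ) • w u) (haJ : ∀ u, a (J u) = Complex.I • a u)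
    (hwJ : ∀ u, w (J u) = -(Complex.I • w u)) {k : T → T → ℂ}
    (hk : ∀ u v, w u * a v + a v * w u = k u v • 1) (S : T →ₗ[ℝ] T)
    (hS : ∀ u v, g (S u) v = -g u (S v)) (hSJ : ∀ u, S (J u) = J (S u)) :
    ∑ j, (a (e j) - w (e j)) * (a (S (e j)) - w (S (e j)))
      = -(2 : ℂ) • ∑ j, a (e j) * w (S (e j)) - (∑ j, k (e j) (S (e j))) • 1 := by
  have hr : ∀ (r : ℝ) (f : Module.End ℂ V), r • f = (r : ℂ) • f := fun r f => rfl
  let β (b c : T → Module.End ℂ V) (hb : ∀ u v, b (u + v) = b u + b v)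
      (hb' : ∀ (r : ℝ) u, b (r • u) = (r : ℂ) • b u) (hc : ∀ u v, c (u + v) = c u + c v)
      (hc' : ∀ (r : ℝ) u, c (r • u) = (r : ℂ) • c u) : T →ₗ[ℝ] T →ₗ[ℝ] Module.End ℂ V :=
    LinearMap.mk₂ ℝ (fun u v => b u * c v) (fun u v z => by rw [hb, add_mul])
      (fun r u v => by rw [hb', smul_mul_assoc, hr]) (fun u v z => by rw [hc, mul_add])
      (fun r u v => by rw [hc', mul_smul_comm, hr])
  have h1 : ∑ j, a (e j) * a (S (e j)) = 0 := by
    have := sum_complex_invariant h he ((β a a ha ha' ha ha').compl₂ S)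
    simp only [β, LinearMap.compl₂_apply, LinearMap.mk₂_apply, hSJ, haJ] at this
    simp only [smul_mul_smul_comm, Complex.I_mul_I, neg_smul, one_smul,
      Finset.sum_neg_distrib] at this
    exact eq_zero_of_neg_eq this
  have h2 : ∑ j, w (e j) * w (S (e j)) = 0 := by
    have := sum_complex_invariant h he ((β w w hw hw' hw hw').compl₂ S)
    simp only [β, LinearMap.compl₂_apply, LinearMap.mk₂_apply, hSJ, hwJ] at this
    simp only [neg_mul_neg, smul_mul_smul_comm, Complex.I_mul_I, neg_smul, one_smul,
      Finset.sum_neg_distrib] at this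
    exact eq_zero_of_neg_eq this
  have h3 : ∑ j, a (S (e j)) * w (e j) = -∑ j, a (e j) * w (S (e j)) :=
    sum_skew_left he h.symm S hS (β a w ha ha' hw hw')
  have h4 : ∀ j, (a (e j) - w (e j)) * (a (S (e j)) - w (S (e j)))
      = a (e j) * a (S (e j)) + w (e j) * w (S (e j)) - a (e j) * w (S (e j))
        - (k (e j) (S (e j)) • 1 - a (S (e j)) * w (e j)) := fun j => by
    rw [← hk]; noncomm_ring
  simp only [h4, Finset.sum_sub_distrib, Finset.sum_add_distrib, h1, h2, h3, Finset.sum_smul]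
  module

end Orthonormal

section OfType

variable {g : T →ₗ[ℝ] T →ₗ[ℝ] ℝ} {J : T →ₗ[ℝ] T} {p : ℕ}

theorem IsTypeP.left {η : Forms T N p} (h : IsTypeP J η) (q : ℕ) (Y : Fin p → T) (i : Fin p)
    (w : T) : η q (Function.update Y i (J w)) = Complex.I • η q (Function.update Y i w) := by
  ext Z
  simpa using (h q (Function.update Y i w) Z).1 i

theorem IsTypeP.right {η : Forms T N p} (h : IsTypeP J η) (q : ℕ) (Y : Fin p → T)
    (Z : Fin q → T) (i : Fin q) (w : T) :
    η q Y (Function.update Z i (J w)) = -(Complex.I • η q Y (Function.update Z i w)) := by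
  simpa using (h q Y (Function.update Z i w)).2 i

theorem IsTypeP.add {η θ : Forms T N p} (h : IsTypeP J η) (h' : IsTypeP J θ) :
    IsTypeP J (η + θ) := fun q Y Z =>
  ⟨fun i => by simp [(h q Y Z).1 i, (h' q Y Z).1 i],
    fun j => by simp [(h q Y Z).2 j, (h' q Y Z).2 j, add_comm]⟩

theorem IsTypeP.smul {η : Forms T N p} (h : IsTypeP J η) (a : ℂ) : IsTypeP J (a • η) :=
  fun q Y Z =>
  ⟨fun i => by simp [(h q Y Z).1 i, smul_comm a Complex.I],
    fun j => by simp [(h q Y Z).2 j, smul_comm a Complex.I]⟩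

theorem IsTypeP.sum {ι : Type*} {t : Finset ι} {η : ι → Forms T N p}
    (h : ∀ i ∈ t, IsTypeP J (η i)) : IsTypeP J (∑ i ∈ t, η i) :=
  Finset.sum_induction _ (IsTypeP J) (fun _ _ => IsTypeP.add) (fun q Y Z => by simp) h

/-- The (1,0) component of X contracts to zero with a (0,q)-form, so the projection may be dropped
and the contraction taken with the real vector X. -/
theorem IsTypeP.contract_pr01 {η : Forms T N p} (h : IsTypeP J η) (q : ℕ) (Y : Fin p → T)
    (X : T) : contract (pr01 J (1 ⊗ₜ X)) (η (q + 1) Y) = (η (q + 1) Y).curryLeft X := by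
  have h1 : (η (q + 1) Y).curryLeft (J X) = -(Complex.I • (η (q + 1) Y).curryLeft X) := by
    ext Z
    simpa [Matrix.vecCons, Fin.update_cons_zero] using h.right (q + 1) Y (Matrix.vecCons X Z) 0 X
  have h2 : pr01 J ((1 : ℂ) ⊗ₜ[ℝ] X) = (1 / 2 : ℂ) • ((1 : ℂ) ⊗ₜ[ℝ] X + Complex.I ⊗ₜ[ℝ] J X) := by
    simp [pr01, complexJ, TensorProduct.smul_tmul']
  rw [h2, contract_smul, contract_add, contract_tmul, contract_tmul, h1, smul_neg, smul_smul,
    Complex.I_mul_I]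
  module

theorem dualForm_pr10_J (hp : IsHermitianPair g J) (X v : T) :
    dualForm g (pr10 J (1 ⊗ₜ X)) (J v) = -(Complex.I * dualForm g (pr10 J (1 ⊗ₜ X)) v) := by
  rw [dualForm_pr10, dualForm_pr10, hp.orth, hp.skew]
  push_cast
  linear_combination (-(1 / 2 : ℂ) * g (J X) v) * Complex.I_mul_I

/-- The dual of a (1,0) vector is a (0,1) form. In each term of the product the changed argument
sits either in this form or in η, and both are antilinear for J there. -/
theorem IsTypeP.wedgeF_isTypeP (hp : IsHermitianPair g J) {η : Forms T N p} (h : IsTypeP J η) (X : T) :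
    IsTypeP J (wedgeF (dualForm g (pr10 J (1 ⊗ₜ X))) η) := by
  intro q Y Z
  match q with
  | 0 => simp [wedgeF_apply_zero]
  | q + 1 =>
    constructor
    · intro i
      rw [wedgeF_apply_succ, wedgeF_apply_succ, h.left, wedge_complex_smul, Function.update_eq_self]
      rfl
    · intro j
      rw [wedgeF_apply_succ, wedge_apply, wedge_apply, Finset.smul_sum, ← Finset.sum_neg_distrib]
      refine Finset.sum_congr rfl fun k _ => ?_
      rcases eq_or_ne k j with rfl | hkj
      · rw [Function.update_self, Fin.removeNth_update, dualForm_pr10_J hp, neg_smul, smul_neg,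
          mul_smul, smul_comm Complex.I ((-1) ^ (k : ℕ) : ℤ)]
      · obtain ⟨l, rfl⟩ := Fin.exists_succAbove_eq hkj.symm
        rw [Function.update_of_ne hkj, Fin.removeNth_update_succAbove,
          ← Fin.removeNth_apply k Z l, (h q Y (k.removeNth Z)).2 l]
        rw [smul_neg, smul_neg, smul_comm Complex.I ((-1) ^ (k : ℕ) : ℤ),
          smul_comm Complex.I (dualForm g _ _)]

theorem IsTypeP.contractF_isTypeP {η : Forms T N p} (h : IsTypeP J η) (X : T) :
    IsTypeP J (contractF (pr01 J (1 ⊗ₜ X)) η) := by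
  intro q Y Z
  simp only [contractF_apply]
  rw [h.contract_pr01, AlternatingMap.curryLeft_apply_apply]
  constructor
  · intro i
    rw [h.contract_pr01, AlternatingMap.curryLeft_apply_apply, (h _ _ _).1]
  · intro j
    rw [AlternatingMap.curryLeft_apply_apply, ← (h _ _ _).2 j.succ]
    congr 1
    exact (Fin.cons_update ..)

theorem IsTypeP.cliffF_isTypeP (hp : IsHermitianPair g J) {η : Forms T N p} (h : IsTypeP J η) (X : T) :
    IsTypeP J (cliffF g J X η) := by
  rw [cliffF_eq, LinearMap.smul_apply, LinearMap.sub_apply, sub_eq_add_neg, ← neg_one_smul ℂ]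
  exact ((h.wedgeF_isTypeP hp X).add ((h.contractF_isTypeP X).smul _)).smul _

end OfType

end Algebra

/-! ### Insertion of endomorphisms into forms, and complex traces -/

section Algebra

variable {T : Type*} [AddCommGroup T] [Module ℝ T] {N : Type*} [AddCommGroup N] [Module ℂ N]

theorem alternatingMap_sum_apply {ι κ V : Type*} [AddCommGroup V] [Module ℝ V] (t : Finset κ)
    (η : κ → T [⋀^ι]→ₗ[ℝ] V) (v : ι → T) : (∑ i ∈ t, η i) v = ∑ i ∈ t, η i v := by
  classical
  induction t using Finset.induction_on with
  | empty => simp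
  | insert a t ha ih => rw [Finset.sum_insert ha, Finset.sum_insert ha, AlternatingMap.add_apply, ih]

section Derivation

variable {g : T →ₗ[ℝ] T →ₗ[ℝ] ℝ} {J : T →ₗ[ℝ] T} {p m : ℕ} {e : Module.Basis (Fin m) ℝ T}

theorem Forms.sum_apply {ι : Type*} (t : Finset ι) (η : ι → Forms T N p) (q : ℕ)
    (Y : Fin p → T) (Z : Fin q → T) : (∑ i ∈ t, η i) q Y Z = ∑ i ∈ t, η i q Y Z := by
  rw [Finset.sum_apply, alternatingMap_sum_apply, alternatingMap_sum_apply]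

theorem Forms.ext {η θ : Forms T N p} (h : ∀ q Y Z, η q Y Z = θ q Y Z) : η = θ :=
  funext fun q => AlternatingMap.ext fun Y => AlternatingMap.ext fun Z => h q Y Z

theorem IsTypeP.wedgeF_contractF_apply {η : Forms T N p} (h : IsTypeP J η) (α : T →ₗ[ℝ] ℂ) (w : T)
    (q : ℕ) (Y : Fin p → T) (Z : Fin q → T) :
    wedgeF α (contractF (pr01 J (1 ⊗ₜ w)) η) q Y Z
      = ∑ k, α (Z k) • η q Y (Function.update Z k w) := by
  match q with
  | 0 => simp [wedgeF_apply_zero]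
  | q + 1 =>
    rw [wedgeF_apply_succ, contractF_apply, h.contract_pr01, ← wedge_contract_tmul, contract_tmul,
      one_smul]

/-- The dual form of the (1,0) part of e_j has the components g(e_j, z)/2 and √-1 g(e_j, Jz)/2.
Summation over the orthonormal basis inserts S z and S J z respectively; as S commutes with J and η
is antilinear in that argument, the two halves are equal. -/
theorem IsTypeP.sum_wedgeF_contractF {η : Forms T N p} (h : IsTypeP J η)
    (hp : IsHermitianPair g J) (he : ∀ i j, g (e i) (e j) = if i = j then 1 else 0)
    (S : T →ₗ[ℝ] T) (hSJ : ∀ u, S (J u) = J (S u)) (q : ℕ) (Y : Fin p → T) (Z : Fin q → T) :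
    (∑ j, wedgeF (dualForm g (pr10 J (1 ⊗ₜ e j))) (contractF (pr01 J (1 ⊗ₜ S (e j))) η)) q Y Z
      = ∑ k, η q Y (Function.update Z k (S (Z k))) := by
  rw [Forms.sum_apply]
  simp only [h.wedgeF_contractF_apply]
  rw [Finset.sum_comm]
  refine Finset.sum_congr rfl fun k _ => ?_
  have hlin : ∀ z, ∑ j, (g (e j) z : ℂ) • η q Y (Function.update Z k (S (e j)))
      = η q Y (Function.update Z k (S z)) := fun z => by
    conv_rhs => rw [← sum_inner_smul he z, map_sum, AlternatingMap.map_update_sum]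
    refine Finset.sum_congr rfl fun j _ => ?_
    rw [map_smul, AlternatingMap.map_update_smul, Complex.coe_smul]
  have hα : ∀ j, dualForm g (pr10 J (1 ⊗ₜ e j)) (Z k)
      = (1 / 2 : ℂ) * g (e j) (Z k) + (1 / 2 * Complex.I : ℂ) * g (e j) (J (Z k)) := fun j => by
    rw [dualForm_pr10, hp.skew]; push_cast; ring
  simp only [hα, add_smul, mul_smul, Finset.sum_add_distrib, ← Finset.smul_sum, hlin]
  rw [hSJ, h.right, smul_neg, smul_smul Complex.I Complex.I, Complex.I_mul_I]
  module

/-- The trace over `T^{(1,0)}` of an endomorphism of `T` that commutes with `J`. -/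
def traceJ (J S : T →ₗ[ℝ] T) : ℂ :=
  (1 / 2 : ℂ) * (LinearMap.trace ℝ T S - Complex.I * LinearMap.trace ℝ T (J ∘ₗ S))

/-- For a skew endomorphism commuting with J, the spin action -(1/4) ∑ c(e_j) c(S e_j) and the
natural action on (0,q) arguments differ by the scalar half the complex trace of S. This is the
contribution of (det T^{(1,0)})^{1/2} to the spinor bundle. -/
theorem IsTypeP.sum_cliffF {η : Forms T N p} (h : IsTypeP J η) (hp : IsHermitianPair g J)
    (he : ∀ i j, g (e i) (e j) = if i = j then 1 else 0) (S : T →ₗ[ℝ] T)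
    (hS : ∀ u v, g (S u) v = -g u (S v)) (hSJ : ∀ u, S (J u) = J (S u)) (q : ℕ)
    (Y : Fin p → T) (Z : Fin q → T) :
    (∑ j, cliffF g J (e j) (cliffF g J (S (e j)) η)) q Y Z
      = -(4 : ℂ) • ∑ k, η q Y (Function.update Z k (S (Z k)))
        - (2 * traceJ J S) • η q Y Z := by
  have hI : ∀ u, (1 : ℂ) ⊗ₜ[ℝ] J u = complexJ J (1 ⊗ₜ u) := fun u => by simp [complexJ]
  have h10 : ∀ u, pr10 J ((1 : ℂ) ⊗ₜ[ℝ] J u) = Complex.I • pr10 J ((1 : ℂ) ⊗ₜ[ℝ] u) := fun u => by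
    have := pr10_mem hp.sq ((1 : ℂ) ⊗ₜ[ℝ] u)
    rw [T10, Module.End.mem_eigenspace_iff] at this
    rw [← this, hI]
    simp [pr10]
  have h01 : ∀ u, pr01 J ((1 : ℂ) ⊗ₜ[ℝ] J u) = -(Complex.I • pr01 J ((1 : ℂ) ⊗ₜ[ℝ] u)) := fun u => by
    simp only [pr01, hI, LinearMap.smul_apply, LinearMap.add_apply, LinearMap.id_apply,
      complexJ_complexJ hp.sq, smul_add, smul_neg, smul_smul]
    rw [mul_comm (1 / 2 : ℂ) Complex.I, ← mul_assoc, Complex.I_mul_I]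
    module
  have haJ : ∀ u, wedgeF (N := N) (p := p) (dualForm g (pr10 J (1 ⊗ₜ J u)))
      = Complex.I • wedgeF (dualForm g (pr10 J (1 ⊗ₜ u))) := fun u => by
    rw [h10, ← wedgeF_smul]
    congr 1
    simp [dualForm]
  have hwJ : ∀ u, contractF (N := N) (p := p) (pr01 J (1 ⊗ₜ J u))
      = -(Complex.I • contractF (pr01 J (1 ⊗ₜ u))) := fun u => by
    rw [h01, ← neg_smul, contractF_smul]
    refine LinearMap.ext fun θ => ?_
    rw [LinearMap.smul_apply, LinearMap.neg_apply, LinearMap.smul_apply, neg_smul]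
  have key := sum_mul_of_car (V := Forms T N p) hp he (a := fun u => wedgeF (dualForm g (pr10 J (1 ⊗ₜ u))))
    (w := fun u => contractF (pr01 J (1 ⊗ₜ u))) (map_add (wedgeL g J)) (map_smul (wedgeL g J))
    (map_add (contractL J)) (map_smul (contractL J)) haJ hwJ
    (k := fun u v => (dualForm g (pr10 J (1 ⊗ₜ v))).liftBaseChange ℂ (pr01 J (1 ⊗ₜ u)))
    (fun u v => contractF_mul_wedgeF _ _) S hS hSJ
  have hk : ∀ u v, (dualForm g (pr10 J (1 ⊗ₜ v))).liftBaseChange ℂ (pr01 J (1 ⊗ₜ u))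
      = (1 / 2 : ℂ) * (g u v - Complex.I * g u (J v)) := by
    intro u v
    rw [liftBaseChange_pr01, dualForm_pr10_J hp, dualForm_pr10, hp.symm, hp.symm (J v)]
    linear_combination (-(1 / 4 : ℂ) * (g u v - Complex.I * g u (J v))) * Complex.I_mul_I
  -- The scalar left by the relation between contraction and wedge, summed over the basis, is the
  -- complex trace of S.
  have htr : ∑ j, (dualForm g (pr10 J (1 ⊗ₜ S (e j)))).liftBaseChange ℂ (pr01 J (1 ⊗ₜ e j))
      = traceJ J S := by
    simp only [hk, traceJ, trace_eq_sum_inner he, LinearMap.comp_apply]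
    push_cast
    rw [← Finset.mul_sum, Finset.sum_sub_distrib, Finset.mul_sum]
  have h2 : ((√2 : ℝ) : ℂ) * ((√2 : ℝ) : ℂ) = 2 := by
    rw [← Complex.ofReal_mul, Real.mul_self_sqrt (by norm_num)]; norm_num
  have hc : ∀ j, cliffF g J (e j) (cliffF g J (S (e j)) η) = (2 : ℂ) •
      (wedgeF (dualForm g (pr10 J (1 ⊗ₜ e j))) - contractF (pr01 J (1 ⊗ₜ e j)) :
        Module.End ℂ (Forms T N p))
      ((wedgeF (dualForm g (pr10 J (1 ⊗ₜ S (e j)))) - contractF (pr01 J (1 ⊗ₜ S (e j))) :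
        Module.End ℂ (Forms T N p)) η) := by
    intro j
    rw [cliffF_eq, cliffF_eq, LinearMap.smul_apply, LinearMap.smul_apply, map_smul, smul_smul, h2]
  have key' := congrArg (fun f : Module.End ℂ (Forms T N p) => f η) key
  simp only [LinearMap.sum_apply, LinearMap.sub_apply, LinearMap.smul_apply, Module.End.mul_apply,
    Module.End.one_apply, htr] at key'
  have hw := h.sum_wedgeF_contractF hp he S hSJ q Y Z
  simp only [hc, ← Finset.smul_sum, LinearMap.sub_apply]
  rw [key', ← hw]
  change (2 : ℂ) • (-(2 : ℂ) • (∑ j, _ : Forms T N p) q Y Z - traceJ J S • η q Y Z) = _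
  module

theorem IsTypeP.contract_pr10 {η : Forms T N (p + 1)} (h : IsTypeP J η) (q : ℕ) (X : T) :
    contract (pr10 J (1 ⊗ₜ X)) (η q) = (η q).curryLeft X := by
  have h1 : (η q).curryLeft (J X) = Complex.I • (η q).curryLeft X := by
    ext Z
    simpa [Matrix.vecCons, Fin.update_cons_zero] using
      DFunLike.congr_fun (h.left q (Matrix.vecCons X Z) 0 X) _
  have h2 : pr10 J ((1 : ℂ) ⊗ₜ[ℝ] X) = (1 / 2 : ℂ) • ((1 : ℂ) ⊗ₜ[ℝ] X + (-Complex.I) ⊗ₜ[ℝ] J X) := by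
    simp [pr10, complexJ, TensorProduct.smul_tmul', TensorProduct.neg_tmul, sub_eq_add_neg]
  rw [h2, contract_smul, contract_add, contract_tmul, contract_tmul, h1, smul_smul, neg_mul,
    Complex.I_mul_I]
  module

theorem IsTypeP.opA_apply {η : Forms T N p} (h : IsTypeP J η) (X w : T)
    (q : ℕ) (Y : Fin p → T) (Z : Fin q → T) :
    opA g J X w η q Y Z
      = ∑ k, dualForm g (pr01 J (1 ⊗ₜ X)) (Y k) • η q (Function.update Y k w) Z := by
  match p with
  | 0 => simp [opA]
  | p + 1 =>
    change wedge _ (contract _ (η q)) Y Z = _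
    rw [h.contract_pr10, ← one_smul ℂ ((η q).curryLeft w), ← contract_tmul,
      wedge_contract_tmul, alternatingMap_sum_apply]
    rfl

/-- The (1,0) dual form of e_j averages the insertion of K with that of -JKJ, so only the part of K
commuting with J survives. K is arbitrary here; in the application the part of ∇V anticommuting with
J disappears. -/
theorem IsTypeP.sum_opA {η : Forms T N p} (h : IsTypeP J η) (hp : IsHermitianPair g J)
    (he : ∀ i j, g (e i) (e j) = if i = j then 1 else 0)
    (K : T →ₗ[ℝ] T) (q : ℕ) (Y : Fin p → T) (Z : Fin q → T) :
    (∑ j, opA g J (e j) (K (e j)) η) q Y Z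
      = ∑ k, η q (Function.update Y k ((1 / 2 : ℝ) • (K (Y k) - J (K (J (Y k)))))) Z := by
  rw [Forms.sum_apply]
  simp only [h.opA_apply]
  rw [Finset.sum_comm]
  refine Finset.sum_congr rfl fun k _ => ?_
  have hlin : ∀ z, ∑ j, (g (e j) z : ℂ) • η q (Function.update Y k (K (e j))) Z
      = η q (Function.update Y k (K z)) Z := fun z => by
    conv_rhs => rw [← sum_inner_smul he z, map_sum, AlternatingMap.map_update_sum,
      alternatingMap_sum_apply]
    refine Finset.sum_congr rfl fun j _ => ?_
    rw [map_smul, AlternatingMap.map_update_smul, Complex.coe_smul]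
    rfl
  have hα : ∀ j, dualForm g (pr01 J (1 ⊗ₜ e j)) (Y k)
      = (1 / 2 : ℂ) * g (e j) (Y k) + (-1 / 2 * Complex.I : ℂ) * g (e j) (J (Y k)) := fun j => by
    rw [dualForm_pr01, hp.skew]; push_cast; ring
  simp only [hα, add_smul, mul_smul, Finset.sum_add_distrib, ← Finset.smul_sum, hlin]
  rw [AlternatingMap.map_update_smul, AlternatingMap.map_update_sub, h.left]
  have hr : ∀ n : N, (1 / 2 : ℝ) • n = (1 / 2 : ℂ) • n := fun n => by
    rw [← Complex.coe_smul]; norm_num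
  simp only [AlternatingMap.smul_apply, AlternatingMap.sub_apply, hr]
  module

theorem IsTypeP.opA_add_right {η : Forms T N p} (h : IsTypeP J η) (X v w : T) :
    opA g J X (v + w) η = opA g J X v η + opA g J X w η := by
  refine Forms.ext fun q Y Z => ?_
  simp [h.opA_apply, Finset.sum_add_distrib]

theorem IsTypeP.opA_smul_right {η : Forms T N p} (h : IsTypeP J η) (X w : T) (r : ℝ) :
    opA g J X (r • w) η = (r : ℂ) • opA g J X w η := by
  refine Forms.ext fun q Y Z => ?_
  simp only [h.opA_apply, AlternatingMap.map_update_smul, AlternatingMap.smul_apply, Pi.smul_apply,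
    Finset.smul_sum]
  refine Finset.sum_congr rfl fun k _ => ?_
  rw [← Complex.coe_smul, smul_comm]

theorem IsTypeP.opA_sum_right {ι : Type*} {η : Forms T N p} (h : IsTypeP J η) (X : T)
    (t : Finset ι) (w : ι → T) :
    opA g J X (∑ i ∈ t, w i) η = ∑ i ∈ t, opA g J X (w i) η := by
  refine Forms.ext fun q Y Z => ?_
  simp only [Forms.sum_apply, h.opA_apply, AlternatingMap.map_update_sum,
    alternatingMap_sum_apply, Finset.smul_sum]
  exact Finset.sum_comm

theorem IsTypeP.sum_opA_inner {η : Forms T N p} (h : IsTypeP J η) (hp : IsHermitianPair g J)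
    (he : ∀ i j, g (e i) (e j) = if i = j then 1 else 0) (u v : T) :
    ∑ j, opA g J (e j) (g u (e j) • v) η = opA g J u v η := by
  refine Forms.ext fun q Y Z => ?_
  rw [Forms.sum_apply]
  simp only [h.opA_apply, AlternatingMap.map_update_smul, AlternatingMap.smul_apply]
  rw [Finset.sum_comm]
  refine Finset.sum_congr rfl fun k _ => ?_
  have hα : ∑ j, (g u (e j) : ℂ) * dualForm g (pr01 J (1 ⊗ₜ e j)) (Y k)
      = dualForm g (pr01 J (1 ⊗ₜ u)) (Y k) := by
    have hg : ∀ z, ∑ j, (g u (e j) : ℂ) * g (e j) z = g u z := fun z => by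
      conv_rhs => rw [← sum_inner_smul he z, map_sum]
      push_cast
      exact Finset.sum_congr rfl fun j _ => by simp [mul_comm]
    have h' : ∀ X z, dualForm g (pr01 J (1 ⊗ₜ X)) z
        = (1 / 2 : ℂ) * g X z + (-1 / 2 * Complex.I : ℂ) * g X (J z) := fun X z => by
      rw [dualForm_pr01, hp.skew]; push_cast; ring
    simp only [h', mul_add, Finset.sum_add_distrib, mul_left_comm _ (1 / 2 : ℂ),
      mul_left_comm _ (-1 / 2 * Complex.I : ℂ), ← Finset.mul_sum, hg]
  rw [← hα, Finset.sum_smul]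
  refine Finset.sum_congr rfl fun j _ => ?_
  rw [← Complex.coe_smul, smul_smul, mul_comm]

end Derivation

section Trace

variable {J : T →ₗ[ℝ] T}

/-- JβJ = β by anticommutation, whereas cyclicity of the trace and J² = -1 give tr(JβJ) = -tr β. -/
theorem trace_eq_zero_of_anticomm (hJ : ∀ v, J (J v) = -v) {β : T →ₗ[ℝ] T}
    (h : ∀ v, β (J v) = -J (β v)) : LinearMap.trace ℝ T β = 0 := by
  have h1 : LinearMap.trace ℝ T (J * (β * J)) = LinearMap.trace ℝ T ((β * J) * J) :=
    LinearMap.trace_mul_comm ..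
  have h2 : J * (β * J) = β := by ext v; simp [h, hJ]
  have h3 : (β * J) * J = -β := by ext v; simp [hJ]
  rw [h2, h3, map_neg] at h1
  linarith

theorem traceJ_eq_zero_of_anticomm (hJ : ∀ v, J (J v) = -v) {β : T →ₗ[ℝ] T}
    (h : ∀ v, β (J v) = -J (β v)) : traceJ J β = 0 := by
  have h' : ∀ v, (J ∘ₗ β) (J v) = -J ((J ∘ₗ β) v) := fun v => by simp [h]
  simp [traceJ, trace_eq_zero_of_anticomm hJ h, trace_eq_zero_of_anticomm hJ h']

theorem traceJ_add (J R S : T →ₗ[ℝ] T) : traceJ J (R + S) = traceJ J R + traceJ J S := by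
  simp only [traceJ, LinearMap.comp_add, map_add]
  push_cast
  ring

theorem traceJ_smul (J S : T →ₗ[ℝ] T) (r : ℝ) : traceJ J (r • S) = r * traceJ J S := by
  simp only [traceJ, LinearMap.comp_smul, map_smul, smul_eq_mul]
  push_cast
  ring

theorem traceJ_sum {ι : Type*} (J : T →ₗ[ℝ] T) (t : Finset ι) (S : ι → T →ₗ[ℝ] T) :
    traceJ J (∑ i ∈ t, S i) = ∑ i ∈ t, traceJ J (S i) := by
  classical
  induction t using Finset.induction_on with
  | empty => simp [traceJ]
  | insert a t ha ih => rw [Finset.sum_insert ha, Finset.sum_insert ha, traceJ_add, ih]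

/-- The endomorphism pr^{(1,0)} K maps everything into T^{(1,0)}, so its trace there equals its
trace on the whole complexification, where traces of base changes are real traces. In the
application A = ∇X and B = ∇(JX), and the right-hand side is the complex trace of v ↦ `nablaJ` of X
along v. -/
theorem trace10_eq [FiniteDimensional ℝ T] (hJ : ∀ v, J (J v) = -v) (A B : T →ₗ[ℝ] T) :
    trace10 hJ ((1 / 2 : ℂ) • (A.baseChange ℂ - Complex.I • B.baseChange ℂ))
      = traceJ J ((1 / 2 : ℝ) • (A - J ∘ₗ B)) := by
  set K : (ℂ ⊗[ℝ] T) →ₗ[ℂ] (ℂ ⊗[ℝ] T) :=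
    (1 / 2 : ℂ) • (A.baseChange ℂ - Complex.I • B.baseChange ℂ) with hK
  have h1 : trace10 hJ K = LinearMap.trace ℂ (ℂ ⊗[ℝ] T) (pr10 J ∘ₗ K) := by
    rw [← LinearMap.trace_restrict_eq_of_forall_mem (T10 J) (pr10 J ∘ₗ K)
      (fun z => pr10_mem hJ (K z))]
    rfl
  have h2 : pr10 J ∘ₗ K = (1 / 4 : ℂ) • (A.baseChange ℂ - Complex.I • B.baseChange ℂ
      - Complex.I • (J ∘ₗ A).baseChange ℂ - (J ∘ₗ B).baseChange ℂ) := by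
    rw [LinearMap.baseChange_comp, LinearMap.baseChange_comp]
    refine LinearMap.ext fun z => ?_
    simp only [hK, pr10, complexJ, LinearMap.comp_apply, LinearMap.smul_apply, LinearMap.sub_apply,
      LinearMap.id_apply, map_smul, map_sub, smul_sub, smul_smul]
    have : (1 / 2 : ℂ) * Complex.I * (1 / 2 * Complex.I) = -(1 / 4) := by
      linear_combination (1 / 4 : ℂ) * Complex.I_mul_I
    rw [this]
    module
  have h3 : J ∘ₗ J ∘ₗ B = -B := by ext v; simp [hJ]
  rw [h1, h2]
  simp only [map_smul, map_sub, LinearMap.trace_baseChange, traceJ, LinearMap.comp_smul,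
    LinearMap.comp_sub, h3, smul_eq_mul, map_neg]
  push_cast
  simp only [Complex.coe_algebraMap]
  ring

end Trace

end Algebra

/-! ### Forms of degree (p, q) as multilinear maps -/

section Multilinear

variable {T : Type*} [AddCommGroup T] [Module ℝ T]

/-- A derivation keeps alternating maps alternating: if arguments i and j coincide, the terms with k
different from i and j vanish outright, and the terms k = i and k = j cancel by polarization. -/
theorem sum_update_eq_zero {ι N : Type*} [Fintype ι] [DecidableEq ι] [AddCommGroup N] [Module ℝ N]
    {f : MultilinearMap ℝ (fun _ : ι => T) N} {i j : ι} (hij : i ≠ j)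
    (hf : ∀ W, W i = W j → f W = 0) {W : ι → T} (hW : W i = W j) {u : ι → T} (hu : u i = u j) :
    ∑ k, f (Function.update W k (u k)) = 0 := by
  have hfu : ∀ a b : T, f (Function.update (Function.update W i a) j b)
      + f (Function.update (Function.update W i b) j a) = 0 := by
    intro a b
    have h0 : ∀ a, f (Function.update (Function.update W i a) j a) = 0 := fun a =>
      hf _ (by simp [hij])
    have h1 := h0 (a + b)
    rw [MultilinearMap.map_update_add, Function.update_comm hij, MultilinearMap.map_update_add,
      Function.update_comm hij, MultilinearMap.map_update_add, ← Function.update_comm hij,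
      ← Function.update_comm hij, ← Function.update_comm hij, ← Function.update_comm hij,
      h0, h0, zero_add, add_zero] at h1
    rw [add_comm]
    exact h1
  rw [← Finset.add_sum_erase _ _ (Finset.mem_univ i),
    ← Finset.add_sum_erase _ _ (Finset.mem_erase.mpr ⟨hij.symm, Finset.mem_univ j⟩),
    Finset.sum_eq_zero, add_zero]
  · have e1 : Function.update (Function.update W i (u i)) j (W j)
        = Function.update W i (u i) := by
      rw [Function.update_eq_self_iff, Function.update_of_ne hij.symm]
    have e2 : Function.update (Function.update W i (W j)) j (u i)
        = Function.update W j (u j) := by rw [← hW, Function.update_eq_self, hu]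
    rw [← hfu (u i) (W j), e1, e2]
  · intro k hk
    simp only [Finset.mem_erase, Finset.mem_univ, and_true] at hk
    exact hf _ (by rw [Function.update_of_ne hk.2.symm, Function.update_of_ne hk.1.symm, hW])

variable {N : Type*} [AddCommGroup N] [Module ℂ N] {p q : ℕ}

/-- A form of degree `(p, q)` as a multilinear map in `p + q` variables. -/
def toMultilinear (η : T [⋀^Fin p]→ₗ[ℝ] (T [⋀^Fin q]→ₗ[ℝ] N)) :
    MultilinearMap ℝ (fun _ : Fin p ⊕ Fin q => T) N :=
  MultilinearMap.mk' (fun W => η (W ∘ Sum.inl) (W ∘ Sum.inr))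
    (fun W i a b => by
      cases i <;> simp [Sum.update_inl_comp_inl, Sum.update_inl_comp_inr, Sum.update_inr_comp_inl,
        Sum.update_inr_comp_inr])
    (fun W i a b => by
      cases i <;> simp [Sum.update_inl_comp_inl, Sum.update_inl_comp_inr, Sum.update_inr_comp_inl,
        Sum.update_inr_comp_inr])

theorem toMultilinear_apply (η : T [⋀^Fin p]→ₗ[ℝ] (T [⋀^Fin q]→ₗ[ℝ] N)) (W : Fin p ⊕ Fin q → T) :
    toMultilinear η W = η (W ∘ Sum.inl) (W ∘ Sum.inr) := rfl

/-- The multilinear map `f` is alternating in each of the two groups of variables. -/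
structure IsBialternating (f : MultilinearMap ℝ (fun _ : Fin p ⊕ Fin q => T) N) : Prop where
  left : ∀ i j : Fin p, i ≠ j → ∀ W, W (Sum.inl i) = W (Sum.inl j) → f W = 0
  right : ∀ i j : Fin q, i ≠ j → ∀ W, W (Sum.inr i) = W (Sum.inr j) → f W = 0

theorem isBialternating_toMultilinear (η : T [⋀^Fin p]→ₗ[ℝ] (T [⋀^Fin q]→ₗ[ℝ] N)) :
    IsBialternating (toMultilinear η) where
  left i j hij W hW := by
    rw [toMultilinear_apply, AlternatingMap.map_eq_zero_of_eq η (i := i) (j := j) _ hW hij]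
    rfl
  right i j hij W hW := by
    rw [toMultilinear_apply, AlternatingMap.map_eq_zero_of_eq _ (i := i) (j := j) _ hW hij]

theorem IsBialternating.exists_form {f : MultilinearMap ℝ (fun _ : Fin p ⊕ Fin q => T) N}
    (h : IsBialternating f) : ∃ η : T [⋀^Fin p]→ₗ[ℝ] (T [⋀^Fin q]→ₗ[ℝ] N),
      ∀ Y Z, η Y Z = f (Sum.elim Y Z) := by
  refine ⟨{ toFun := fun Y =>
              { toFun := fun Z => f (Sum.elim Y Z)
                map_update_add' := fun Z i a b => ?_
                map_update_smul' := fun Z i a b => ?_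
                map_eq_zero_of_eq' := fun Z i j hZ hij => h.right i j hij _ hZ }
            map_update_add' := fun Y i a b => AlternatingMap.ext fun Z => ?_
            map_update_smul' := fun Y i a b => AlternatingMap.ext fun Z => ?_
            map_eq_zero_of_eq' := fun Y i j hY hij => AlternatingMap.ext fun Z =>
              h.left i j hij _ hY }, fun Y Z => rfl⟩
  · simp only [← Sum.update_elim_inr, MultilinearMap.map_update_add]
  · simp only [← Sum.update_elim_inr, MultilinearMap.map_update_smul]
  · change f (Sum.elim _ Z) = f (Sum.elim _ Z) + f (Sum.elim _ Z)
    simp only [← Sum.update_elim_inl, MultilinearMap.map_update_add]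
  · change f (Sum.elim _ Z) = a • f (Sum.elim _ Z)
    simp only [← Sum.update_elim_inl, MultilinearMap.map_update_smul]

/-- `ofValues` falls back to 0 unless the prescribed values come from a form. A bialternating
multilinear map with these values certifies that they do. -/
theorem ofValues_apply {f : ∀ q : ℕ, (Fin p → T) → (Fin q → T) → N}
    (F : ∀ q, MultilinearMap ℝ (fun _ : Fin p ⊕ Fin q => T) N) (hF : ∀ q, IsBialternating (F q))
    (h : ∀ q Y Z, f q Y Z = F q (Sum.elim Y Z)) (q : ℕ) (Y : Fin p → T) (Z : Fin q → T) :
    ofValues f q Y Z = f q Y Z := by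
  have hex : ∃ η : T [⋀^Fin p]→ₗ[ℝ] (T [⋀^Fin q]→ₗ[ℝ] N), ∀ Y Z, η Y Z = f q Y Z := by
    obtain ⟨η, hη⟩ := (hF q).exists_form
    exact ⟨η, fun Y Z => by rw [hη, h]⟩
  unfold ofValues
  rw [dif_pos hex]
  exact hex.choose_spec Y Z

end Multilinear

/-! ### Smooth sections and tensorial operations -/

section Sections

open scoped Topology

variable {EM : Type*} [NormedAddCommGroup EM] [NormedSpace ℝ EM]
  {M : Type*} [TopologicalSpace M] [ChartedSpace EM M]
  {FV : Type*} [NormedAddCommGroup FV] [NormedSpace ℝ FV]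
  {V : M → Type*} [TopologicalSpace (TotalSpace FV V)]
  [∀ x, AddCommGroup (V x)] [∀ x, Module ℝ (V x)] [∀ x, TopologicalSpace (V x)]
  [FiberBundle FV V]

/-- The section `σ` of a real vector bundle is smooth at `x`. -/
abbrev SecAt (EM FV : Type*) [NormedAddCommGroup EM] [NormedSpace ℝ EM]
    [NormedAddCommGroup FV] [NormedSpace ℝ FV]
    {M : Type*} [TopologicalSpace M] [ChartedSpace EM M]
    {V : M → Type*} [TopologicalSpace (TotalSpace FV V)] [∀ x, TopologicalSpace (V x)]
    [FiberBundle FV V] (σ : ∀ x : M, V x) (x : M) : Prop :=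
  ContMDiffAt 𝓘(ℝ, EM) (𝓘(ℝ, EM).prod 𝓘(ℝ, FV)) ∞ (fun y => TotalSpace.mk' FV y (σ y)) x

/-- The function `f` is smooth at `x`. -/
abbrev FunAt (EM : Type*) [NormedAddCommGroup EM] [NormedSpace ℝ EM]
    {M : Type*} [TopologicalSpace M] [ChartedSpace EM M] (f : M → ℝ) (x : M) : Prop :=
  ContMDiffAt 𝓘(ℝ, EM) 𝓘(ℝ, ℝ) ∞ f x

theorem SecAt.congr {σ τ : ∀ y : M, V y} {x : M} (h : SecAt EM FV σ x)
    (hστ : ∀ᶠ y in 𝓝 x, σ y = τ y) : SecAt EM FV τ x :=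
  ContMDiffAt.congr_of_eventuallyEq h (hστ.mono fun y hy => by simp only [hy])

variable [VectorBundle ℝ FV V]

theorem SecAt.add {σ τ : ∀ y : M, V y} {x : M} (hσ : SecAt EM FV σ x) (hτ : SecAt EM FV τ x) :
    SecAt EM FV (fun y => σ y + τ y) x := ContMDiffAt.add_section hσ hτ

theorem SecAt.sub {σ τ : ∀ y : M, V y} {x : M} (hσ : SecAt EM FV σ x) (hτ : SecAt EM FV τ x) :
    SecAt EM FV (fun y => σ y - τ y) x := ContMDiffAt.sub_section hσ hτ

theorem SecAt.smul {f : M → ℝ} {σ : ∀ y : M, V y} {x : M} (hf : FunAt EM f x)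
    (hσ : SecAt EM FV σ x) : SecAt EM FV (fun y => f y • σ y) x := ContMDiffAt.smul_section hf hσ

theorem SecAt.const_smul (r : ℝ) {σ : ∀ y : M, V y} {x : M}
    (hσ : SecAt EM FV σ x) : SecAt EM FV (fun y => r • σ y) x :=
  SecAt.smul contMDiffAt_const hσ

theorem SecAt.sum {ι : Type*} {s : Finset ι} {σ : ι → ∀ y : M, V y} {x : M}
    (hσ : ∀ i ∈ s, SecAt EM FV (σ i) x) : SecAt EM FV (fun y => ∑ i ∈ s, σ i y) x :=
  ContMDiffAt.sum_section hσ

theorem secAt_zero (x : M) : SecAt EM FV (fun y => (0 : V y)) x :=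
  contMDiff_zeroSection ℝ V x

theorem secAt_extend [ContMDiffVectorBundle ∞ FV V 𝓘(ℝ, EM)] {x : M} (v : V x) :
    SecAt EM FV (FiberBundle.extend FV v) x :=
  FiberBundle.contMDiffAt_extend (k := ∞) 𝓘(ℝ, EM) FV v

/-- A germ of a smooth section at `x` is the germ of a global smooth section. -/
theorem exists_global_section [T2Space M] [FiniteDimensional ℝ EM] [IsManifold 𝓘(ℝ, EM) ∞ M]
    {u : Set M} (hu : IsOpen u) {x : M} (hx : x ∈ u) {σ : ∀ y : M, V y}
    (hσ : ∀ y ∈ u, SecAt EM FV σ y) :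
    ∃ τ : ∀ y : M, V y, (∀ y, SecAt EM FV τ y) ∧ ∀ᶠ y in 𝓝 x, τ y = σ y := by
  obtain ⟨f, -, hf⟩ := (SmoothBumpFunction.nhds_basis_tsupport (I := 𝓘(ℝ, EM)) x).mem_iff.1
    (hu.mem_nhds hx)
  -- A bump function equal to 1 near x and supported in u extends σ by zero.
  refine ⟨fun y => f y • σ y, ?_, f.eventuallyEq_one.mono fun y hy => ?_⟩
  · exact ContMDiffOn.smul_section_of_tsupport (f.contMDiff.contMDiffOn (s := u)) hu hf
      fun y hy => (hσ y hy).contMDiffWithinAt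
  · simp [hy]

/-- Near every point there is a frame of global smooth sections. -/
theorem exists_frame [T2Space M] [FiniteDimensional ℝ EM] [IsManifold 𝓘(ℝ, EM) ∞ M]
    [FiniteDimensional ℝ FV] [ContMDiffVectorBundle ∞ FV V 𝓘(ℝ, EM)] (x : M) :
    ∃ (n : ℕ) (e : Fin n → ∀ y : M, V y), (∀ a y, SecAt EM FV (e a) y) ∧
      (∀ᶠ y in 𝓝 x, LinearIndependent ℝ fun a => e a y) ∧
      (∀ᶠ y in 𝓝 x, ⊤ ≤ Submodule.span ℝ (Set.range fun a => e a y)) ∧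
      ∀ σ : ∀ y : M, V y, SecAt EM FV σ x → ∃ c : Fin n → M → ℝ,
        (∀ a, FunAt EM (c a) x) ∧ ∀ᶠ y in 𝓝 x, σ y = ∑ a, c a y • e a y := by
  have : ContMDiffVectorBundle 1 FV V 𝓘(ℝ, EM) := ContMDiffVectorBundle.of_le (n := ∞) (by simp)
  let t := trivializationAt FV V x
  have hx : x ∈ t.baseSet := FiberBundle.mem_baseSet_trivializationAt FV V x
  let b := Module.finBasis ℝ FV
  have hloc := t.isLocalFrameOn_localFrame_baseSet 𝓘(ℝ, EM) ∞ b
  choose e he1 he2 using fun a => exists_global_section t.open_baseSet hx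
    fun y hy => (contMDiffAt_localFrame_of_mem (I := 𝓘(ℝ, EM)) ∞ t b a hy)
  have he3 : ∀ᶠ y in 𝓝 x, ∀ a, e a y = t.localFrame b a y := Filter.eventually_all.2 he2
  have hmem : ∀ᶠ y in 𝓝 x, y ∈ t.baseSet := t.open_baseSet.mem_nhds hx
  refine ⟨_, e, he1, ?_, ?_, fun σ hσ => ⟨fun a => LinearMap.piApply (t.localFrameCoeff 𝓘(ℝ, EM) b a) σ,
    fun a => contMDiffAt_localFrameCoeff b hx hσ a, ?_⟩⟩
  · filter_upwards [he3, hmem] with y hy hy'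
    simp only [hy]
    exact hloc.linearIndependent hy'
  · filter_upwards [he3, hmem] with y hy hy'
    simp only [hy]
    exact hloc.generating hy'
  · filter_upwards [he3, t.eventually_eq_localFrame_sum_coeff_smul (I := 𝓘(ℝ, EM)) b hx (s := σ)]
      with y hy hy'
    simp only [hy]
    exact hy'

/-- An operation on sections that respects sums and multiplication by smooth functions. -/
structure SmoothTensorialAt (EM FV : Type*) [NormedAddCommGroup EM] [NormedSpace ℝ EM]
    [NormedAddCommGroup FV] [NormedSpace ℝ FV]
    {M : Type*} [TopologicalSpace M] [ChartedSpace EM M]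
    {V : M → Type*} [TopologicalSpace (TotalSpace FV V)] [∀ x, AddCommGroup (V x)]
    [∀ x, Module ℝ (V x)] [∀ x, TopologicalSpace (V x)]
    [FiberBundle FV V] {A : Type*} [AddCommGroup A] [Module ℝ A]
    (Φ : (∀ y : M, V y) → A) (x : M) : Prop where
  add : ∀ {σ τ}, SecAt EM FV σ x → SecAt EM FV τ x → Φ (fun y => σ y + τ y) = Φ σ + Φ τ
  smul : ∀ {f : M → ℝ} {σ}, FunAt EM f x → SecAt EM FV σ x → Φ (fun y => f y • σ y) = f x • Φ σ

variable {A : Type*} [AddCommGroup A] [Module ℝ A] {Φ : (∀ y : M, V y) → A} {x : M}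

/-- The indicator function of the set where σ = τ suffices: it is identically 1 near x, which is all
that smoothness at x requires, and multiplication by it makes the two sections equal everywhere. -/
theorem exists_cutoff {σ τ : ∀ y : M, V y} (h : ∀ᶠ y in 𝓝 x, σ y = τ y) :
    ∃ ψ : M → ℝ, FunAt EM ψ x ∧ ψ =ᶠ[𝓝 x] (fun _ => 1) ∧
      (fun y => ψ y • σ y) = fun y => ψ y • τ y := by
  classical
  have h1 : (fun y => if σ y = τ y then (1 : ℝ) else 0) =ᶠ[𝓝 x] fun _ => 1 :=
    h.mono fun y hy => by simp [hy]
  refine ⟨_, contMDiffAt_const.congr_of_eventuallyEq h1, h1, ?_⟩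
  funext y
  by_cases hy : σ y = τ y <;> simp [hy]

theorem SmoothTensorialAt.congr (hΦ : SmoothTensorialAt EM FV Φ x) {σ τ : ∀ y : M, V y}
    (hσ : SecAt EM FV σ x) (h : ∀ᶠ y in 𝓝 x, σ y = τ y) : Φ σ = Φ τ := by
  obtain ⟨ψ, h1, h2, h3⟩ := exists_cutoff (EM := EM) h
  have e1 := hΦ.smul h1 hσ
  have e2 := hΦ.smul h1 (hσ.congr h)
  rw [h2.eq_of_nhds, one_smul] at e1 e2
  rw [← e1, ← e2, h3]

theorem SmoothTensorialAt.sum (hΦ : SmoothTensorialAt EM FV Φ x) {ι : Type*} {s : Finset ι}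
    {σ : ι → ∀ y : M, V y} (hσ : ∀ i ∈ s, SecAt EM FV (σ i) x) :
    Φ (fun y => ∑ i ∈ s, σ i y) = ∑ i ∈ s, Φ (σ i) := by
  classical
  induction s using Finset.induction_on with
  | empty =>
    have := hΦ.smul (f := fun _ => 0) contMDiffAt_const (secAt_zero x)
    simpa using this
  | insert a s ha h =>
    simp only [Finset.mem_insert, forall_eq_or_imp] at hσ
    simp only [Finset.sum_insert ha, ← h hσ.2]
    exact hΦ.add hσ.1 (.sum hσ.2)

/-- In a frame the coefficients of a section vanishing at x vanish at x, and the operation lets them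
out as scalars evaluated at x. -/
theorem SmoothTensorialAt.pointwise [T2Space M] [FiniteDimensional ℝ EM]
    [IsManifold 𝓘(ℝ, EM) ∞ M] [FiniteDimensional ℝ FV] [ContMDiffVectorBundle ∞ FV V 𝓘(ℝ, EM)]
    (hΦ : SmoothTensorialAt EM FV Φ x) {σ τ : ∀ y : M, V y}
    (hσ : SecAt EM FV σ x) (hτ : SecAt EM FV τ x) (h : σ x = τ x) : Φ σ = Φ τ := by
  suffices H : ∀ σ : ∀ y : M, V y, SecAt EM FV σ x → σ x = 0 → Φ σ = 0 by
    have e := H (fun y => σ y + (-1 : ℝ) • τ y) (hσ.add (hτ.const_smul _)) (by simp [h])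
    rw [hΦ.add hσ (hτ.const_smul _), hΦ.smul (f := fun _ => -1) contMDiffAt_const hτ] at e
    rw [← sub_eq_zero, ← e]
    module
  intro σ hσ h0
  obtain ⟨n, e, he, hli, -, hc⟩ := exists_frame (EM := EM) (FV := FV) (V := V) x
  obtain ⟨c, hc1, hc2⟩ := hc σ hσ
  have hz : ∀ a, c a x = 0 := Fintype.linearIndependent_iff.1 hli.self_of_nhds _
    (by rw [← hc2.self_of_nhds, h0])
  rw [hΦ.congr hσ hc2, hΦ.sum fun a _ => (he a x).smul (hc1 a)]
  refine Finset.sum_eq_zero fun a _ => ?_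
  rw [hΦ.smul (hc1 a) (he a x), hz, zero_smul]

/-- An operation on several sections that is tensorial in each of them depends only on the values
of the sections at the point. -/
theorem pointwise_of_tensorial [T2Space M] [FiniteDimensional ℝ EM]
    [IsManifold 𝓘(ℝ, EM) ∞ M] [FiniteDimensional ℝ FV] [ContMDiffVectorBundle ∞ FV V 𝓘(ℝ, EM)]
    {ι : Type*} [Fintype ι] [DecidableEq ι] {Ψ : (ι → ∀ y : M, V y) → A}
    (hΨ : ∀ W, (∀ k, SecAt EM FV (W k) x) → ∀ k,
      SmoothTensorialAt EM FV (fun σ => Ψ (Function.update W k σ)) x)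
    {W W' : ι → ∀ y : M, V y} (hW : ∀ k, SecAt EM FV (W k) x) (hW' : ∀ k, SecAt EM FV (W' k) x)
    (h : ∀ k, W k x = W' k x) : Ψ W = Ψ W' := by
  -- The sections are exchanged one at a time.
  have H : ∀ s : Finset ι, Ψ W = Ψ (s.piecewise W' W) := by
    intro s
    induction s using Finset.induction_on with
    | empty => simp
    | insert k s hk ih =>
      have hs : ∀ l, SecAt EM FV (s.piecewise W' W l) x := fun l => by
        by_cases hl : l ∈ s <;> simp [hl, hW, hW']
      rw [Finset.piecewise_insert, ih]
      have := (hΨ _ hs k).pointwise (hW k) (hW' k) (h k)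
      rw [← this, Function.update_eq_self_iff.2]
      simp [hk]
  simpa using H Finset.univ

/-- An operation that is tensorial in each of several sections is given by a multilinear map. -/
theorem exists_multilinear_of_tensorial [T2Space M] [FiniteDimensional ℝ EM]
    [IsManifold 𝓘(ℝ, EM) ∞ M] [FiniteDimensional ℝ FV] [ContMDiffVectorBundle ∞ FV V 𝓘(ℝ, EM)]
    {ι : Type*} [Fintype ι] [DecidableEq ι] {Ψ : (ι → ∀ y : M, V y) → A}
    (hΨ : ∀ W, (∀ k, SecAt EM FV (W k) x) → ∀ k,
      SmoothTensorialAt EM FV (fun σ => Ψ (Function.update W k σ)) x) :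
    ∃ F : MultilinearMap ℝ (fun _ : ι => V x) A, ∀ W, (∀ k, SecAt EM FV (W k) x) →
      Ψ W = F fun k => W k x := by
  have hext : ∀ (Y : ι → V x) k, SecAt EM FV (FiberBundle.extend FV (Y k)) x :=
    fun Y k => secAt_extend (Y k)
  -- Extending a modified family of vectors and modifying the family of extensions give sections
  -- with the same values at x, hence the same result. This transfers additivity and homogeneity
  -- from sections to vectors.
  have hup : ∀ (Y : ι → V x) (k : ι) (σ : ∀ y : M, V y), SecAt EM FV σ x →
      Ψ (fun l => FiberBundle.extend FV (Function.update Y k (σ x) l))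
        = Ψ (Function.update (fun l => FiberBundle.extend FV (Y l)) k σ) := by
    intro Y k σ hσ
    refine pointwise_of_tensorial (EM := EM) (x := x) hΨ (hext _) (fun l => ?_) fun l => ?_
    · rcases eq_or_ne l k with rfl | h
      · simpa using hσ
      · simpa [h] using hext Y l
    · rcases eq_or_ne l k with rfl | h
      · simp
      · simp [h]
  refine ⟨MultilinearMap.mk' (fun Y => Ψ fun k => FiberBundle.extend FV (Y k))
    (fun Y k a b => ?_) (fun Y k r a => ?_), fun W hW => ?_⟩
  · have h := (hΨ _ (hext Y) k).add (secAt_extend (EM := EM) a) (secAt_extend (EM := EM) b)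
    rw [← hup _ _ _ ((secAt_extend a).add (secAt_extend b)), ← hup _ _ _ (secAt_extend a),
      ← hup _ _ _ (secAt_extend b)] at h
    simpa using h
  · have h := (hΨ _ (hext Y) k).smul (f := fun _ => r) contMDiffAt_const
      (secAt_extend (EM := EM) a)
    rw [← hup _ _ _ ((secAt_extend a).const_smul r), ← hup _ _ _ (secAt_extend a)] at h
    simpa using h
  · exact pointwise_of_tensorial (EM := EM) (x := x) hΨ hW (fun k => secAt_extend _) fun k => by simp

/-- Smoothness of a family of multilinear maps can be tested on global smooth sections. -/
theorem secAt_of_multilinear [T2Space M] [FiniteDimensional ℝ EM]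
    [IsManifold 𝓘(ℝ, EM) ∞ M] [FiniteDimensional ℝ FV] [ContMDiffVectorBundle ∞ FV V 𝓘(ℝ, EM)]
    {FU : Type*} [NormedAddCommGroup FU] [NormedSpace ℝ FU]
    {U : M → Type*} [TopologicalSpace (TotalSpace FU U)]
    [∀ x, AddCommGroup (U x)] [∀ x, Module ℝ (U x)] [∀ x, TopologicalSpace (U x)]
    [FiberBundle FU U] [VectorBundle ℝ FU U]
    {ι : Type*} [Fintype ι] [DecidableEq ι] {m : ∀ y : M, MultilinearMap ℝ (fun _ : ι => V y) (U y)}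
    (hm : ∀ W : ι → ∀ y : M, V y, (∀ k y, SecAt EM FV (W k) y) →
      SecAt EM FU (fun y => m y fun k => W k y) x)
    {W : ι → ∀ y : M, V y} (hW : ∀ k, SecAt EM FV (W k) x) :
    SecAt EM FU (fun y => m y fun k => W k y) x := by
  obtain ⟨n, e, he, -, -, hc⟩ := exists_frame (EM := EM) (FV := FV) (V := V) x
  choose c hc1 hc2 using fun k => hc _ (hW k)
  have h1 : SecAt EM FU (fun y => ∑ b : ι → Fin n, (∏ k, c k (b k) y) • m y fun k => e (b k) y) x :=
    SecAt.sum fun b _ => SecAt.smul (ContMDiffAt.prod fun k _ => hc1 k (b k))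
      (hm (fun k => e (b k)) fun k y => he _ y)
  refine h1.congr ?_
  filter_upwards [Filter.eventually_all.2 hc2] with y hy
  simp only [hy]
  rw [MultilinearMap.map_sum]
  refine Finset.sum_congr rfl fun b _ => ?_
  rw [MultilinearMap.map_smul_univ]

variable {FU : Type*} [NormedAddCommGroup FU] [NormedSpace ℝ FU]
  {U : M → Type*} [TopologicalSpace (TotalSpace FU U)]
  [∀ x, AddCommGroup (U x)] [∀ x, Module ℝ (U x)] [∀ x, TopologicalSpace (U x)]
  [FiberBundle FU U] [VectorBundle ℝ FU U]

/-- `D` is additive and satisfies the Leibniz rule for differentiation along `v`. -/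
structure IsDerivationAt (FV : Type*) [NormedAddCommGroup FV] [NormedSpace ℝ FV]
    {V : M → Type*} [TopologicalSpace (TotalSpace FV V)] [∀ x, AddCommGroup (V x)]
    [∀ x, Module ℝ (V x)] [∀ x, TopologicalSpace (V x)] [FiberBundle FV V] {x : M}
    (v : TM EM x) (D : (∀ y : M, V y) → V x) : Prop where
  add : ∀ {σ τ : ∀ y : M, V y}, SecAt EM FV σ x → SecAt EM FV τ x →
    D (fun y => σ y + τ y) = D σ + D τ
  leibniz : ∀ {f : M → ℝ} {σ : ∀ y : M, V y}, FunAt EM f x → SecAt EM FV σ x →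
    D (fun y => f y • σ y) = f x • D σ + mvfderiv 𝓘(ℝ, EM) f x v • σ x

section Derivation

variable {v : TM EM x} {D : (∀ y : M, V y) → V x}

theorem mvfderiv_const_apply (r : ℝ) (v : TM EM x) :
    mvfderiv 𝓘(ℝ, EM) (fun _ : M => r) x v = 0 := by
  rw [mvfderiv_const]; rfl

theorem IsDerivationAt.const_smul (hD : IsDerivationAt FV v D) (r : ℝ) {σ : ∀ y : M, V y}
    (hσ : SecAt EM FV σ x) : D (fun y => r • σ y) = r • D σ := by
  rw [hD.leibniz (f := fun _ => r) contMDiffAt_const hσ, mvfderiv_const_apply, zero_smul, add_zero]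

theorem IsDerivationAt.zero (hD : IsDerivationAt FV v D) : D (fun _ => 0) = 0 := by
  have := hD.const_smul 0 (secAt_zero x)
  simpa using this

theorem IsDerivationAt.neg (hD : IsDerivationAt FV v D) {σ : ∀ y : M, V y}
    (hσ : SecAt EM FV σ x) : D (fun y => -σ y) = -D σ := by
  have := hD.const_smul (-1) hσ
  simpa using this

theorem IsDerivationAt.sum (hD : IsDerivationAt FV v D) {ι : Type*} {s : Finset ι}
    {σ : ι → ∀ y : M, V y} (hσ : ∀ i ∈ s, SecAt EM FV (σ i) x) :
    D (fun y => ∑ i ∈ s, σ i y) = ∑ i ∈ s, D (σ i) := by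
  classical
  induction s using Finset.induction_on with
  | empty => simpa using hD.zero
  | insert a s ha h =>
    simp only [Finset.mem_insert, forall_eq_or_imp] at hσ
    simp only [Finset.sum_insert ha, ← h hσ.2]
    exact hD.add hσ.1 (.sum hσ.2)

variable {DU : (∀ y : M, U y) → U x} {ι : Type*} [Fintype ι] [DecidableEq ι]

/-- The derivative of a field of multilinear maps, for given derivations of the sections. -/
def mderiv (D : (∀ y : M, V y) → V x) (DU : (∀ y : M, U y) → U x)
    (m : ∀ y : M, MultilinearMap ℝ (fun _ : ι => V y) (U y)) (W : ι → ∀ y : M, V y) : U x :=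
  DU (fun y => m y fun k => W k y) - ∑ k, m x (Function.update (fun k => W k x) k (D (W k)))

theorem update_section (W : ι → ∀ y : M, V y) (k : ι) (σ : ∀ y : M, V y) (y : M) :
    (fun l => Function.update W k σ l y) = Function.update (fun l => W l y) k (σ y) := by
  funext l
  rcases eq_or_ne l k with rfl | h
  · simp
  · simp [h]

theorem secAt_update {W : ι → ∀ y : M, V y} (hW : ∀ k, SecAt EM FV (W k) x) (k : ι)
    {σ : ∀ y : M, V y} (hσ : SecAt EM FV σ x) (l : ι) :
    SecAt EM FV (Function.update W k σ l) x := by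
  rcases eq_or_ne l k with rfl | h
  · simpa using hσ
  · simpa [h] using hW l

/-- The field of multilinear maps `m` is smooth at `x`. -/
def SmoothMultiAt (EM FV FU : Type*) [NormedAddCommGroup EM] [NormedSpace ℝ EM]
    [NormedAddCommGroup FV] [NormedSpace ℝ FV] [NormedAddCommGroup FU] [NormedSpace ℝ FU]
    {M : Type*} [TopologicalSpace M] [ChartedSpace EM M]
    {V : M → Type*} [TopologicalSpace (TotalSpace FV V)] [∀ x, AddCommGroup (V x)]
    [∀ x, Module ℝ (V x)] [∀ x, TopologicalSpace (V x)] [FiberBundle FV V]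
    {U : M → Type*} [TopologicalSpace (TotalSpace FU U)] [∀ x, AddCommGroup (U x)]
    [∀ x, Module ℝ (U x)] [∀ x, TopologicalSpace (U x)] [FiberBundle FU U]
    {ι : Type*} (m : ∀ y : M, MultilinearMap ℝ (fun _ : ι => V y) (U y)) (x : M) : Prop :=
  ∀ W : ι → ∀ y : M, V y, (∀ k, SecAt EM FV (W k) x) → SecAt EM FU (fun y => m y fun k => W k y) x

/-- When slot k is multiplied by f, the value of m is multiplied by f too. The term with the
derivative of f coming from `DU` cancels the one coming from `D` in slot k. -/
theorem mderiv_tensorial (hD : IsDerivationAt FV v D) (hDU : IsDerivationAt FU v DU)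
    {m : ∀ y : M, MultilinearMap ℝ (fun _ : ι => V y) (U y)} (hm : SmoothMultiAt EM FV FU m x)
    {W : ι → ∀ y : M, V y} (hW : ∀ k, SecAt EM FV (W k) x) (k : ι) :
    SmoothTensorialAt EM FV (fun σ => mderiv D DU m (Function.update W k σ)) x := by
  have hS : ∀ {σ : ∀ y : M, V y}, SecAt EM FV σ x →
      SecAt EM FU (fun y => m y (Function.update (fun l => W l y) k (σ y))) x := by
    intro σ hσ
    have := hm _ (secAt_update hW k hσ)
    simpa only [update_section] using this
  -- Isolate the term in which slot k itself is differentiated; in all other terms slot k carries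
  -- only the value of σ at x.
  have hsum : ∀ σ : ∀ y : M, V y,
      ∑ l, m x (Function.update (fun l => Function.update W k σ l x) l
        (D (Function.update W k σ l)))
      = m x (Function.update (fun l => W l x) k (D σ))
        + ∑ l ∈ Finset.univ.erase k,
          m x (Function.update (Function.update (fun l => W l x) l (D (W l))) k (σ x)) := by
    intro σ
    rw [← Finset.add_sum_erase _ _ (Finset.mem_univ k)]
    congr 1
    · rw [update_section, Function.update_self, Function.update_idem]
    · refine Finset.sum_congr rfl fun l hl => ?_
      rw [Finset.mem_erase] at hl
      rw [update_section, Function.update_of_ne hl.1, Function.update_comm hl.1.symm]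
  constructor
  · intro σ τ hσ hτ
    simp only [mderiv, hsum]
    simp only [update_section, MultilinearMap.map_update_add]
    rw [hDU.add (hS hσ) (hS hτ), hD.add hσ hτ, MultilinearMap.map_update_add,
      Finset.sum_add_distrib]
    abel
  · intro f σ hf hσ
    simp only [mderiv, hsum]
    simp only [update_section, MultilinearMap.map_update_smul]
    rw [hDU.leibniz hf (hS hσ), hD.leibniz hf hσ, MultilinearMap.map_update_add,
      MultilinearMap.map_update_smul, MultilinearMap.map_update_smul, ← Finset.smul_sum]
    module

theorem exists_mderiv [T2Space M] [FiniteDimensional ℝ EM]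
    [IsManifold 𝓘(ℝ, EM) ∞ M] [FiniteDimensional ℝ FV] [ContMDiffVectorBundle ∞ FV V 𝓘(ℝ, EM)]
    (hD : IsDerivationAt FV v D) (hDU : IsDerivationAt FU v DU)
    {m : ∀ y : M, MultilinearMap ℝ (fun _ : ι => V y) (U y)} (hm : SmoothMultiAt EM FV FU m x) :
    ∃ F : MultilinearMap ℝ (fun _ : ι => V x) (U x), ∀ W, (∀ k, SecAt EM FV (W k) x) →
      mderiv D DU m W = F fun k => W k x :=
  exists_multilinear_of_tensorial (EM := EM) fun _ hW k => mderiv_tensorial hD hDU hm hW k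

end Derivation

end Sections

/-! ### Complex scalars on real smooth sections -/

section ComplexSections

variable {EM : Type*} [NormedAddCommGroup EM] [NormedSpace ℝ EM]
  {M : Type*} [TopologicalSpace M] [ChartedSpace EM M]
  {F : Type*} [NormedAddCommGroup F] [NormedSpace ℂ F]
  {E : M → Type*} [TopologicalSpace (TotalSpace F E)]
  [∀ x, AddCommGroup (E x)] [∀ x, Module ℂ (E x)] [∀ x, TopologicalSpace (E x)]
  [FiberBundle F E] [VectorBundle ℝ F E] [VectorBundle ℂ F E]

open scoped Topology

/-- Smoothness is that of a real bundle; the trivializations are also complex linear, so in a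
trivialization multiplication by √-1 is a fixed linear map of the model fibre. -/
theorem SecAt.I_smul {σ : ∀ y : M, E y} {x : M} (hσ : SecAt EM F σ x) :
    SecAt EM F (fun y => Complex.I • σ y) x := by
  rw [SecAt, contMDiffAt_section] at hσ ⊢
  have hI : ContMDiff 𝓘(ℝ, F) 𝓘(ℝ, F) ∞ fun w : F => Complex.I • w :=
    (contDiff_const_smul Complex.I).contMDiff
  refine (hI.contMDiffAt.comp x hσ).congr_of_eventuallyEq ?_
  filter_upwards [(trivializationAt F E x).open_baseSet.mem_nhds
    (FiberBundle.mem_baseSet_trivializationAt' x)] with y hy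
  exact ((trivializationAt F E x).linear ℂ hy).map_smul Complex.I (σ y)

theorem SecAt.complex_smul {a b : M → ℝ} {σ : ∀ y : M, E y} {x : M} (ha : FunAt EM a x)
    (hb : FunAt EM b x) (hσ : SecAt EM F σ x) :
    SecAt EM F (fun y => (a y + b y * Complex.I : ℂ) • σ y) x := by
  refine ((hσ.smul ha).add (hσ.I_smul.smul hb)).congr (Filter.Eventually.of_forall fun y => ?_)
  rw [add_smul, mul_smul, Complex.coe_smul, Complex.coe_smul]

theorem SecAt.const_complex_smul (z : ℂ) {σ : ∀ y : M, E y} {x : M}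
    (hσ : SecAt EM F σ x) : SecAt EM F (fun y => z • σ y) x := by
  refine (hσ.complex_smul (a := fun _ => z.re) (b := fun _ => z.im) contMDiffAt_const
    contMDiffAt_const).congr (Filter.Eventually.of_forall fun y => ?_)
  simp only [Complex.re_add_im]

variable {x : M} {v : TM EM x} {D : (∀ y : M, E y) → E x}

theorem IsDerivationAt.complex_leibniz (hD : IsDerivationAt F v D)
    (hI : ∀ σ : ∀ y : M, E y, SecAt EM F σ x → D (fun y => Complex.I • σ y) = Complex.I • D σ)
    {a b : M → ℝ} {σ : ∀ y : M, E y} (ha : FunAt EM a x)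
    (hb : FunAt EM b x) (hσ : SecAt EM F σ x) :
    D (fun y => (a y + b y * Complex.I : ℂ) • σ y) = (a x + b x * Complex.I : ℂ) • D σ
      + (mvfderiv 𝓘(ℝ, EM) a x v + mvfderiv 𝓘(ℝ, EM) b x v * Complex.I : ℂ) • σ x := by
  have e : (fun y => (a y + b y * Complex.I : ℂ) • σ y)
      = fun y => a y • σ y + b y • Complex.I • σ y := by
    funext y
    rw [add_smul, mul_smul, Complex.coe_smul, Complex.coe_smul]
  rw [e, hD.add (hσ.smul ha) (hσ.I_smul.smul hb), hD.leibniz ha hσ, hD.leibniz hb hσ.I_smul, hI σ hσ]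
  simp only [add_smul, mul_smul, Complex.coe_smul]
  abel

theorem IsDerivationAt.const_complex_smul (hD : IsDerivationAt F v D)
    (hI : ∀ σ : ∀ y : M, E y, SecAt EM F σ x → D (fun y => Complex.I • σ y) = Complex.I • D σ)
    (z : ℂ) {σ : ∀ y : M, E y} (hσ : SecAt EM F σ x) : D (fun y => z • σ y) = z • D σ := by
  have h := hD.complex_leibniz hI (a := fun _ => z.re) (b := fun _ => z.im) contMDiffAt_const
    contMDiffAt_const hσ
  simpa only [Complex.re_add_im, mvfderiv_const_apply, Complex.ofReal_zero, zero_mul, add_zero,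
    zero_smul] using h

end ComplexSections

/-! ### Derivatives of fields of forms -/

section FormDerivative

variable {EM : Type*} [NormedAddCommGroup EM] [NormedSpace ℝ EM]
  {M : Type*} [TopologicalSpace M] [ChartedSpace EM M]
  [IsManifold 𝓘(ℝ, EM) ∞ M]
  {F : Type*} [NormedAddCommGroup F] [NormedSpace ℂ F]
  {E : M → Type*} [TopologicalSpace (TotalSpace F E)]
  [∀ x, AddCommGroup (E x)] [∀ x, Module ℂ (E x)] [∀ x, TopologicalSpace (E x)]
  [FiberBundle F E]

open scoped Topology

/-- The field of forms of degree `(p, q)` is smooth at `x`. -/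
def SmoothBiformAt (F : Type*) [NormedAddCommGroup F] [NormedSpace ℂ F]
    {E : M → Type*} [TopologicalSpace (TotalSpace F E)]
    [∀ x, AddCommGroup (E x)] [∀ x, Module ℂ (E x)] [∀ x, TopologicalSpace (E x)]
    [FiberBundle F E] {p q : ℕ}
    (η : ∀ y : M, TM EM y [⋀^Fin p]→ₗ[ℝ] (TM EM y [⋀^Fin q]→ₗ[ℝ] E y)) (x : M) : Prop :=
  ∀ (Y : Fin p → ∀ y : M, TM EM y) (Z : Fin q → ∀ y : M, TM EM y),
    (∀ i, SecAt EM EM (Y i) x) → (∀ j, SecAt EM EM (Z j) x) →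
      SecAt EM F (fun y => η y (fun i => Y i y) fun j => Z j y) x

/-- `η'` is the derivative at `x` of the field of forms `η`, for given derivations of vector fields
and of sections of `E`. -/
def HasFormDeriv (F : Type*) [NormedAddCommGroup F] [NormedSpace ℂ F]
    {E : M → Type*} [TopologicalSpace (TotalSpace F E)]
    [∀ x, AddCommGroup (E x)] [∀ x, Module ℂ (E x)] [∀ x, TopologicalSpace (E x)]
    [FiberBundle F E] {p q : ℕ} {x : M}
    (DT : (∀ y : M, TM EM y) → TM EM x) (DE : (∀ y : M, E y) → E x)
    (η : ∀ y : M, TM EM y [⋀^Fin p]→ₗ[ℝ] (TM EM y [⋀^Fin q]→ₗ[ℝ] E y))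
    (η' : TM EM x [⋀^Fin p]→ₗ[ℝ] (TM EM x [⋀^Fin q]→ₗ[ℝ] E x)) : Prop :=
  ∀ (Y : Fin p → ∀ y : M, TM EM y) (Z : Fin q → ∀ y : M, TM EM y),
    (∀ i, SecAt EM EM (Y i) x) → (∀ j, SecAt EM EM (Z j) x) →
      η' (fun i => Y i x) (fun j => Z j x) = DE (fun y => η y (fun i => Y i y) fun j => Z j y)
        - ∑ i, η x (Function.update (fun i => Y i x) i (DT (Y i))) (fun j => Z j x)
        - ∑ j, η x (fun i => Y i x) (Function.update (fun j => Z j x) j (DT (Z j)))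

variable {p q : ℕ} {x : M} {v : TM EM x}
  {DT : (∀ y : M, TM EM y) → TM EM x} {DE : (∀ y : M, E y) → E x}
  {η : ∀ y : M, TM EM y [⋀^Fin p]→ₗ[ℝ] (TM EM y [⋀^Fin q]→ₗ[ℝ] E y)}
  {η' : TM EM x [⋀^Fin p]→ₗ[ℝ] (TM EM x [⋀^Fin q]→ₗ[ℝ] E x)}

theorem secAt_extendT (u : TM EM x) : SecAt EM EM (FiberBundle.extend EM u) x :=
  secAt_extend u

theorem SmoothBiformAt.toMulti (hη : SmoothBiformAt F η x) :
    SmoothMultiAt EM EM F (fun y => toMultilinear (η y)) x :=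
  fun W hW => hη (fun i => W (Sum.inl i)) (fun j => W (Sum.inr j)) (fun _ => hW _) fun _ => hW _

theorem mderiv_toMultilinear (Y : Fin p → ∀ y : M, TM EM y) (Z : Fin q → ∀ y : M, TM EM y) :
    mderiv DT DE (fun y => toMultilinear (η y)) (Sum.elim Y Z)
      = DE (fun y => η y (fun i => Y i y) fun j => Z j y)
        - ∑ i, η x (Function.update (fun i => Y i x) i (DT (Y i))) (fun j => Z j x)
        - ∑ j, η x (fun i => Y i x) (Function.update (fun j => Z j x) j (DT (Z j))) := by
  have h : ∀ y, (fun k => Sum.elim Y Z k y) = Sum.elim (fun i => Y i y) fun j => Z j y := by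
    intro y; funext k; cases k <;> rfl
  simp only [mderiv, h, Fintype.sum_sum_type, toMultilinear_apply, Sum.elim_inl, Sum.elim_inr,
    Sum.update_elim_inl, Sum.update_elim_inr, Sum.elim_comp_inl, Sum.elim_comp_inr, sub_sub]

/-- Tensoriality produces a multilinear map. It is alternating because equal vectors have equal
extensions: the derivative of the section of E is then that of the zero section, and the correction
terms cancel by `sum_update_eq_zero`. -/
theorem exists_hasFormDeriv [T2Space M] [FiniteDimensional ℝ EM] [VectorBundle ℝ F E]
    (hT : IsDerivationAt EM v DT)
    (hE : IsDerivationAt F v DE) (hη : SmoothBiformAt F η x) : ∃ η', HasFormDeriv F DT DE η η' := by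
  obtain ⟨G, hG⟩ := exists_mderiv hT hE hη.toMulti
  have hval : ∀ (Y : Fin p → ∀ y : M, TM EM y) (Z : Fin q → ∀ y : M, TM EM y),
      (∀ i, SecAt EM EM (Y i) x) → (∀ j, SecAt EM EM (Z j) x) →
      mderiv DT DE (fun y => toMultilinear (η y)) (Sum.elim Y Z)
        = G (Sum.elim (fun i => Y i x) fun j => Z j x) := by
    intro Y Z hY hZ
    rw [hG (Sum.elim Y Z) (by rintro (k | k); exacts [hY k, hZ k])]
    congr 1
    funext k; cases k <;> rfl
  have halt : IsBialternating G := by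
    have hex : ∀ W : Fin p ⊕ Fin q → TM EM x,
        G W = mderiv DT DE (fun y => toMultilinear (η y)) fun k => FiberBundle.extend EM (W k) := by
      intro W
      rw [hG _ fun k => secAt_extendT _]
      simp
    have hz : ∀ (W : Fin p ⊕ Fin q → TM EM x) (k l), k ≠ l → W k = W l →
        (∀ (y : M) (W' : Fin p ⊕ Fin q → TM EM y), W' k = W' l → toMultilinear (η y) W' = 0) →
        G W = 0 := by
      intro W k l hkl hW h0
      rw [hex, mderiv, sum_update_eq_zero hkl (h0 x) (by simp [hW]) (by rw [hW]), sub_zero]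
      have : (fun y => toMultilinear (η y) fun k => FiberBundle.extend EM (W k) y) = fun _ => 0 :=
        funext fun y => h0 y _ (by rw [hW])
      rw [this, hE.zero]
    refine ⟨fun i j hij W hW => hz W _ _ (Sum.inl_injective.ne hij) hW fun y W' =>
      (isBialternating_toMultilinear (η y)).left i j hij W', fun i j hij W hW => hz W _ _
      (Sum.inr_injective.ne hij) hW fun y W' => (isBialternating_toMultilinear (η y)).right i j hij W'⟩
  obtain ⟨η', h'⟩ := halt.exists_form
  exact ⟨η', fun Y Z hY hZ => by rw [h', ← hval Y Z hY hZ, mderiv_toMultilinear]⟩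

/-- Every family of vectors at x is the value of smooth fields, so the defining formula determines
all values. -/
theorem HasFormDeriv.unique {η'' : TM EM x [⋀^Fin p]→ₗ[ℝ] (TM EM x [⋀^Fin q]→ₗ[ℝ] E x)}
    (h' : HasFormDeriv F DT DE η η') (h'' : HasFormDeriv F DT DE η η'') : η' = η'' := by
  ext Y Z
  have e1 := h' (fun i => FiberBundle.extend EM (Y i)) (fun j => FiberBundle.extend EM (Z j))
    (fun _ => secAt_extendT _) fun _ => secAt_extendT _
  have e2 := h'' (fun i => FiberBundle.extend EM (Y i)) (fun j => FiberBundle.extend EM (Z j))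
    (fun _ => secAt_extendT _) fun _ => secAt_extendT _
  rw [← e2] at e1
  simpa using e1

theorem HasFormDeriv.add [VectorBundle ℝ F E] (hE : IsDerivationAt F v DE)
    {θ : ∀ y : M, TM EM y [⋀^Fin p]→ₗ[ℝ] (TM EM y [⋀^Fin q]→ₗ[ℝ] E y)}
    {θ' : TM EM x [⋀^Fin p]→ₗ[ℝ] (TM EM x [⋀^Fin q]→ₗ[ℝ] E x)}
    (hη : SmoothBiformAt F η x) (hθ : SmoothBiformAt F θ x)
    (h : HasFormDeriv F DT DE η η') (h' : HasFormDeriv F DT DE θ θ') :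
    HasFormDeriv F DT DE (fun y => η y + θ y) (η' + θ') := by
  intro Y Z hY hZ
  simp only [AlternatingMap.add_apply]
  rw [h Y Z hY hZ, h' Y Z hY hZ, hE.add (hη Y Z hY hZ) (hθ Y Z hY hZ)]
  simp only [Finset.sum_add_distrib]
  abel

theorem HasFormDeriv.smul [VectorBundle ℝ F E] (hE : IsDerivationAt F v DE)
    (hη : SmoothBiformAt F η x)
    (h : HasFormDeriv F DT DE η η') (r : ℝ) :
    HasFormDeriv F DT DE (fun y => r • η y) (r • η') := by
  intro Y Z hY hZ
  simp only [AlternatingMap.smul_apply]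
  rw [h Y Z hY hZ, hE.const_smul r (hη Y Z hY hZ)]
  simp only [← Finset.smul_sum, smul_sub]

theorem HasFormDeriv.complex_smul [VectorBundle ℝ F E] [VectorBundle ℂ F E]
    (hE : IsDerivationAt F v DE)
    (hI : ∀ σ : ∀ y : M, E y, SecAt EM F σ x → DE (fun y => Complex.I • σ y) = Complex.I • DE σ)
    (hη : SmoothBiformAt F η x)
    (h : HasFormDeriv F DT DE η η') (z : ℂ) :
    HasFormDeriv F DT DE (fun y => z • η y) (z • η') := by
  intro Y Z hY hZ
  simp only [AlternatingMap.smul_apply]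
  rw [h Y Z hY hZ, hE.const_complex_smul hI z (hη Y Z hY hZ)]
  simp only [← Finset.smul_sum, smul_sub]

/-- A form-valued derivative defined through extensions of vectors is the derivative. -/
theorem hasFormDeriv_ofValues [T2Space M] [FiniteDimensional ℝ EM] [VectorBundle ℝ F E]
    (hT : IsDerivationAt EM v DT) (hE : IsDerivationAt F v DE)
    {s : ∀ y : M, Forms (TM EM y) (E y) p} (hs : ∀ q, SmoothBiformAt F (fun y => s y q) x) (q : ℕ) :
    HasFormDeriv F DT DE (fun y => s y q) (ofValues (fun q Y Z =>
      DE (fun y => s y q (fun i => FiberBundle.extend EM (Y i) y)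
        (fun j => FiberBundle.extend EM (Z j) y))
      - ∑ i, s x q (Function.update Y i (DT (FiberBundle.extend EM (Y i)))) Z
      - ∑ j, s x q Y (Function.update Z j (DT (FiberBundle.extend EM (Z j))))) q) := by
  choose θ hθ using fun q => exists_hasFormDeriv hT hE (hs q)
  convert hθ q using 1
  ext Y Z
  rw [ofValues_apply (fun q => toMultilinear (θ q)) fun q => isBialternating_toMultilinear (θ q)]
  · have := hθ q (fun i => FiberBundle.extend EM (Y i)) (fun j => FiberBundle.extend EM (Z j))
      (fun _ => secAt_extendT _) fun _ => secAt_extendT _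
    simp only [FiberBundle.extend_apply_self] at this
    exact this.symm
  · intro q Y Z
    have := hθ q (fun i => FiberBundle.extend EM (Y i)) (fun j => FiberBundle.extend EM (Z j))
      (fun _ => secAt_extendT _) fun _ => secAt_extendT _
    simp only [FiberBundle.extend_apply_self] at this
    rw [toMultilinear_apply, Sum.elim_comp_inl, Sum.elim_comp_inr, this]

end FormDerivative

/-! ### Leibniz rules for wedge and contraction -/

section CliffordLeibniz

variable {EM : Type*} [NormedAddCommGroup EM] [NormedSpace ℝ EM]
  {M : Type*} [TopologicalSpace M] [ChartedSpace EM M]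
  [IsManifold 𝓘(ℝ, EM) ∞ M]
  {F : Type*} [NormedAddCommGroup F] [NormedSpace ℂ F]
  {E : M → Type*} [TopologicalSpace (TotalSpace F E)]
  [∀ x, AddCommGroup (E x)] [∀ x, Module ℂ (E x)] [∀ x, TopologicalSpace (E x)]
  [FiberBundle F E] [VectorBundle ℝ F E] [VectorBundle ℂ F E]

open scoped Topology

variable {p q : ℕ} {x : M} {v : TM EM x}
  {DT : (∀ y : M, TM EM y) → TM EM x} {DE : (∀ y : M, E y) → E x}
  {J : ∀ y : M, TM EM y →L[ℝ] TM EM y}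
  {s : ∀ y : M, Forms (TM EM y) (E y) p} {s' : Forms (TM EM x) (E x) p}

/-- Apply the defining formula to extensions of the arguments, once as they are and once with J
applied to one of them. The derivations commute with J and √-1, so every term changes by the same
factor. -/
theorem isTypeP_of_hasFormDeriv
    (hI : ∀ σ : ∀ y : M, E y, SecAt EM F σ x → DE (fun y => Complex.I • σ y) = Complex.I • DE σ)
    (hJs : ∀ Y : ∀ y : M, TM EM y, SecAt EM EM Y x → SecAt EM EM (fun y => J y (Y y)) x)
    (hJ : ∀ Y : ∀ y : M, TM EM y, SecAt EM EM Y x → DT (fun y => J y (Y y)) = J x (DT Y))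
    (hn : ∀ σ : ∀ y : M, E y, SecAt EM F σ x → DE (fun y => -σ y) = -DE σ)
    (hs : ∀ q, SmoothBiformAt F (fun y => s y q) x)
    (ht : ∀ y, IsTypeP (J y).toLinearMap (s y))
    (h : ∀ q, HasFormDeriv F DT DE (fun y => s y q) (s' q)) : IsTypeP (J x).toLinearMap s' := by
  intro q Y Z
  have hY : ∀ i, SecAt EM EM (FiberBundle.extend EM (Y i)) x := fun i => secAt_extendT _
  have hZ : ∀ i, SecAt EM EM (FiberBundle.extend EM (Z i)) x := fun i => secAt_extendT _
  have hl : ∀ (y : M) (Y : Fin p → TM EM y) (i) (w : TM EM y) (Z : Fin q → TM EM y),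
      s y q (Function.update Y i (J y w)) Z = Complex.I • s y q (Function.update Y i w) Z :=
    fun y Y i w Z => DFunLike.congr_fun ((ht y).left q Y i w) Z
  have hr : ∀ (y : M) (Y : Fin p → TM EM y) (i) (w : TM EM y) (Z : Fin q → TM EM y),
      s y q Y (Function.update Z i (J y w)) = -(Complex.I • s y q Y (Function.update Z i w)) :=
    fun y Y i w Z => (ht y).right q Y Z i w
  have h0 := h q _ _ hY hZ
  constructor
  · intro i
    have h1 := h q _ _ (secAt_update hY i (hJs _ (hY i))) hZ
    simp only [update_section, FiberBundle.extend_apply_self, hl] at h0 h1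
    simp only [Function.update_eq_self] at h1
    rw [← Finset.add_sum_erase _ _ (Finset.mem_univ i)] at h1 h0
    have h2 : ∀ k ∈ Finset.univ.erase i, s x q (Function.update (Function.update Y i (J x (Y i))) k
        (DT (Function.update (fun k => FiberBundle.extend EM (Y k)) i
          (fun y => J y (FiberBundle.extend EM (Y i) y)) k))) Z
        = Complex.I • s x q (Function.update Y k (DT (FiberBundle.extend EM (Y k)))) Z := by
      intro k hk
      rw [Finset.mem_erase] at hk
      rw [Function.update_of_ne hk.1, Function.update_comm hk.1.symm, hl]
      congr 3
      rw [Function.update_comm hk.1, Function.update_eq_self]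
    rw [Finset.sum_congr rfl h2, Function.update_self, Function.update_idem, hJ _ (hY i), hl,
      hI _ (hs q _ _ hY hZ), ← Finset.smul_sum, ← Finset.smul_sum, ← smul_add, ← smul_sub,
      ← smul_sub, ← h0] at h1
    exact h1
  · intro i
    have h1 := h q _ _ hY (secAt_update hZ i (hJs _ (hZ i)))
    simp only [update_section, FiberBundle.extend_apply_self, hr] at h0 h1
    simp only [Function.update_eq_self] at h1
    rw [← Finset.add_sum_erase (a := i) (s := Finset.univ) (f := fun j => s x q _
      (Function.update (Function.update Z i _) j _)) (Finset.mem_univ i)] at h1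
    rw [← Finset.add_sum_erase (a := i) (s := Finset.univ) (f := fun j => s x q _
      (Function.update Z j _)) (Finset.mem_univ i)] at h0
    have h2 : ∀ k ∈ Finset.univ.erase i, s x q Y (Function.update (Function.update Z i (J x (Z i))) k
        (DT (Function.update (fun k => FiberBundle.extend EM (Z k)) i
          (fun y => J y (FiberBundle.extend EM (Z i) y)) k)))
        = -(Complex.I • s x q Y (Function.update Z k (DT (FiberBundle.extend EM (Z k))))) := by
      intro k hk
      rw [Finset.mem_erase] at hk
      rw [Function.update_of_ne hk.1, Function.update_comm hk.1.symm, hr]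
      congr 3
      rw [Function.update_comm hk.1, Function.update_eq_self]
    rw [Finset.sum_congr rfl h2, Function.update_self, Function.update_idem, hJ _ (hZ i), hr,
      hn _ (hs q _ _ hY hZ).I_smul,
      hI _ (hs q _ _ hY hZ), Finset.sum_neg_distrib, Finset.sum_neg_distrib, ← Finset.smul_sum,
      ← Finset.smul_sum] at h1
    refine h1.trans ?_
    rw [show s' q Y Z = _ from h0]
    module

theorem SecAt.zsmul {σ : ∀ y : M, E y} (hσ : SecAt EM F σ x) (n : ℤ) :
    SecAt EM F (fun y => n • σ y) x :=
  (hσ.const_smul n).congr (Filter.Eventually.of_forall fun y => Int.cast_smul_eq_zsmul ℝ n (σ y))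

theorem IsDerivationAt.zsmul (hE : IsDerivationAt F v DE) {σ : ∀ y : M, E y}
    (hσ : SecAt EM F σ x) (n : ℤ) : DE (fun y => n • σ y) = n • DE σ := by
  simp only [← Int.cast_smul_eq_zsmul ℝ n]
  exact hE.const_smul n hσ

/-- Leibniz rule for the exterior product with the one-form `a + √-1 b`. -/
theorem HasFormDeriv.wedge
    (hE : IsDerivationAt F v DE)
    (hI : ∀ σ : ∀ y : M, E y, SecAt EM F σ x → DE (fun y => Complex.I • σ y) = Complex.I • DE σ)
    {a b : ∀ y : M, TM EM y → ℝ} {α : ∀ y : M, TM EM y →ₗ[ℝ] ℂ} {α' : TM EM x →ₗ[ℝ] ℂ}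
    (hα : ∀ y w, α y w = a y w + b y w * Complex.I)
    (ha : ∀ Z : ∀ y : M, TM EM y, SecAt EM EM Z x → FunAt EM (fun y => a y (Z y)) x)
    (hb : ∀ Z : ∀ y : M, TM EM y, SecAt EM EM Z x → FunAt EM (fun y => b y (Z y)) x)
    (hd : ∀ Z : ∀ y : M, TM EM y, SecAt EM EM Z x →
      (mvfderiv 𝓘(ℝ, EM) (fun y => a y (Z y)) x v
        + mvfderiv 𝓘(ℝ, EM) (fun y => b y (Z y)) x v * Complex.I : ℂ) = α' (Z x) + α x (DT Z))
    {η : ∀ y : M, TM EM y [⋀^Fin p]→ₗ[ℝ] (TM EM y [⋀^Fin q]→ₗ[ℝ] E y)}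
    {η' : TM EM x [⋀^Fin p]→ₗ[ℝ] (TM EM x [⋀^Fin q]→ₗ[ℝ] E x)}
    (hη : SmoothBiformAt F η x) (h : HasFormDeriv F DT DE η η') :
    SmoothBiformAt F (fun y => (TwistedSpinc.wedge (α y)).compAlternatingMap (η y)) x ∧
    HasFormDeriv F DT DE (fun y => (TwistedSpinc.wedge (α y)).compAlternatingMap (η y))
      ((TwistedSpinc.wedge α').compAlternatingMap (η x)
        + (TwistedSpinc.wedge (α x)).compAlternatingMap η') := by
  have hsm : ∀ (Y : Fin p → ∀ y : M, TM EM y) (Z : Fin (q + 1) → ∀ y : M, TM EM y),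
      (∀ i, SecAt EM EM (Y i) x) → (∀ j, SecAt EM EM (Z j) x) → ∀ i : Fin (q + 1),
      SecAt EM F (fun y => (α y (Z i y)) • η y (fun k => Y k y) (i.removeNth fun j => Z j y)) x := by
    intro Y Z hY hZ i
    simp only [hα]
    exact (hη Y (fun j => Z (i.succAbove j)) hY fun j => hZ _).complex_smul (ha _ (hZ i))
      (hb _ (hZ i))
  constructor
  · intro Y Z hY hZ
    simp only [LinearMap.compAlternatingMap_apply, wedge_apply]
    exact SecAt.sum fun i _ => (hsm Y Z hY hZ i).zsmul _
  · intro Y Z hY hZ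
    have hrem : ∀ (i : Fin (q + 1)) (y : M), (i.removeNth fun j => Z j y)
        = fun k => (fun j => Z (i.succAbove j)) k y := fun i y => rfl
    have hDE : ∀ i : Fin (q + 1), DE (fun y => α y (Z i y) • η y (fun k => Y k y)
        (i.removeNth fun j => Z j y)) = α x (Z i x) • DE (fun y => η y (fun k => Y k y)
          (i.removeNth fun j => Z j y)) + (α' (Z i x) + α x (DT (Z i))) • η x (fun k => Y k x)
          (i.removeNth fun j => Z j x) := by
      intro i
      rw [← hd _ (hZ i)]
      simp only [hα]
      exact hE.complex_leibniz hI (ha _ (hZ i)) (hb _ (hZ i))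
        (hη Y (fun j => Z (i.succAbove j)) hY fun j => hZ _)
    have hη' : ∀ i : Fin (q + 1), η' (fun k => Y k x) (i.removeNth fun j => Z j x) = _ :=
      fun i => h Y (fun j => Z (i.succAbove j)) hY fun j => hZ _
    -- Differentiating the argument fed to α gives the term for α; differentiating any other
    -- argument gives a correction term for η with the i-th argument removed.
    have hup : ∀ i : Fin (q + 1), ∑ j, α x (Function.update (fun j => Z j x) j (DT (Z j)) i) •
          η x (fun k => Y k x) (i.removeNth (Function.update (fun j => Z j x) j (DT (Z j))))
        = α x (DT (Z i)) • η x (fun k => Y k x) (i.removeNth fun j => Z j x)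
          + α x (Z i x) • ∑ j, η x (fun k => Y k x) (Function.update
            (fun j => Z (i.succAbove j) x) j (DT (Z (i.succAbove j)))) := by
      intro i
      rw [Fin.sum_univ_succAbove _ i, Function.update_self, Fin.removeNth_update, Finset.smul_sum]
      congr 1
      refine Finset.sum_congr rfl fun j _ => ?_
      rw [Function.update_of_ne (Fin.succAbove_ne i j).symm, Fin.removeNth_update_succAbove]
      rfl
    simp only [AlternatingMap.add_apply, LinearMap.compAlternatingMap_apply, wedge_apply]
    rw [hE.sum fun i _ => (hsm Y Z hY hZ i).zsmul _]
    rw [Finset.sum_comm (γ := Fin p), Finset.sum_comm (γ := Fin (q + 1)) (s := Finset.univ)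
      (t := Finset.univ) (f := fun (j i : Fin (q + 1)) => (-1) ^ (i : ℕ) •
        α x (Function.update (fun j => Z j x) j (DT (Z j)) i) •
          η x (fun k => Y k x) (i.removeNth (Function.update (fun j => Z j x) j (DT (Z j)))))]
    simp only [← Finset.smul_sum, hup]
    simp only [fun i => hE.zsmul (hsm Y Z hY hZ i), hDE, hη']
    rw [← Finset.sum_add_distrib, ← Finset.sum_sub_distrib, ← Finset.sum_sub_distrib]
    refine Finset.sum_congr rfl fun i _ => ?_
    rw [← smul_add, ← smul_sub, ← smul_sub]
    congr 1
    simp only [hrem, smul_sub, add_smul]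
    abel

/-- Leibniz rule for the interior product with a vector field. -/
theorem HasFormDeriv.contract {X : ∀ y : M, TM EM y} (hX : SecAt EM EM X x)
    {η : ∀ y : M, TM EM y [⋀^Fin p]→ₗ[ℝ] (TM EM y [⋀^Fin (q + 1)]→ₗ[ℝ] E y)}
    {η' : TM EM x [⋀^Fin p]→ₗ[ℝ] (TM EM x [⋀^Fin (q + 1)]→ₗ[ℝ] E x)}
    {θ : ∀ y : M, TM EM y [⋀^Fin p]→ₗ[ℝ] (TM EM y [⋀^Fin q]→ₗ[ℝ] E y)}
    {θ' : TM EM x [⋀^Fin p]→ₗ[ℝ] (TM EM x [⋀^Fin q]→ₗ[ℝ] E x)}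
    (hθ : ∀ y Y Z, θ y Y Z = η y Y (Fin.cons (X y) Z))
    (hθ' : ∀ Y Z, θ' Y Z = η x Y (Fin.cons (DT X) Z) + η' Y (Fin.cons (X x) Z))
    (hη : SmoothBiformAt F η x) (h : HasFormDeriv F DT DE η η') :
    SmoothBiformAt F θ x ∧ HasFormDeriv F DT DE θ θ' := by
  have hc : ∀ (Z : Fin q → ∀ y : M, TM EM y), (∀ j, SecAt EM EM (Z j) x) →
      ∀ j, SecAt EM EM ((Fin.cons X Z : Fin (q + 1) → ∀ y : M, TM EM y) j) x := by
    intro Z hZ j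
    refine Fin.cases ?_ (fun j => ?_) j
    · exact hX
    · exact hZ j
  have hcy : ∀ (Z : Fin q → ∀ y : M, TM EM y) (y : M),
      (fun j => (Fin.cons X Z : Fin (q + 1) → ∀ y : M, TM EM y) j y)
        = Fin.cons (X y) fun j => Z j y := by
    intro Z y
    funext j
    refine Fin.cases ?_ (fun j => ?_) j <;> rfl
  constructor
  · intro Y Z hY hZ
    have := hη Y (Fin.cons X Z) hY (hc Z hZ)
    simpa only [hcy, ← hθ] using this
  · intro Y Z hY hZ
    have := h Y (Fin.cons X Z) hY (hc Z hZ)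
    simp only [hcy, Fin.sum_univ_succ, Fin.cons_zero, Fin.cons_succ, Fin.update_cons_zero,
      ← Fin.cons_update, ← hθ] at this
    rw [hθ', this]
    abel

end CliffordLeibniz

/-! ### Derivations compatible with the metric and J -/

section HermitianDerivation

variable {EM : Type*} [NormedAddCommGroup EM] [NormedSpace ℝ EM]
  {M : Type*} [TopologicalSpace M] [ChartedSpace EM M]
  [IsManifold 𝓘(ℝ, EM) ∞ M]
  {g : ∀ x : M, TM EM x →ₗ[ℝ] TM EM x →ₗ[ℝ] ℝ} {J : ∀ x : M, TM EM x →L[ℝ] TM EM x}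

/-- `g` and `J` form a smooth almost Hermitian structure on `M`. -/
structure IsSmoothHermitian (g : ∀ x : M, TM EM x →ₗ[ℝ] TM EM x →ₗ[ℝ] ℝ)
    (J : ∀ x : M, TM EM x →L[ℝ] TM EM x) : Prop where
  pair : ∀ x, IsHermitianPair (g x) (J x).toLinearMap
  smooth_J : ∀ (x : M) (Y : ∀ y : M, TM EM y), SecAt EM EM Y x →
    SecAt EM EM (fun y => J y (Y y)) x
  smooth_g : ∀ (x : M) (Y Z : ∀ y : M, TM EM y), SecAt EM EM Y x → SecAt EM EM Z x →
    FunAt EM (fun y => g y (Y y) (Z y)) x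

/-- A derivation of vector fields that preserves `g` and `J`. -/
structure IsHermitianDerivation (g : ∀ x : M, TM EM x →ₗ[ℝ] TM EM x →ₗ[ℝ] ℝ)
    (J : ∀ x : M, TM EM x →L[ℝ] TM EM x) {x : M} (v : TM EM x)
    (DT : (∀ y : M, TM EM y) → TM EM x) : Prop extends IsDerivationAt EM v DT where
  map_J : ∀ Y : ∀ y : M, TM EM y, SecAt EM EM Y x → DT (fun y => J y (Y y)) = J x (DT Y)
  metric : ∀ Y Z : ∀ y : M, TM EM y, SecAt EM EM Y x → SecAt EM EM Z x →
    mvfderiv 𝓘(ℝ, EM) (fun y => g y (Y y) (Z y)) x v = g x (DT Y) (Z x) + g x (Y x) (DT Z)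

variable {F : Type*} [NormedAddCommGroup F] [NormedSpace ℂ F]
  {E : M → Type*} [TopologicalSpace (TotalSpace F E)]
  [∀ x, AddCommGroup (E x)] [∀ x, Module ℂ (E x)] [∀ x, TopologicalSpace (E x)]
  [FiberBundle F E] [VectorBundle ℝ F E] [VectorBundle ℂ F E]

/-- A complex linear derivation of sections of `E`. -/
structure IsComplexDerivation (F : Type*) [NormedAddCommGroup F] [NormedSpace ℂ F]
    {E : M → Type*} [TopologicalSpace (TotalSpace F E)]
    [∀ x, AddCommGroup (E x)] [∀ x, Module ℂ (E x)] [∀ x, TopologicalSpace (E x)]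
    [FiberBundle F E] {x : M} (v : TM EM x) (DE : (∀ y : M, E y) → E x) : Prop
    extends IsDerivationAt F v DE where
  map_I : ∀ σ : ∀ y : M, E y, SecAt EM F σ x → DE (fun y => Complex.I • σ y) = Complex.I • DE σ

variable {p : ℕ} {x : M} {v : TM EM x}
  {DT : (∀ y : M, TM EM y) → TM EM x} {DE : (∀ y : M, E y) → E x}
  {s : ∀ y : M, Forms (TM EM y) (E y) p} {s' : Forms (TM EM x) (E x) p}
  {X : ∀ y : M, TM EM y}

theorem FunAt.const_mul {f : M → ℝ} (r : ℝ) (hf : FunAt EM f x) : FunAt EM (fun y => r * f y) x :=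
  contMDiffAt_const.mul hf

theorem mvfderiv_const_mul {f : M → ℝ} (r : ℝ) (hf : FunAt EM f x) :
    mvfderiv 𝓘(ℝ, EM) (fun y => r * f y) x v = r * mvfderiv 𝓘(ℝ, EM) f x v := by
  have := mvfderiv_mul (I := 𝓘(ℝ, EM)) (f := fun _ => r) (g := f) (x := x) mdifferentiableAt_const
    (hf.mdifferentiableAt (by simp))
  rw [mvfderiv_const] at this
  have h := DFunLike.congr_fun this v
  rw [show (fun y => r * f y) = (fun _ => r) * f from rfl]
  simpa using h

/-- A derivation preserving g and J turns the dual form of X₁ into the dual form of the (1,0) part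
of the derivative of X. The wedge rule is applied with the real and imaginary parts g(X, ·)/2 and
-g(JX, ·)/2. -/
theorem hasFormDeriv_wedgeF (hE : IsComplexDerivation F v DE) (hH : IsSmoothHermitian g J)
    (hT : IsHermitianDerivation g J v DT) (hs : ∀ q, SmoothBiformAt F (fun y => s y q) x)
    (h : ∀ q, HasFormDeriv F DT DE (fun y => s y q) (s' q)) (hX : SecAt EM EM X x) (q : ℕ) :
    SmoothBiformAt F (fun y => wedgeF (dualForm (g y) (pr10 (J y).toLinearMap (1 ⊗ₜ X y))) (s y) q) x
    ∧ HasFormDeriv F DT DE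
      (fun y => wedgeF (dualForm (g y) (pr10 (J y).toLinearMap (1 ⊗ₜ X y))) (s y) q)
      (wedgeF (dualForm (g x) (pr10 (J x).toLinearMap (1 ⊗ₜ DT X))) (s x) q
        + wedgeF (dualForm (g x) (pr10 (J x).toLinearMap (1 ⊗ₜ X x))) s' q) := by
  match q with
  | 0 =>
    simp only [wedgeF_apply_zero]
    refine ⟨fun Y Z _ _ => by simpa using secAt_zero x, fun Y Z _ _ => ?_⟩
    simpa using hE.zero.symm
  | q + 1 =>
    have hJX := hH.smooth_J x X hX
    refine HasFormDeriv.wedge hE.toIsDerivationAt hE.map_I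
      (a := fun y w => (1 / 2) * g y (X y) w) (b := fun y w => (-1 / 2) * g y (J y (X y)) w)
      (fun y w => ?_) (fun Z hZ => (hH.smooth_g x _ _ hX hZ).const_mul _)
      (fun Z hZ => (hH.smooth_g x _ _ hJX hZ).const_mul _) (fun Z hZ => ?_) (hs q) (h q)
    · rw [dualForm_pr10]
      simp only [ContinuousLinearMap.coe_coe]
      push_cast
      ring
    · rw [mvfderiv_const_mul _ (hH.smooth_g x _ _ hX hZ),
        mvfderiv_const_mul _ (hH.smooth_g x _ _ hJX hZ),
        hT.metric _ _ hX hZ, hT.metric _ _ hJX hZ, hT.map_J _ hX, dualForm_pr10, dualForm_pr10]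
      simp only [ContinuousLinearMap.coe_coe]
      push_cast
      ring

/-- Both the field and its derivative have the right type, so `IsTypeP.contract_pr01` removes the
projections and the rule for contraction with a real vector field applies. -/
theorem hasFormDeriv_contractF
    (hs : ∀ q, SmoothBiformAt F (fun y => s y q) x)
    (h : ∀ q, HasFormDeriv F DT DE (fun y => s y q) (s' q))
    (ht : ∀ y, IsTypeP (J y).toLinearMap (s y)) (ht' : IsTypeP (J x).toLinearMap s')
    (hX : SecAt EM EM X x) (q : ℕ) :
    SmoothBiformAt F (fun y => contractF (pr01 (J y).toLinearMap (1 ⊗ₜ X y)) (s y) q) x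
    ∧ HasFormDeriv F DT DE
      (fun y => contractF (pr01 (J y).toLinearMap (1 ⊗ₜ X y)) (s y) q)
      (contractF (pr01 (J x).toLinearMap (1 ⊗ₜ DT X)) (s x) q
        + contractF (pr01 (J x).toLinearMap (1 ⊗ₜ X x)) s' q) := by
  refine HasFormDeriv.contract hX (η := fun y => s y (q + 1)) (η' := s' (q + 1))
    (fun y Y Z => ?_) (fun Y Z => ?_) (hs _) (h _)
  · rw [contractF_apply, (ht y).contract_pr01]
    rfl
  · simp only [AlternatingMap.add_apply]
    rw [contractF_apply, (ht x).contract_pr01, contractF_apply, ht'.contract_pr01]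
    rfl

/-- The Clifford action satisfies the Leibniz rule. -/
theorem hasFormDeriv_cliffF (hE : IsComplexDerivation F v DE) (hH : IsSmoothHermitian g J)
    (hT : IsHermitianDerivation g J v DT) (hs : ∀ q, SmoothBiformAt F (fun y => s y q) x)
    (h : ∀ q, HasFormDeriv F DT DE (fun y => s y q) (s' q))
    (ht : ∀ y, IsTypeP (J y).toLinearMap (s y)) (hX : SecAt EM EM X x) (q : ℕ) :
    SmoothBiformAt F (fun y => cliffF (g y) (J y).toLinearMap (X y) (s y) q) x
    ∧ HasFormDeriv F DT DE
      (fun y => cliffF (g y) (J y).toLinearMap (X y) (s y) q)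
      (cliffF (g x) (J x).toLinearMap (DT X) (s x) q
        + cliffF (g x) (J x).toLinearMap (X x) s' q) := by
  have ht' : IsTypeP (J x).toLinearMap s' := isTypeP_of_hasFormDeriv hE.map_I
    (fun Y => hH.smooth_J x Y) hT.map_J (fun σ hσ => hE.neg hσ) hs ht h
  obtain ⟨w1, w2⟩ := hasFormDeriv_wedgeF hE hH hT hs h hX q
  obtain ⟨c1, c2⟩ := hasFormDeriv_contractF hs h ht ht' hX q
  have e : ∀ (y : M) (w : TM EM y) (η : Forms (TM EM y) (E y) p),
      cliffF (g y) (J y).toLinearMap w η q = ((√2 : ℝ) : ℂ) •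
        (wedgeF (dualForm (g y) (pr10 (J y).toLinearMap (1 ⊗ₜ w))) η q
          + (-1 : ℝ) • contractF (pr01 (J y).toLinearMap (1 ⊗ₜ w)) η q) := by
    intro y w η
    have h1 : (-1 : ℝ) • contractF (pr01 (J y).toLinearMap (1 ⊗ₜ w)) η q
        = -contractF (pr01 (J y).toLinearMap (1 ⊗ₜ w)) η q :=
      AlternatingMap.ext fun Y => neg_one_smul ℝ _
    rw [cliffF_eq, h1, ← sub_eq_add_neg]
    rfl
  have hc1 : SmoothBiformAt F (fun y =>
      (-1 : ℝ) • contractF (pr01 (J y).toLinearMap (1 ⊗ₜ X y)) (s y) q) x :=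
    fun Y Z hY hZ => (c1 Y Z hY hZ).const_smul (-1)
  have hs1 : SmoothBiformAt F (fun y =>
      wedgeF (dualForm (g y) (pr10 (J y).toLinearMap (1 ⊗ₜ X y))) (s y) q
        + (-1 : ℝ) • contractF (pr01 (J y).toLinearMap (1 ⊗ₜ X y)) (s y) q) x :=
    fun Y Z hY hZ => (w1 Y Z hY hZ).add (hc1 Y Z hY hZ)
  simp only [e]
  constructor
  · exact fun Y Z hY hZ => (hs1 Y Z hY hZ).const_complex_smul _
  · have := (w2.add hE.toIsDerivationAt w1 hc1 (c2.smul hE.toIsDerivationAt c1 (-1))).complex_smul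
      hE.toIsDerivationAt hE.map_I hs1 ((√2 : ℝ) : ℂ)
    convert this using 1
    rw [← smul_add]
    congr 1
    rw [smul_add]
    abel

end HermitianDerivation

/-! ### The Levi-Civita connection and its projection -/

section Connections

variable {EM : Type*} [NormedAddCommGroup EM] [NormedSpace ℝ EM]
  {M : Type*} [TopologicalSpace M] [ChartedSpace EM M]
  [IsManifold 𝓘(ℝ, EM) ∞ M]

section Generic

variable {FV : Type*} [NormedAddCommGroup FV] [NormedSpace ℝ FV]
  {V : M → Type*} [TopologicalSpace (TotalSpace FV V)]
  [∀ x, AddCommGroup (V x)] [∀ x, Module ℝ (V x)] [∀ x, TopologicalSpace (V x)]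
  [∀ x, IsTopologicalAddGroup (V x)] [∀ x, ContinuousSMul ℝ (V x)]
  [FiberBundle FV V]

theorem isDerivationAt_covariantDerivative (D : CovariantDerivative 𝓘(ℝ, EM) FV V) {x : M}
    (v : TM EM x) : IsDerivationAt FV v (fun σ => D σ x v) where
  add hσ hτ := DFunLike.congr_fun (D.isCovariantDerivativeOnUniv.add
    (hσ.mdifferentiableAt (by simp)) (hτ.mdifferentiableAt (by simp))) v
  leibniz hf hσ := DFunLike.congr_fun (D.isCovariantDerivativeOnUniv.leibniz
    (hσ.mdifferentiableAt (by simp)) (hf.mdifferentiableAt (by simp))) v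

theorem secAt_covariantDerivative [VectorBundle ℝ FV V] {D : CovariantDerivative 𝓘(ℝ, EM) FV V}
    (hD : CovariantDerivative.ContMDiffCovariantDerivative D ∞) {σ : ∀ y : M, V y}
    (hσ : ∀ y, SecAt EM FV σ y) {x : M} {X : ∀ y : M, TM EM y} (hX : SecAt EM EM X x) :
    SecAt EM FV (fun y => D σ y (X y)) x := by
  have h := hD.contMDiff.contMDiff (σ := σ) (fun y _ => (hσ y).contMDiffWithinAt)
  exact ContMDiffAt.clm_bundle_apply (𝕜 := ℝ) (n := ∞) (b := fun y => y)
    (ϕ := fun y => D σ y) (v := X) ((h x trivial).contMDiffAt Filter.univ_mem) hX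

end Generic

variable {Ω : ∀ x : M, TM EM x →L[ℝ] TM EM x →L[ℝ] ℝ} {J : ∀ x : M, TM EM x →L[ℝ] TM EM x}
  {nab : AffineConn EM M}

theorem IsSymplectic.antisymm (hΩ : IsSymplectic Ω) (x : M) (u v : TM EM x) :
    Ω x u v = -Ω x v u := by
  have h := hΩ.alt x (u + v)
  simp only [map_add, add_apply, hΩ.alt] at h
  linarith

theorem metric_apply (x : M) (u v : TM EM x) : metric Ω J x u v = Ω x u (J x v) := rfl

theorem isSmoothHermitian (hΩ : IsSymplectic Ω) (hJ : IsCompatible Ω J) :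
    IsSmoothHermitian (metric Ω J) J where
  pair x :=
    { sq := hJ.sq x
      symm := hJ.symm x
      orth := fun u v => by
        rw [ContinuousLinearMap.coe_coe, metric_apply, hJ.sq, map_neg, ← hΩ.antisymm,
          ← metric_apply (Ω := Ω) (J := J), hJ.symm] }
  smooth_J := hJ.smooth
  smooth_g x Y Z hY hZ := hΩ.smooth x _ _ hY (hJ.smooth x Z hZ)

/-- `nablaJ` is the average of ∇ and its conjugate J⁻¹∇J; conjugation by J exchanges the two. -/
theorem nablaJ_map_J (hJ : IsCompatible Ω J) (Y : ∀ y : M, TM EM y)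
    {x : M} (hY : SecAt EM EM Y x) (v : TM EM x) :
    nablaJ nab J (fun y => J y (Y y)) x v = J x (nablaJ nab J Y x v) := by
  have h2 := (isDerivationAt_covariantDerivative nab v).neg hY
  simp only [nablaJ, map_smul, map_sub, hJ.sq]
  rw [show nab (fun y => -Y y) x v = -nab Y x v from h2, map_neg]
  congr 1
  abel

/-- J is orthogonal, so the conjugate of ∇ by J is metric as well, and the average of two metric
connections is metric. -/
theorem isHermitianDerivation_nablaJ (hΩ : IsSymplectic Ω) (hJ : IsCompatible Ω J)
    (hnab : IsLeviCivita (metric Ω J) nab) {x : M} (v : TM EM x) :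
    IsHermitianDerivation (metric Ω J) J v (fun Y => nablaJ nab J Y x v) where
  add {Y Z} hY hZ := by
    have hD := isDerivationAt_covariantDerivative nab v
    have h1 := hD.add hY hZ
    have h2 := hD.add (hJ.smooth x Y hY) (hJ.smooth x Z hZ)
    simp only [nablaJ, map_add]
    rw [show nab (fun y => Y y + Z y) x v = _ from h1,
      show nab (fun y => J y (Y y) + J y (Z y)) x v = _ from h2, map_add]
    module
  leibniz {f Y} hf hY := by
    have hD := isDerivationAt_covariantDerivative nab v
    have h1 := hD.leibniz hf hY
    have h2 := hD.leibniz hf (hJ.smooth x Y hY)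
    simp only [nablaJ, map_smul]
    rw [show nab (fun y => f y • Y y) x v = _ from h1,
      show nab (fun y => f y • J y (Y y)) x v = _ from h2, map_add, map_smul, map_smul, hJ.sq]
    module
  map_J Y hY := nablaJ_map_J hJ Y hY v
  metric Y Z hY hZ := by
    have hH := isSmoothHermitian hΩ hJ
    have hJY := hJ.smooth x Y hY
    have hJZ := hJ.smooth x Z hZ
    have h1 := hnab.metric x v Y Z hY hZ
    have h2 := hnab.metric x v _ _ hJY hJZ
    have h3 : (fun y => metric Ω J y (J y (Y y)) (J y (Z y))) = fun y => metric Ω J y (Y y) (Z y) :=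
      funext fun y => (hH.pair y).orth _ _
    rw [h3] at h2
    have h4 : ∀ u w, metric Ω J x (J x u) w = -metric Ω J x u (J x w) := fun u w => by
      have := (hH.pair x).skew u w
      simp only [ContinuousLinearMap.coe_coe] at this
      rw [this, neg_neg]
    have h5 : ∀ u w, metric Ω J x u (J x w) = -metric Ω J x (J x u) w := fun u w => by
      rw [h4, neg_neg]
    simp only [nablaJ, map_smul, map_sub, LinearMap.smul_apply, LinearMap.sub_apply, smul_eq_mul]
    rw [h5 (Y x), h4 _ (Z x)]
    linarith

end Connections

/-! ### The spin action of a skew endomorphism -/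

section Algebra

variable {T : Type*} [AddCommGroup T] [Module ℝ T] {N : Type*} [AddCommGroup N] [Module ℂ N]
  {m : ℕ} {g : T →ₗ[ℝ] T →ₗ[ℝ] ℝ} {J : T →ₗ[ℝ] T} {e : Module.Basis (Fin m) ℝ T} {p : ℕ}

theorem cliffF_cliffF (hp : IsHermitianPair g J) (X Y : T) (η : Forms T N p) :
    cliffF g J X (cliffF g J Y η) = -cliffF g J Y (cliffF g J X η) - ((2 * g X Y : ℝ) : ℂ) • η := by
  have h := DFunLike.congr_fun (cliffF_mul_add (N := N) (p := p) hp.sq hp.symm hp.orth X Y) η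
  have h' : cliffF g J X (cliffF g J Y η) + cliffF g J Y (cliffF g J X η)
      = ((-2 * g X Y : ℝ) : ℂ) • η := h
  rw [eq_sub_of_add_eq h']
  push_cast
  module

/-- The spin representation of a skew endomorphism acts on Clifford multiplication through the
endomorphism. -/
theorem sum_cliffF_commutator (hp : IsHermitianPair g J)
    (he : ∀ i j, g (e i) (e j) = if i = j then 1 else 0) (B : T →ₗ[ℝ] T)
    (hB : ∀ u v, g (B u) v = -g u (B v)) (X : T) (η : Forms T N p) :
    ∑ j, cliffF g J (e j) (cliffF g J (B (e j)) (cliffF g J X η))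
      = cliffF g J X (∑ j, cliffF g J (e j) (cliffF g J (B (e j)) η))
        + (4 : ℂ) • cliffF g J (B X) η := by
  -- Moving c(X) to the left past both factors leaves two scalar corrections. Skewness of B rewrites
  -- one of them, and after summation each equals 2 c(BX), which gives the factor 4.
  have h1 : ∀ j, cliffF g J (e j) (cliffF g J (B (e j)) (cliffF g J X η))
      = cliffF g J X (cliffF g J (e j) (cliffF g J (B (e j)) η))
        + (2 : ℂ) • cliffF g J (B (g (e j) X • e j)) η
        + (2 : ℂ) • cliffF g J (g (e j) (B X) • e j) η := by
    intro j
    rw [cliffF_cliffF hp (B (e j)) X, map_sub, map_neg, cliffF_cliffF hp (e j) X, map_smul, hB,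
      map_smul B, map_smul (cliffF g J), map_smul (cliffF g J), LinearMap.smul_apply,
      LinearMap.smul_apply, ← Complex.coe_smul, ← Complex.coe_smul]
    push_cast
    module
  simp only [h1, Finset.sum_add_distrib, ← Finset.smul_sum, ← map_sum]
  have h2 : ∀ u : Fin m → T, ∑ j, cliffF g J (u j) η = cliffF g J (∑ j, u j) η := fun u => by
    rw [map_sum, LinearMap.sum_apply]
  rw [h2, h2, ← map_sum, sum_inner_smul he, sum_inner_smul he]
  module

end Algebra

/-! ### The difference tensor B_v = (1/2) J (∇_v J) -/

section TorsionTensor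

variable {EM : Type*} [NormedAddCommGroup EM] [NormedSpace ℝ EM]
  {M : Type*} [TopologicalSpace M] [ChartedSpace EM M]
  [IsManifold 𝓘(ℝ, EM) ∞ M]

theorem exists_linear_of_tensorial [T2Space M] [FiniteDimensional ℝ EM]
    {FV : Type*} [NormedAddCommGroup FV] [NormedSpace ℝ FV] [FiniteDimensional ℝ FV]
    {V : M → Type*} [TopologicalSpace (TotalSpace FV V)]
    [∀ x, AddCommGroup (V x)] [∀ x, Module ℝ (V x)] [∀ x, TopologicalSpace (V x)]
    [FiberBundle FV V] [VectorBundle ℝ FV V] [ContMDiffVectorBundle ∞ FV V 𝓘(ℝ, EM)]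
    {A : Type*} [AddCommGroup A] [Module ℝ A] {Φ : (∀ y : M, V y) → A} {x : M}
    (hΦ : SmoothTensorialAt EM FV Φ x) :
    ∃ L : V x →ₗ[ℝ] A, ∀ σ, SecAt EM FV σ x → Φ σ = L (σ x) := by
  have he : ∀ v : V x, SecAt EM FV (FiberBundle.extend FV v) x := fun v => secAt_extend v
  refine ⟨{ toFun := fun v => Φ (FiberBundle.extend FV v)
            map_add' := fun u v => ?_
            map_smul' := fun r v => ?_ }, fun σ hσ => hΦ.pointwise hσ (he _) (by simp)⟩
  · rw [← hΦ.add (he u) (he v)]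
    exact hΦ.pointwise (he _) ((he u).add (he v)) (by simp)
  · rw [RingHom.id_apply, ← hΦ.smul (f := fun _ => r) contMDiffAt_const (he v)]
    exact hΦ.pointwise (he _) ((he v).const_smul r) (by simp)

variable {Ω : ∀ x : M, TM EM x →L[ℝ] TM EM x →L[ℝ] ℝ} {J : ∀ x : M, TM EM x →L[ℝ] TM EM x}
  {nab : AffineConn EM M}

/-- The difference `∇_v u - (∇^{T^{(1,0)}M})_v u`. -/
def diffB (nab : AffineConn EM M) (J : ∀ x : M, TM EM x →L[ℝ] TM EM x) (x : M) (v u : TM EM x) :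
    TM EM x :=
  nab (FiberBundle.extend EM u) x v - nablaJ nab J (FiberBundle.extend EM u) x v

variable [T2Space M] [FiniteDimensional ℝ EM]

/-- Two connections on the same bundle have the same Leibniz term, so their difference depends only
on the value of the field at x. -/
theorem diffB_eq (hΩ : IsSymplectic Ω) (hJ : IsCompatible Ω J)
    (hnab : IsLeviCivita (metric Ω J) nab) {x : M} (v : TM EM x) {Y : ∀ y : M, TM EM y}
    (hY : SecAt EM EM Y x) : nab Y x v - nablaJ nab J Y x v = diffB nab J x v (Y x) := by
  have h1 := isDerivationAt_covariantDerivative nab v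
  have h2 := isHermitianDerivation_nablaJ hΩ hJ hnab v
  have h3 : SmoothTensorialAt EM EM (fun Y => nab Y x v - nablaJ nab J Y x v) x :=
    { add := fun {σ τ} hσ hτ => by
        rw [h1.add hσ hτ, h2.add hσ hτ]
        abel
      smul := fun {f σ} hf hσ => by
        rw [h1.leibniz hf hσ, h2.leibniz hf hσ]
        module }
  exact h3.pointwise hY (secAt_extendT _) (by simp)

/-- `diffB` is bilinear. -/
theorem exists_diffB (hΩ : IsSymplectic Ω) (hJ : IsCompatible Ω J)
    (hnab : IsLeviCivita (metric Ω J) nab) (x : M) :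
    ∃ B : TM EM x →ₗ[ℝ] TM EM x →ₗ[ℝ] TM EM x, ∀ v u, B v u = diffB nab J x v u := by
  have h1 := fun v : TM EM x => isDerivationAt_covariantDerivative nab v
  have h2 := fun v : TM EM x => isHermitianDerivation_nablaJ hΩ hJ hnab v
  have he : ∀ v : TM EM x, SecAt EM EM (FiberBundle.extend EM v) x := fun v => secAt_extendT v
  refine ⟨LinearMap.mk₂ ℝ (diffB nab J x) (fun v w u => ?_) (fun r v u => ?_) (fun v u w => ?_)
    (fun r v u => ?_), fun v u => rfl⟩
  · simp only [diffB, nablaJ, map_add]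
    module
  · simp only [diffB, nablaJ, map_smul]
    module
  · have := diffB_eq hΩ hJ hnab v ((he u).add (he w))
    rw [(h1 v).add (he u) (he w), (h2 v).add (he u) (he w)] at this
    simp only [FiberBundle.extend_apply_self] at this
    rw [← this, diffB, diffB]
    abel
  · have := diffB_eq hΩ hJ hnab v ((he u).const_smul r)
    rw [(h1 v).const_smul r (he u), (h2 v).toIsDerivationAt.const_smul r (he u)] at this
    simp only [FiberBundle.extend_apply_self] at this
    rw [← this, diffB, smul_sub]

theorem diffB_skew (hΩ : IsSymplectic Ω) (hJ : IsCompatible Ω J)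
    (hnab : IsLeviCivita (metric Ω J) nab) (x : M) (v u w : TM EM x) :
    metric Ω J x (diffB nab J x v u) w = -metric Ω J x u (diffB nab J x v w) := by
  have h1 := hnab.metric x v _ _ (secAt_extendT u) (secAt_extendT w)
  have h2 := (isHermitianDerivation_nablaJ hΩ hJ hnab v).metric _ _ (secAt_extendT u)
    (secAt_extendT w)
  simp only [FiberBundle.extend_apply_self] at h1 h2
  simp only [diffB, map_sub, LinearMap.sub_apply]
  linarith

/-- `nablaJ` takes away the part of ∇ commuting with J. What is left is (1/2) J (∇_v J), and ∇_v J
anticommutes with J because J² is constant. -/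
theorem diffB_J (hΩ : IsSymplectic Ω) (hJ : IsCompatible Ω J)
    (hnab : IsLeviCivita (metric Ω J) nab) (x : M) (v u : TM EM x) :
    diffB nab J x v (J x u) = -J x (diffB nab J x v u) := by
  have hu := secAt_extendT u
  have h := diffB_eq hΩ hJ hnab v (hJ.smooth x _ hu)
  simp only [FiberBundle.extend_apply_self] at h
  rw [nablaJ_map_J hJ _ hu v] at h
  rw [← h, diffB]
  simp only [nablaJ, map_sub, map_smul, hJ.sq]
  module

theorem nab_J_eq (hJ : IsCompatible Ω J) (x : M) (v u : TM EM x) :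
    nab (fun y => J y (FiberBundle.extend EM u y)) x v
      = J x (nab (FiberBundle.extend EM u) x v) - (2 : ℝ) • J x (diffB nab J x v u) := by
  simp only [diffB, nablaJ, map_sub, map_smul, hJ.sq]
  module

theorem omega_eq_metric (hΩ : IsSymplectic Ω) (hJ : IsCompatible Ω J) (y : M) (u w : TM EM y) :
    Ω y u w = metric Ω J y (J y u) w := by
  rw [hJ.symm, metric_apply, hJ.sq, map_neg, ← hΩ.antisymm]

/-- For a torsion-free connection dΩ is the cyclic sum of ∇Ω. Since Ω = g(J·, ·) with g parallel,
(∇_X Ω)(Y, Z) = g((∇_X J) Y, Z) = -2 g(J B_X Y, Z). Closedness therefore gives the identity. -/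
theorem diffB_cyclic (hΩ : IsSymplectic Ω) (hJ : IsCompatible Ω J)
    (hnab : IsLeviCivita (metric Ω J) nab) (x : M) (X Y Z : TM EM x) :
    metric Ω J x (J x (diffB nab J x X Y)) Z + metric Ω J x (J x (diffB nab J x Y Z)) X
      + metric Ω J x (J x (diffB nab J x Z X)) Y = 0 := by
  have hX := secAt_extendT X
  have hY := secAt_extendT Y
  have hZ := secAt_extendT Z
  have hc := hΩ.closed x _ _ _ hX hY hZ
  have hg := fun (y : M) (u w : TM EM y) => omega_eq_metric hΩ hJ y u w
  -- This is (∇_v Ω)(u, w) = -2 g(J B_v u, w), with the Leibniz terms kept on the right; the terms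
  -- with ∇ cancel against the brackets later.
  have hd : ∀ v u w : TM EM x, mvfderiv 𝓘(ℝ, EM) (fun y => Ω y (FiberBundle.extend EM u y)
      (FiberBundle.extend EM w y)) x v = Ω x (nab (FiberBundle.extend EM u) x v) w
        - 2 * metric Ω J x (J x (diffB nab J x v u)) w
        + Ω x u (nab (FiberBundle.extend EM w) x v) := by
    intro v u w
    simp only [hg]
    rw [hnab.metric x v _ _ (hJ.smooth x _ (secAt_extendT u)) (secAt_extendT w), nab_J_eq hJ]
    simp only [FiberBundle.extend_apply_self, map_sub, map_smul, LinearMap.sub_apply,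
      LinearMap.smul_apply, smul_eq_mul]
  simp only [← hnab.torsionFree x _ _ hX hY, ← hnab.torsionFree x _ _ hY hZ,
    ← hnab.torsionFree x _ _ hZ hX, FiberBundle.extend_apply_self, hd, map_sub,
    sub_apply] at hc
  have a1 := hΩ.antisymm x X (nab (FiberBundle.extend EM Y) x Z)
  have a2 := hΩ.antisymm x Y (nab (FiberBundle.extend EM Z) x X)
  have a3 := hΩ.antisymm x Z (nab (FiberBundle.extend EM X) x Y)
  have a4 := hΩ.antisymm x X (nab (FiberBundle.extend EM Z) x Y)
  have a5 := hΩ.antisymm x Y (nab (FiberBundle.extend EM X) x Z)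
  have a6 := hΩ.antisymm x Z (nab (FiberBundle.extend EM Y) x X)
  linarith

theorem eq_of_metric (hJ : IsCompatible Ω J) {x : M} {u w : TM EM x}
    (h : ∀ z, metric Ω J x u z = metric Ω J x w z) : u = w := by
  by_contra hne
  have := hJ.pos x (u - w) (sub_ne_zero.2 hne)
  rw [LinearMap.map_sub₂, h, sub_self] at this
  exact lt_irrefl _ this

/-- An almost Kähler structure is quasi-Kähler: B is antilinear also in the direction of
differentiation. The cyclic identity at (JX, Y, Z), (X, JY, Z), (X, Y, JZ) and (JX, JY, JZ),
combined with antilinearity of B in its second argument, leaves only this relation. -/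
theorem diffB_J_left (hΩ : IsSymplectic Ω) (hJ : IsCompatible Ω J)
    (hnab : IsLeviCivita (metric Ω J) nab) (x : M) (X Y : TM EM x) :
    diffB nab J x (J x X) Y = -J x (diffB nab J x X Y) := by
  have hB := fun v u => diffB_J hΩ hJ hnab x v u
  have hp := (isSmoothHermitian hΩ hJ).pair x
  have ho : ∀ u w, metric Ω J x (J x u) (J x w) = metric Ω J x u w := hp.orth
  have hk : ∀ u w, metric Ω J x u (J x w) = -metric Ω J x (J x u) w := hp.skew
  have key : ∀ Z, metric Ω J x (J x (diffB nab J x (J x X) Y)) Z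
      = metric Ω J x (diffB nab J x X Y) Z := by
    intro Z
    have c1 := diffB_cyclic hΩ hJ hnab x (J x X) Y Z
    have c2 := diffB_cyclic hΩ hJ hnab x X (J x Y) Z
    have c3 := diffB_cyclic hΩ hJ hnab x X Y (J x Z)
    have c4 := diffB_cyclic hΩ hJ hnab x (J x X) (J x Y) (J x Z)
    simp only [hB, map_neg, hJ.sq, neg_neg, ho, hk] at c1 c2 c3 c4
    linarith
  have := eq_of_metric hJ key
  rw [← this, hJ.sq, neg_neg]

end TorsionTensor

/-! ### Metric contractions in smooth frames -/

section Gram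

open scoped Topology

variable {EM : Type*} [NormedAddCommGroup EM] [NormedSpace ℝ EM] [FiniteDimensional ℝ EM]
  {M : Type*} [TopologicalSpace M] [T2Space M] [ChartedSpace EM M]
  [IsManifold 𝓘(ℝ, EM) ∞ M]

theorem funAt_det {n : ℕ} {A : M → Matrix (Fin n) (Fin n) ℝ} {x : M}
    (hA : ∀ a b, FunAt EM (fun y => A y a b) x) : FunAt EM (fun y => (A y).det) x := by
  simp only [Matrix.det_apply']
  exact ContMDiffAt.sum fun σ _ => contMDiffAt_const.mul (ContMDiffAt.prod fun i _ => hA _ _)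

theorem funAt_inv {n : ℕ} {A : M → Matrix (Fin n) (Fin n) ℝ} {x : M}
    (hA : ∀ a b, FunAt EM (fun y => A y a b) x) (h0 : (A x).det ≠ 0) (a b : Fin n) :
    FunAt EM (fun y => (A y)⁻¹ a b) x := by
  have h : (fun y => (A y)⁻¹ a b)
      = fun y => ((A y).det)⁻¹ * ((A y).updateRow b (Pi.single a 1)).det := by
    funext y
    rw [Matrix.inv_def, Matrix.smul_apply, Ring.inverse_eq_inv, smul_eq_mul, Matrix.adjugate_apply]
  rw [h]
  refine ContMDiffAt.mul ((funAt_det hA).inv₀ h0) (funAt_det fun c d => ?_)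
  by_cases hc : c = b
  · subst hc
    simp only [Matrix.updateRow_self]
    exact contMDiffAt_const
  · simp only [Matrix.updateRow_ne hc]
    exact hA c d

/-- A smooth frame near `x`, with the inverse of its Gram matrix. -/
theorem exists_gram {g : ∀ x : M, TM EM x →ₗ[ℝ] TM EM x →ₗ[ℝ] ℝ}
    (hg : ∀ (x : M) (Y Z : ∀ y : M, TM EM y), SecAt EM EM Y x → SecAt EM EM Z x →
      FunAt EM (fun y => g y (Y y) (Z y)) x)
    (hpos : ∀ (x : M) (v : TM EM x), v ≠ 0 → 0 < g x v v) (x : M) :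
    ∃ (n : ℕ) (u : Fin n → ∀ y : M, TM EM y) (G : Fin n → Fin n → M → ℝ),
      (∀ a y, SecAt EM EM (u a) y) ∧ (∀ a b, FunAt EM (G a b) x) ∧
      ∀ᶠ y in 𝓝 x, ∀ w : TM EM y, ∑ a, ∑ b, (G a b y * g y (u b y) w) • u a y = w := by
  obtain ⟨n, u, hu, hli, hsp, -⟩ := exists_frame (EM := EM) (FV := EM) (V := TangentSpace 𝓘(ℝ, EM)) x
  let A : M → Matrix (Fin n) (Fin n) ℝ := fun y => Matrix.of fun a b => g y (u a y) (u b y)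
  have hA : ∀ a b, FunAt EM (fun y => A y a b) x := fun a b => hg x _ _ (hu a x) (hu b x)
  -- A null vector of the Gram matrix gives a combination of the frame orthogonal to the whole
  -- frame, hence to itself; positivity makes it zero.
  have hdet : ∀ᶠ y in 𝓝 x, (A y).det ≠ 0 := by
    filter_upwards [hli] with y hy h0
    obtain ⟨c, hc, hc0⟩ := Matrix.exists_mulVec_eq_zero_iff.2 h0
    have h1 : ∀ a, g y (u a y) (∑ b, c b • u b y) = 0 := fun a => by
      have := congrFun hc0 a
      simp only [Matrix.mulVec, dotProduct, A, Matrix.of_apply, Pi.zero_apply] at this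
      rw [map_sum, ← this]
      exact Finset.sum_congr rfl fun b _ => by rw [map_smul, smul_eq_mul, mul_comm]
    have h2 : (∑ b, c b • u b y) = 0 := by
      by_contra hne
      have h3 : ∀ w, g y (∑ b, c b • u b y) w = ∑ b, c b * g y (u b y) w := fun w => by simp
      have h4 := hpos y _ hne
      rw [h3] at h4
      simp only [h1, mul_zero, Finset.sum_const_zero, lt_self_iff_false] at h4
    exact hc (funext (Fintype.linearIndependent_iff.1 hy c h2))
  refine ⟨n, u, fun a b y => (A y)⁻¹ a b, hu, fun a b => funAt_inv hA hdet.self_of_nhds a b, ?_⟩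
  filter_upwards [hsp, hdet] with y hy h0 w
  obtain ⟨c, hc⟩ := (Submodule.mem_span_range_iff_exists_fun ℝ).1 (hy (x := w) trivial)
  have h1 : ∀ a, ∑ b, (A y)⁻¹ a b * g y (u b y) w = c a := by
    intro a
    have h2 : ∀ b, g y (u b y) w = (A y).mulVec c b := fun b => by
      rw [← hc, map_sum]
      exact Finset.sum_congr rfl fun d _ => by
        rw [map_smul, smul_eq_mul, mul_comm]
        rfl
    simp only [h2]
    have h3 : (A y)⁻¹.mulVec ((A y).mulVec c) = c := by
      rw [Matrix.mulVec_mulVec, Matrix.nonsing_inv_mul _ (isUnit_iff_ne_zero.2 h0),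
        Matrix.one_mulVec]
    exact congrFun h3 a
  simp only [← Finset.sum_smul, h1, hc]

end Gram

/-- The contraction of a bilinear map with the metric does not depend on the frame. The pointwise
orthonormal basis, whose dependence on the point is not controlled, is replaced by a smooth frame
with smooth inverse Gram coefficients. -/
theorem sum_orthonormal_eq_gram {T V : Type*} [AddCommGroup T] [Module ℝ T] [AddCommGroup V]
    [Module ℝ V] {m n : ℕ} {g : T →ₗ[ℝ] T →ₗ[ℝ] ℝ} {e : Module.Basis (Fin m) ℝ T}
    (he : ∀ i j, g (e i) (e j) = if i = j then 1 else 0) (hs : ∀ u v, g u v = g v u)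
    {u : Fin n → T} {G : Fin n → Fin n → ℝ}
    (h : ∀ w : T, ∑ a, ∑ b, (G a b * g (u b) w) • u a = w) (β : T →ₗ[ℝ] T →ₗ[ℝ] V) :
    ∑ j, β (e j) (e j) = ∑ a, ∑ b, G a b • β (u a) (u b) := by
  have h1 : ∀ j, β (e j) (e j) = ∑ a, ∑ b, (G a b * g (u b) (e j)) • β (u a) (e j) := fun j => by
    refine (congrArg (fun w => β w (e j)) (h (e j)).symm).trans ?_
    simp only [map_sum, map_smul, LinearMap.sum_apply, LinearMap.smul_apply]
  simp only [h1]
  rw [Finset.sum_comm]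
  refine Finset.sum_congr rfl fun a _ => ?_
  rw [Finset.sum_comm]
  refine Finset.sum_congr rfl fun b _ => ?_
  conv_rhs => rw [← sum_inner_smul he (u b)]
  simp only [map_sum, map_smul, Finset.smul_sum, smul_smul]
  exact Finset.sum_congr rfl fun j _ => by rw [hs]

/-! ### The connection on forms induced by the projected connection -/

section CovOnForms

open scoped Topology

variable {EM : Type*} [NormedAddCommGroup EM] [NormedSpace ℝ EM] [FiniteDimensional ℝ EM]
  {M : Type*} [TopologicalSpace M] [T2Space M] [ChartedSpace EM M]
  [IsManifold 𝓘(ℝ, EM) ∞ M]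
  {Ω : ∀ x : M, TM EM x →L[ℝ] TM EM x →L[ℝ] ℝ} {J : ∀ x : M, TM EM x →L[ℝ] TM EM x}
  {nab : AffineConn EM M}
  {F : Type*} [NormedAddCommGroup F] [NormedSpace ℂ F]
  {E : M → Type*} [TopologicalSpace (TotalSpace F E)]
  [∀ x, AddCommGroup (E x)] [∀ x, Module ℂ (E x)] [∀ x, TopologicalSpace (E x)]
  [FiberBundle F E] [∀ x, IsTopologicalAddGroup (E x)]
  [∀ x, ContinuousSMul ℝ (E x)] [VectorBundle ℝ F E] [VectorBundle ℂ F E]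
  {h : ∀ x : M, E x →ₗ⋆[ℂ] E x →ₗ[ℂ] ℂ} {covE : CovariantDerivative 𝓘(ℝ, EM) F E}

theorem isComplexDerivation_covE (hcovE : IsHermitianConnection h covE) {x : M} (v : TM EM x) :
    IsComplexDerivation F v (fun σ => covE σ x v) where
  toIsDerivationAt := isDerivationAt_covariantDerivative covE v
  map_I σ hσ := hcovE.complexLinear x v σ hσ

variable {p : ℕ} {s s₁ s₂ : ∀ y : M, Forms (TM EM y) (E y) p}

theorem IsSmoothForm.biform (hs : IsSmoothForm F J s) (x : M) (q : ℕ) :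
    SmoothBiformAt F (fun y => s y q) x := hs.smooth q x

variable (hΩ : IsSymplectic Ω) (hJ : IsCompatible Ω J)
  (hnab : IsLeviCivita (metric Ω J) nab) (hcovE : IsHermitianConnection h covE)

include hΩ hJ hnab hcovE

theorem hasFormDeriv_cov0 (hs : IsSmoothForm F J s) (x : M) (v : TM EM x) (q : ℕ) :
    HasFormDeriv F (fun Y => nablaJ nab J Y x v) (fun σ => covE σ x v) (fun y => s y q)
      (cov0 nab J covE s x v q) :=
  hasFormDeriv_ofValues (isHermitianDerivation_nablaJ hΩ hJ hnab v).toIsDerivationAt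
    (isComplexDerivation_covE hcovE v).toIsDerivationAt (hs.biform x) q

/-- By uniqueness, every algebraic rule for `cov0` reduces to exhibiting the expected form as a
derivative. -/
theorem cov0_eq_of_hasFormDeriv (hs : IsSmoothForm F J s) {x : M} {v : TM EM x}
    {η : Forms (TM EM x) (E x) p}
    (hη : ∀ q, HasFormDeriv F (fun Y => nablaJ nab J Y x v) (fun σ => covE σ x v) (fun y => s y q)
      (η q)) : cov0 nab J covE s x v = η :=
  funext fun q => (hasFormDeriv_cov0 hΩ hJ hnab hcovE hs x v q).unique (hη q)

theorem isTypeP_cov0 (hs : IsSmoothForm F J s) (x : M) (v : TM EM x) :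
    IsTypeP (J x).toLinearMap (cov0 nab J covE s x v) :=
  isTypeP_of_hasFormDeriv (isComplexDerivation_covE hcovE v).map_I (fun Y => hJ.smooth x Y)
    (isHermitianDerivation_nablaJ hΩ hJ hnab v).map_J
    (fun _ hσ => (isComplexDerivation_covE hcovE v).neg hσ) (hs.biform x) hs.isType
    (hasFormDeriv_cov0 hΩ hJ hnab hcovE hs x v)

theorem isSmoothForm_cliffF (hs : IsSmoothForm F J s) {X : ∀ y : M, TM EM y}
    (hX : ∀ y, SecAt EM EM X y) :
    IsSmoothForm F J fun y => cliffF (metric Ω J y) (J y).toLinearMap (X y) (s y) where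
  isType y := (hs.isType y).cliffF_isTypeP ((isSmoothHermitian hΩ hJ).pair y) _
  -- Only the smoothness half of the Leibniz statement is used, so the direction of differentiation
  -- may be zero.
  smooth q x := (hasFormDeriv_cliffF (isComplexDerivation_covE hcovE (0 : TM EM x))
    (isSmoothHermitian hΩ hJ) (isHermitianDerivation_nablaJ hΩ hJ hnab _) (hs.biform x)
    (hasFormDeriv_cov0 hΩ hJ hnab hcovE hs x 0) hs.isType (hX x) q).1

/-- A version asking for smoothness at one point only. It applies to Clifford products whose vector
fields are known to be smooth only at x, as in the correction term of `cov`. -/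
theorem smoothBiformAt_cliffF {x : M} (hs : ∀ q, SmoothBiformAt F (fun y => s y q) x)
    (ht : ∀ y, IsTypeP (J y).toLinearMap (s y)) {X : ∀ y : M, TM EM y} (hX : SecAt EM EM X x)
    (q : ℕ) : SmoothBiformAt F
      (fun y => cliffF (metric Ω J y) (J y).toLinearMap (X y) (s y) q) x := by
  have h1 := isComplexDerivation_covE hcovE (0 : TM EM x)
  have h2 := isHermitianDerivation_nablaJ hΩ hJ hnab (0 : TM EM x)
  choose s' hs' using fun q => exists_hasFormDeriv h2.toIsDerivationAt h1.toIsDerivationAt (hs q)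
  exact (hasFormDeriv_cliffF (s' := s') h1 (isSmoothHermitian hΩ hJ) h2 hs hs' ht hX q).1

theorem cov0_cliffF (hs : IsSmoothForm F J s) {X : ∀ y : M, TM EM y}
    (hX : ∀ y, SecAt EM EM X y) (x : M) (v : TM EM x) :
    cov0 nab J covE (fun y => cliffF (metric Ω J y) (J y).toLinearMap (X y) (s y)) x v
      = cliffF (metric Ω J x) (J x).toLinearMap (nablaJ nab J X x v) (s x)
        + cliffF (metric Ω J x) (J x).toLinearMap (X x) (cov0 nab J covE s x v) :=
  cov0_eq_of_hasFormDeriv hΩ hJ hnab hcovE (isSmoothForm_cliffF hΩ hJ hnab hcovE hs hX) fun q =>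
    (hasFormDeriv_cliffF (isComplexDerivation_covE hcovE v)
      (isSmoothHermitian hΩ hJ) (isHermitianDerivation_nablaJ hΩ hJ hnab _) (hs.biform x)
      (hasFormDeriv_cov0 hΩ hJ hnab hcovE hs x v) hs.isType (hX x) q).2

omit hΩ hJ hnab hcovE in
theorem IsSmoothForm.add (h₁ : IsSmoothForm F J s₁) (h₂ : IsSmoothForm F J s₂) :
    IsSmoothForm F J fun y => s₁ y + s₂ y where
  isType y := (h₁.isType y).add (h₂.isType y)
  smooth q x Y Z hY hZ := (h₁.biform x q Y Z hY hZ).add (h₂.biform x q Y Z hY hZ)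

omit hΩ hJ hnab hcovE in
theorem IsSmoothForm.smul (hs : IsSmoothForm F J s) (z : ℂ) :
    IsSmoothForm F J fun y => z • s y where
  isType y := (hs.isType y).smul z
  smooth q x Y Z hY hZ := (hs.biform x q Y Z hY hZ).const_complex_smul z

theorem cov0_add (h₁ : IsSmoothForm F J s₁) (h₂ : IsSmoothForm F J s₂) (x : M) (v : TM EM x) :
    cov0 nab J covE (fun y => s₁ y + s₂ y) x v
      = cov0 nab J covE s₁ x v + cov0 nab J covE s₂ x v :=
  cov0_eq_of_hasFormDeriv hΩ hJ hnab hcovE (h₁.add h₂) fun q =>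
    (hasFormDeriv_cov0 hΩ hJ hnab hcovE h₁ x v q).add
      (isComplexDerivation_covE hcovE v).toIsDerivationAt (h₁.biform x q) (h₂.biform x q)
      (hasFormDeriv_cov0 hΩ hJ hnab hcovE h₂ x v q)

theorem cov0_smul (hs : IsSmoothForm F J s) (z : ℂ) (x : M) (v : TM EM x) :
    cov0 nab J covE (fun y => z • s y) x v = z • cov0 nab J covE s x v :=
  cov0_eq_of_hasFormDeriv hΩ hJ hnab hcovE (hs.smul z) fun q =>
    (hasFormDeriv_cov0 hΩ hJ hnab hcovE hs x v q).complex_smul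
      (isComplexDerivation_covE hcovE v).toIsDerivationAt (isComplexDerivation_covE hcovE v).map_I
      (hs.biform x q) z

theorem exists_cov0_linear (hs : IsSmoothForm F J s) (x : M) :
    ∃ L : TM EM x →ₗ[ℝ] Forms (TM EM x) (E x) p, ∀ v, cov0 nab J covE s x v = L v := by
  refine ⟨{ toFun := cov0 nab J covE s x
            map_add' := fun v w => ?_
            map_smul' := fun r v => ?_ }, fun v => rfl⟩
  · refine cov0_eq_of_hasFormDeriv hΩ hJ hnab hcovE hs fun q Y Z hY hZ => ?_
    have e1 := hasFormDeriv_cov0 hΩ hJ hnab hcovE hs x v q Y Z hY hZ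
    have e2 := hasFormDeriv_cov0 hΩ hJ hnab hcovE hs x w q Y Z hY hZ
    have e3 : ∀ Y : ∀ y : M, TM EM y, nablaJ nab J Y x (v + w)
        = nablaJ nab J Y x v + nablaJ nab J Y x w := fun Y => by
      simp only [nablaJ, map_add]
      module
    rw [Pi.add_apply, AlternatingMap.add_apply, AlternatingMap.add_apply, e1, e2]
    simp only [e3, map_add, AlternatingMap.map_update_add, AlternatingMap.add_apply,
      Finset.sum_add_distrib]
    abel
  · refine cov0_eq_of_hasFormDeriv hΩ hJ hnab hcovE hs fun q Y Z hY hZ => ?_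
    have e1 := hasFormDeriv_cov0 hΩ hJ hnab hcovE hs x v q Y Z hY hZ
    have e3 : ∀ Y : ∀ y : M, TM EM y, nablaJ nab J Y x (r • v)
        = r • nablaJ nab J Y x v := fun Y => by
      simp only [nablaJ, map_smul]
      module
    rw [RingHom.id_apply, Pi.smul_apply, AlternatingMap.smul_apply, AlternatingMap.smul_apply, e1]
    simp only [e3, map_smul, AlternatingMap.map_update_smul, AlternatingMap.smul_apply,
      ← Finset.smul_sum, smul_sub]

/-- The covariant derivative of a smooth form along a smooth vector field is smooth. -/
theorem smoothBiformAt_cov0 (hs : IsSmoothForm F J s) {X : ∀ y : M, TM EM y}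
    (hX : ∀ y, SecAt EM EM X y) (x : M) (q : ℕ) :
    SmoothBiformAt F (fun y => cov0 nab J covE s y (X y) q) x := by
  -- Smoothness of ∇W is available for W smooth everywhere, so the arguments are first taken
  -- globally smooth; `secAt_of_multilinear` then allows arguments smooth only at x.
  have key : ∀ (Y : Fin p → ∀ y : M, TM EM y) (Z : Fin q → ∀ y : M, TM EM y),
      (∀ i y, SecAt EM EM (Y i) y) → (∀ j y, SecAt EM EM (Z j) y) →
      SecAt EM F (fun y => cov0 nab J covE s y (X y) q (fun i => Y i y) fun j => Z j y) x := by
    intro Y Z hY hZ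
    have hval := fun y => hasFormDeriv_cov0 hΩ hJ hnab hcovE hs y (X y) q Y Z (fun i => hY i y)
      fun j => hZ j y
    have hn : ∀ W : ∀ y : M, TM EM y, (∀ y, SecAt EM EM W y) →
        SecAt EM EM (fun y => nablaJ nab J W y (X y)) x := fun W hW =>
      ((secAt_covariantDerivative hnab.smooth hW (hX x)).sub (hJ.smooth x _
        (secAt_covariantDerivative hnab.smooth (fun y => hJ.smooth y W (hW y)) (hX x)))).const_smul _
    simp only [hval]
    refine SecAt.sub (SecAt.sub (secAt_covariantDerivative hcovE.smooth
      (fun y => hs.biform y q Y Z (fun i => hY i y) fun j => hZ j y) (hX x))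
      (SecAt.sum fun i _ => ?_)) (SecAt.sum fun j _ => ?_)
    · have := hs.biform x q _ Z (secAt_update (fun i => hY i x) i (hn _ (hY i))) fun j => hZ j x
      simpa only [update_section] using this
    · have := hs.biform x q Y _ (fun i => hY i x) (secAt_update (fun i => hZ i x) j (hn _ (hZ j)))
      simpa only [update_section] using this
  intro Y Z hY hZ
  have := secAt_of_multilinear (EM := EM) (FV := EM) (FU := F)
    (m := fun y => toMultilinear (cov0 nab J covE s y (X y) q)) (x := x)
    (fun W hW => key (fun i => W (Sum.inl i)) (fun j => W (Sum.inr j)) (fun _ => hW _) fun _ => hW _)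
    (W := Sum.elim Y Z) (by rintro (k | k); exacts [hY k, hZ k])
  exact this

end CovOnForms

/-! ### The Clifford connection, the Dirac operator and its deformation -/

section DiracOperator

open scoped Topology

variable {EM : Type*} [NormedAddCommGroup EM] [NormedSpace ℝ EM] [FiniteDimensional ℝ EM]
  {M : Type*} [TopologicalSpace M] [T2Space M] [ChartedSpace EM M]
  [IsManifold 𝓘(ℝ, EM) ∞ M]
  {Ω : ∀ x : M, TM EM x →L[ℝ] TM EM x →L[ℝ] ℝ} {J : ∀ x : M, TM EM x →L[ℝ] TM EM x}
  {nab : AffineConn EM M}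
  {F : Type*} [NormedAddCommGroup F] [NormedSpace ℂ F]
  {E : M → Type*} [TopologicalSpace (TotalSpace F E)]
  [∀ x, AddCommGroup (E x)] [∀ x, Module ℂ (E x)] [∀ x, TopologicalSpace (E x)]
  [FiberBundle F E] [∀ x, IsTopologicalAddGroup (E x)]
  [∀ x, ContinuousSMul ℝ (E x)] [VectorBundle ℝ F E] [VectorBundle ℂ F E]
  {h : ∀ x : M, E x →ₗ⋆[ℂ] E x →ₗ[ℂ] ℂ} {covE : CovariantDerivative 𝓘(ℝ, EM) F E}
  {p : ℕ} {s s₁ s₂ : ∀ y : M, Forms (TM EM y) (E y) p}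
  {m : ℕ} {e : ∀ x : M, Module.Basis (Fin m) ℝ (TM EM x)}

/-- Clifford multiplication on `M`, as an endomorphism. -/
abbrev cl (Ω : ∀ x : M, TM EM x →L[ℝ] TM EM x →L[ℝ] ℝ) (J : ∀ x : M, TM EM x →L[ℝ] TM EM x) {x : M}
    (u : TM EM x) : Module.End ℂ (Forms (TM EM x) (E x) p) :=
  cliffF (metric Ω J x) (J x).toLinearMap u

theorem cl_add {x : M} (u w : TM EM x) (η : Forms (TM EM x) (E x) p) :
    cl Ω J (u + w) η = cl Ω J u η + cl Ω J w η := by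
  rw [cl, map_add, LinearMap.add_apply]

theorem cl_smul {x : M} (r : ℝ) (u : TM EM x) (η : Forms (TM EM x) (E x) p) :
    cl Ω J (r • u) η = r • cl Ω J u η := by
  rw [cl, map_smul, LinearMap.smul_apply]

theorem cl_smul_right {x : M} (r : ℝ) (u : TM EM x) (η : Forms (TM EM x) (E x) p) :
    cl Ω J u (r • η) = r • cl Ω J u η := by
  have h : ∀ (r : ℝ) (η : Forms (TM EM x) (E x) p), r • η = (r : ℂ) • η :=
    fun r η => (Complex.coe_smul r η).symm
  rw [h, h, map_smul]

section Smoothness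

variable {q : ℕ} {x : M}
  {η η' : ∀ y : M, TM EM y [⋀^Fin p]→ₗ[ℝ] (TM EM y [⋀^Fin q]→ₗ[ℝ] E y)}

theorem SmoothBiformAt.add (hη : SmoothBiformAt F η x) (hη' : SmoothBiformAt F η' x) :
    SmoothBiformAt F (fun y => η y + η' y) x :=
  fun Y Z hY hZ => SecAt.add (hη Y Z hY hZ) (hη' Y Z hY hZ)

theorem SmoothBiformAt.congr (hη : SmoothBiformAt F η x) (hηη' : ∀ᶠ y in 𝓝 x, η y = η' y) :
    SmoothBiformAt F η' x :=
  fun Y Z hY hZ => SecAt.congr (hη Y Z hY hZ) (hηη'.mono fun y hy => by rw [hy])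

theorem SmoothBiformAt.smul {f : M → ℝ} (hf : FunAt EM f x) (hη : SmoothBiformAt F η x) :
    SmoothBiformAt F (fun y => f y • η y) x :=
  fun Y Z hY hZ => SecAt.smul hf (hη Y Z hY hZ)

theorem SmoothBiformAt.const_complex_smul (z : ℂ) (hη : SmoothBiformAt F η x) :
    SmoothBiformAt F (fun y => z • η y) x :=
  fun Y Z hY hZ => SecAt.const_complex_smul z (hη Y Z hY hZ)

theorem SmoothBiformAt.sum {ι : Type*} {t : Finset ι}
    {η : ι → ∀ y : M, TM EM y [⋀^Fin p]→ₗ[ℝ] (TM EM y [⋀^Fin q]→ₗ[ℝ] E y)}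
    (hη : ∀ i ∈ t, SmoothBiformAt F (η i) x) : SmoothBiformAt F (fun y => ∑ i ∈ t, η i y) x := by
  classical
  induction t using Finset.induction_on with
  | empty => exact fun Y Z _ _ => by simpa using secAt_zero x
  | insert a t ha ih =>
    simp only [Finset.sum_insert ha]
    exact (hη a (by simp)).add (ih fun i hi => hη i (by simp [hi]))

end Smoothness

theorem cov_eq (x : M) (v : TM EM x) : cov Ω J nab e covE s x v = cov0 nab J covE s x v
    + (1 / 4 : ℂ) • ∑ j, cl Ω J (e x j) (cl Ω J (diffB nab J x v (e x j)) (s x)) := by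
  simp only [cov, cliff_eq_cliffF]
  rfl

theorem dirac_eq (x : M) : dirac Ω J nab e covE s x
    = ∑ j, cl Ω J (e x j) (cov Ω J nab e covE s x (e x j)) := by
  simp only [dirac, cliff_eq_cliffF]

theorem diracT_eq (X : ∀ x : M, TM EM x) (t : ℝ) (x : M) : diracT Ω J nab e covE X t s x
    = dirac Ω J nab e covE s x + (Complex.I * t / 2) • cl Ω J (X x) (s x) := by
  simp only [diracT, cliff_eq_cliffF]

variable (hΩ : IsSymplectic Ω) (hJ : IsCompatible Ω J)
  (hnab : IsLeviCivita (metric Ω J) nab) (hcovE : IsHermitianConnection h covE)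

include hΩ hJ hnab hcovE

theorem isTypeP_cov (hs : IsSmoothForm F J s) (x : M) (v : TM EM x) :
    IsTypeP (J x).toLinearMap (cov Ω J nab e covE s x v) := by
  have hp := (isSmoothHermitian hΩ hJ).pair x
  rw [cov_eq]
  exact (isTypeP_cov0 hΩ hJ hnab hcovE hs x v).add ((IsTypeP.sum fun j _ =>
    ((hs.isType x).cliffF_isTypeP hp _).cliffF_isTypeP hp _).smul _)

theorem exists_cov_linear (hs : IsSmoothForm F J s) (x : M) :
    ∃ L : TM EM x →ₗ[ℝ] Forms (TM EM x) (E x) p, ∀ v, cov Ω J nab e covE s x v = L v := by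
  obtain ⟨L, hL⟩ := exists_cov0_linear hΩ hJ hnab hcovE hs x
  obtain ⟨B, hB⟩ := exists_diffB hΩ hJ hnab x
  refine ⟨{ toFun := cov Ω J nab e covE s x
            map_add' := fun v w => ?_
            map_smul' := fun r v => ?_ }, fun v => rfl⟩
  · simp only [cov_eq, hL, ← hB, map_add, LinearMap.add_apply, Finset.sum_add_distrib, smul_add]
    abel
  · simp only [cov_eq, hL, ← hB, map_smul, LinearMap.smul_apply, RingHom.id_apply]
    simp only [← Complex.coe_smul r, map_smul, ← Finset.smul_sum]
    module

theorem cov_add (h₁ : IsSmoothForm F J s₁) (h₂ : IsSmoothForm F J s₂) (x : M) (v : TM EM x) :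
    cov Ω J nab e covE (fun y => s₁ y + s₂ y) x v
      = cov Ω J nab e covE s₁ x v + cov Ω J nab e covE s₂ x v := by
  simp only [cov_eq, cov0_add hΩ hJ hnab hcovE h₁ h₂, map_add, Finset.sum_add_distrib]
  module

theorem cov_smul (hs : IsSmoothForm F J s) (z : ℂ) (x : M) (v : TM EM x) :
    cov Ω J nab e covE (fun y => z • s y) x v = z • cov Ω J nab e covE s x v := by
  simp only [cov_eq, cov0_smul hΩ hJ hnab hcovE hs, map_smul, ← Finset.smul_sum]
  module

theorem dirac_add (h₁ : IsSmoothForm F J s₁) (h₂ : IsSmoothForm F J s₂) (x : M) :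
    dirac Ω J nab e covE (fun y => s₁ y + s₂ y) x
      = dirac Ω J nab e covE s₁ x + dirac Ω J nab e covE s₂ x := by
  simp only [dirac_eq, cov_add hΩ hJ hnab hcovE h₁ h₂, map_add, Finset.sum_add_distrib]

theorem dirac_smul (hs : IsSmoothForm F J s) (z : ℂ) (x : M) :
    dirac Ω J nab e covE (fun y => z • s y) x = z • dirac Ω J nab e covE s x := by
  simp only [dirac_eq, cov_smul hΩ hJ hnab hcovE hs, map_smul, ← Finset.smul_sum]

/-- The lift of the Levi-Civita connection is a Clifford connection. -/
theorem cov_cliffF (he : ∀ x i j, metric Ω J x (e x i) (e x j) = if i = j then 1 else 0)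
    (hs : IsSmoothForm F J s) {X : ∀ y : M, TM EM y}
    (hX : ∀ y, SecAt EM EM X y) (x : M) (v : TM EM x) :
    cov Ω J nab e covE (fun y => cl Ω J (X y) (s y)) x v
      = cl Ω J (nab X x v) (s x) + cl Ω J (X x) (cov Ω J nab e covE s x v) := by
  obtain ⟨B, hB⟩ := exists_diffB hΩ hJ hnab x
  have h1 := cov0_cliffF hΩ hJ hnab hcovE hs hX x v
  have h2 := sum_cliffF_commutator ((isSmoothHermitian hΩ hJ).pair x) (he x) (B v)
    (fun u w => by simp only [hB, diffB_skew hΩ hJ hnab x v u w]) (X x) (s x)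
  simp only [hB] at h2
  -- The Leibniz rule of `cov0` differentiates X by the projected connection, and the commutator
  -- with the quarter sum supplies the missing B_v X; together they give ∇_v X.
  have h3 : cl Ω J (nab X x v) (s x)
      = cl Ω J (diffB nab J x v (X x)) (s x) + cl Ω J (nablaJ nab J X x v) (s x) := by
    rw [eq_add_of_sub_eq (diffB_eq hΩ hJ hnab v (hX x)), cl_add]
  rw [cov_eq, cov_eq, h1, h2, h3, map_add, map_smul]
  module

/-- Apply the Leibniz rule to ∇_{e_j}(c(X) s), then use c(e_j) c(X) = -c(X) c(e_j) - 2 g(e_j, X).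
The first part cancels c(X) D s and the second sums to -2∇_X s. -/
theorem dirac_anticommutator (he : ∀ x i j, metric Ω J x (e x i) (e x j) = if i = j then 1 else 0)
    (hs : IsSmoothForm F J s) {X : ∀ y : M, TM EM y}
    (hX : ∀ y, SecAt EM EM X y) (x : M) :
    dirac Ω J nab e covE (fun y => cl Ω J (X y) (s y)) x + cl Ω J (X x) (dirac Ω J nab e covE s x)
      = ∑ j, cl Ω J (e x j) (cl Ω J (nab X x (e x j)) (s x))
        - (2 : ℂ) • cov Ω J nab e covE s x (X x) := by
  have hp := (isSmoothHermitian hΩ hJ).pair x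
  obtain ⟨L, hL⟩ := exists_cov_linear (e := e) hΩ hJ hnab hcovE hs x
  have h1 : (2 : ℂ) • cov Ω J nab e covE s x (X x)
      = ∑ j, ((2 * metric Ω J x (e x j) (X x) : ℝ) : ℂ) • cov Ω J nab e covE s x (e x j) := by
    simp only [hL]
    conv_lhs => rw [← sum_inner_smul (he x) (X x)]
    rw [map_sum, Finset.smul_sum]
    refine Finset.sum_congr rfl fun j _ => ?_
    have h2 : ∀ (r : ℝ) (η : Forms (TM EM x) (E x) p), r • η = (r : ℂ) • η :=
      fun r η => (Complex.coe_smul r η).symm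
    rw [map_smul, h2, smul_smul]
    push_cast
    rfl
  rw [h1, dirac_eq, dirac_eq, map_sum, ← Finset.sum_sub_distrib, ← Finset.sum_add_distrib]
  refine Finset.sum_congr rfl fun j _ => ?_
  rw [cov_cliffF hΩ hJ hnab hcovE he hs hX, map_add, cliffF_cliffF hp (e x j) (X x)]
  abel

/-- The square of the deformed Dirac operator, before the term `∇_X` is expressed by Lie
derivatives. -/
theorem diracT_diracT (he : ∀ x i j, metric Ω J x (e x i) (e x j) = if i = j then 1 else 0)
    (hs : IsSmoothForm F J s) (hDs : IsSmoothForm F J (dirac Ω J nab e covE s))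
    {X : ∀ y : M, TM EM y} (hX : ∀ y, SecAt EM EM X y) (t : ℝ) (x : M) :
    diracT Ω J nab e covE X t (diracT Ω J nab e covE X t s) x
      = dirac Ω J nab e covE (dirac Ω J nab e covE s) x
        + (Complex.I * t / 2) • (∑ j, cl Ω J (e x j) (cl Ω J (nab X x (e x j)) (s x))
          - (2 : ℂ) • cov Ω J nab e covE s x (X x))
        + ((t ^ 2 / 4 * metric Ω J x (X x) (X x) : ℝ) : ℂ) • s x := by
  have hp := (isSmoothHermitian hΩ hJ).pair x
  have hc := isSmoothForm_cliffF hΩ hJ hnab hcovE hs hX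
  have h1 : diracT Ω J nab e covE X t s
      = fun y => dirac Ω J nab e covE s y + (Complex.I * t / 2) • cl Ω J (X y) (s y) :=
    funext fun y => diracT_eq X t y
  have h2 : cl Ω J (X x) (cl Ω J (X x) (s x)) = -((metric Ω J x (X x) (X x) : ℝ) : ℂ) • s x := by
    have h3 := DFunLike.congr_fun (cliffF_mul_add (N := E x) (p := p) hp.sq hp.symm hp.orth
      (X x) (X x)) (s x)
    have h4 : cl Ω J (X x) (cl Ω J (X x) (s x)) + cl Ω J (X x) (cl Ω J (X x) (s x))
      = ((-2 * metric Ω J x (X x) (X x) : ℝ) : ℂ) • s x := h3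
    have h5 : cl Ω J (X x) (cl Ω J (X x) (s x)) = (1 / 2 : ℂ) • (cl Ω J (X x) (cl Ω J (X x) (s x))
      + cl Ω J (X x) (cl Ω J (X x) (s x))) := by module
    rw [h5, h4]
    push_cast
    module
  rw [diracT_eq, h1, dirac_add hΩ hJ hnab hcovE hDs (hc.smul _), dirac_smul hΩ hJ hnab hcovE hc,
    ← dirac_anticommutator hΩ hJ hnab hcovE he hs hX x, map_add, map_smul, h2]
  -- The square of √-1 t/2 times c(X)² = -|X|² is the term t²|X|²/4.
  have h6 : ∀ z : ℂ, (Complex.I * t / 2) * ((Complex.I * t / 2) * -z) = t ^ 2 / 4 * z := fun z => by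
    linear_combination (-(t ^ 2 / 4 : ℂ) * z) * Complex.I_mul_I
  rw [smul_add, smul_smul _ _ (s x), smul_smul _ _ (s x), h6]
  push_cast
  module

/-- The spin correction is a metric contraction over the basis e. In a smooth frame with Gram
coefficients each of its summands is visibly smooth. -/
theorem smoothBiformAt_cov (he : ∀ x i j, metric Ω J x (e x i) (e x j) = if i = j then 1 else 0)
    (hs : IsSmoothForm F J s) {X : ∀ y : M, TM EM y}
    (hX : ∀ y, SecAt EM EM X y) (x : M) (q : ℕ) :
    SmoothBiformAt F (fun y => cov Ω J nab e covE s y (X y) q) x := by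
  have hH := isSmoothHermitian hΩ hJ
  obtain ⟨n, u, G, hu, hG, hsum⟩ := exists_gram hH.smooth_g hJ.pos x
  have hn : ∀ b, SecAt EM EM (fun y => diffB nab J y (X y) (u b y)) x := fun b => by
    have h1 := ((secAt_covariantDerivative hnab.smooth (hu b) (hX x)).sub (hJ.smooth x _
        (secAt_covariantDerivative hnab.smooth (fun y => hJ.smooth y _ (hu b y)) (hX x)))).const_smul
          (1 / 2)
    have h2 := SecAt.sub (secAt_covariantDerivative hnab.smooth (hu b) (hX x)) h1
    refine h2.congr (.of_forall fun y => ?_)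
    rw [← diffB_eq hΩ hJ hnab (X y) (hu b y)]
    rfl
  have h1 : SmoothBiformAt F (fun y => cov0 nab J covE s y (X y) q + (1 / 4 : ℂ) • ∑ a, ∑ b,
      G a b y • cl Ω J (u a y) (cl Ω J (diffB nab J y (X y) (u b y)) (s y)) q) x := by
    refine (smoothBiformAt_cov0 hΩ hJ hnab hcovE hs hX x q).add
      (SmoothBiformAt.const_complex_smul _ (SmoothBiformAt.sum fun a _ => SmoothBiformAt.sum
        fun b _ => SmoothBiformAt.smul (hG a b) ?_))
    exact smoothBiformAt_cliffF hΩ hJ hnab hcovE (fun q' => smoothBiformAt_cliffF hΩ hJ hnab hcovE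
      (hs.biform x) hs.isType (hn b) q') (fun y => (hs.isType y).cliffF_isTypeP (hH.pair y) _)
      (hu a x) q
  refine h1.congr ?_
  filter_upwards [hsum] with y hy
  obtain ⟨B, hB⟩ := exists_diffB hΩ hJ hnab y
  let β : TM EM y →ₗ[ℝ] TM EM y →ₗ[ℝ] Forms (TM EM y) (E y) p :=
    LinearMap.mk₂ ℝ (fun u w => cl Ω J u (cl Ω J (B (X y) w) (s y)))
      (fun u u' w => cl_add _ _ _) (fun r u w => cl_smul _ _ _)
      (fun u w w' => by rw [map_add, cl_add, map_add])
      (fun r u w => by rw [map_smul, cl_smul, cl_smul_right])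
  have h2 := sum_orthonormal_eq_gram (he y) (hH.pair y).symm hy β
  simp only [β, LinearMap.mk₂_apply, hB] at h2
  rw [cov_eq, h2]
  simp only [Pi.add_apply, Pi.smul_apply, Finset.sum_apply]

theorem isSmoothForm_dirac (he : ∀ x i j, metric Ω J x (e x i) (e x j) = if i = j then 1 else 0)
    (hs : IsSmoothForm F J s) : IsSmoothForm F J (dirac Ω J nab e covE s) where
  isType x := by
    rw [dirac_eq]
    exact IsTypeP.sum fun j _ => (isTypeP_cov hΩ hJ hnab hcovE hs x _).cliffF_isTypeP
      ((isSmoothHermitian hΩ hJ).pair x) _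
  smooth q x := by
    have hH := isSmoothHermitian hΩ hJ
    -- The sum over e defining D s is again rewritten in a smooth frame.
    obtain ⟨n, u, G, hu, hG, hsum⟩ := exists_gram hH.smooth_g hJ.pos x
    have h1 : SmoothBiformAt F (fun y => ∑ a, ∑ b,
        G a b y • cl Ω J (u a y) (cov Ω J nab e covE s y (u b y)) q) x :=
      SmoothBiformAt.sum fun a _ => SmoothBiformAt.sum fun b _ => SmoothBiformAt.smul (hG a b)
        (smoothBiformAt_cliffF hΩ hJ hnab hcovE
          (fun q' => smoothBiformAt_cov hΩ hJ hnab hcovE he hs (hu b) x q')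
          (fun y => isTypeP_cov hΩ hJ hnab hcovE hs y _) (hu a x) q)
    refine h1.congr ?_
    filter_upwards [hsum] with y hy
    obtain ⟨L, hL⟩ := exists_cov_linear (e := e) hΩ hJ hnab hcovE hs y
    let β : TM EM y →ₗ[ℝ] TM EM y →ₗ[ℝ] Forms (TM EM y) (E y) p :=
      LinearMap.mk₂ ℝ (fun u w => cl Ω J u (L w))
        (fun u u' w => cl_add _ _ _) (fun r u w => cl_smul _ _ _)
        (fun u w w' => by rw [map_add, map_add])
        (fun r u w => by rw [map_smul, cl_smul_right])
    have h2 := sum_orthonormal_eq_gram (he y) (hH.pair y).symm hy β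
    simp only [β, LinearMap.mk₂_apply, ← hL] at h2
    rw [dirac_eq, h2]
    simp only [Pi.smul_apply, Finset.sum_apply]

theorem isSmoothForm_diracT (he : ∀ x i j, metric Ω J x (e x i) (e x j) = if i = j then 1 else 0)
    (hs : IsSmoothForm F J s) {X : ∀ y : M, TM EM y} (hX : ∀ y, SecAt EM EM X y) (t : ℝ) :
    IsSmoothForm F J (diracT Ω J nab e covE X t s) := by
  have h1 : diracT Ω J nab e covE X t s
      = fun y => dirac Ω J nab e covE s y + (Complex.I * t / 2) • cl Ω J (X y) (s y) :=
    funext fun y => diracT_eq X t y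
  rw [h1]
  exact (isSmoothForm_dirac hΩ hJ hnab hcovE he hs).add
    ((isSmoothForm_cliffF hΩ hJ hnab hcovE hs hX).smul _)

end DiracOperator

/-! ### Vector fields and brackets in a chart -/

section Coordinates

open scoped Topology

variable {EM : Type*} [NormedAddCommGroup EM] [NormedSpace ℝ EM]
  {M : Type*} [TopologicalSpace M] [ChartedSpace EM M]
  [IsManifold 𝓘(ℝ, EM) ∞ M]
  {W : Type*} [NormedAddCommGroup W] [NormedSpace ℝ W]
  {W' : Type*} [NormedAddCommGroup W'] [NormedSpace ℝ W']

theorem mvfderiv_fderiv_comp {f : M → W} {Φ : W → W'} {x : M} (v : TM EM x)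
    (hΦ : DifferentiableAt ℝ Φ (f x)) (hf : MDifferentiableAt 𝓘(ℝ, EM) 𝓘(ℝ, W) f x) :
    mvfderiv 𝓘(ℝ, EM) (fun y => Φ (f y)) x v = fderiv ℝ Φ (f x) (mvfderiv 𝓘(ℝ, EM) f x v) := by
  have h := mfderiv_comp x hΦ.mdifferentiableAt hf
  rw [mfderiv_eq_fderiv] at h
  exact DFunLike.congr_fun h v

theorem mvfderiv_congr_eventually {f g : M → W} {x : M} (h : f =ᶠ[𝓝 x] g) (v : TM EM x) :
    mvfderiv 𝓘(ℝ, EM) f x v = mvfderiv 𝓘(ℝ, EM) g x v := by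
  have := h.mfderiv_eq (I := 𝓘(ℝ, EM)) (I' := 𝓘(ℝ, W))
  exact DFunLike.congr_fun this v

/-- The coordinates of a tangent vector at `y` in the chart at `x`. -/
def coordAt (x y : M) : TM EM y →L[ℝ] EM := mvfderiv 𝓘(ℝ, EM) (extChartAt 𝓘(ℝ, EM) x) y

theorem two_le_infty : (2 : WithTop ℕ∞) ≤ ∞ :=
  WithTop.coe_le_coe.2 (le_top : (2 : ℕ∞) ≤ ⊤)

theorem coordAt_eq {x y : M} (hy : y ∈ (chartAt EM x).source) (v : TM EM y) :
    coordAt x y v = (trivializationAt EM (TangentSpace 𝓘(ℝ, EM)) x ⟨y, v⟩).2 := by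
  have h := DFunLike.congr_fun
    (TangentBundle.continuousLinearMapAt_trivializationAt (I := 𝓘(ℝ, EM)) hy) v
  rw [Trivialization.continuousLinearMapAt_apply, Trivialization.linearMapAt_apply,
    if_pos (by simpa using hy)] at h
  exact h.symm

theorem eventually_mem_chart (x : M) : ∀ᶠ y in 𝓝 x, y ∈ (chartAt EM x).source :=
  (chartAt EM x).open_source.mem_nhds (mem_chart_source EM x)

theorem secAt_iff_coordAt {x : M} {Y : ∀ y : M, TM EM y} :
    SecAt EM EM Y x ↔ ContMDiffAt 𝓘(ℝ, EM) 𝓘(ℝ, EM) ∞ (fun y => coordAt x y (Y y)) x := by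
  rw [SecAt, contMDiffAt_section]
  have h : (fun y => (trivializationAt EM (TangentSpace 𝓘(ℝ, EM)) x ⟨y, Y y⟩).2)
      =ᶠ[𝓝 x] fun y => coordAt x y (Y y) :=
    (eventually_mem_chart (EM := EM) x).mono fun y hy => (coordAt_eq hy _).symm
  exact h.contMDiffAt_iff

/-- The standard extension of a vector has constant coordinates near x, which removes one of the two
terms of its bracket with another field. -/
theorem coordAt_extend {x : M} (u : TM EM x) :
    ∀ᶠ y in 𝓝 x, coordAt x y (FiberBundle.extend EM u y) = coordAt x x u := by
  filter_upwards [eventually_mem_chart (EM := EM) x] with y hy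
  rw [coordAt_eq hy, coordAt_eq (mem_chart_source EM x), FiberBundle.extend,
    Trivialization.apply_mk_symm _ (by simpa using hy)]

/-- The Lie bracket in coordinates. -/
theorem coordAt_mlieBracket [CompleteSpace EM] {x : M} {X Y : ∀ y : M, TM EM y}
    (hX : SecAt EM EM X x) (hY : SecAt EM EM Y x) :
    coordAt x x (VectorField.mlieBracket 𝓘(ℝ, EM) X Y x)
      = mvfderiv 𝓘(ℝ, EM) (fun y => coordAt x y (Y y)) x (X x)
        - mvfderiv 𝓘(ℝ, EM) (fun y => coordAt x y (X y)) x (Y x) := by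
  let φ := extChartAt 𝓘(ℝ, EM) x
  have : IsManifold 𝓘(ℝ, EM) (minSmoothness ℝ 2) M :=
    IsManifold.of_le (n := ∞) (by rw [minSmoothness_of_isRCLikeNormedField]; exact two_le_infty)
  let loc : (∀ y : M, TM EM y) → EM → EM := fun Z z => coordAt x (φ.symm z) (Z (φ.symm z))
  let locT : (∀ y : M, TM EM y) → ∀ z : EM, TM EM z := fun Z z => loc Z z
  have hinv : ∀ y ∈ (chartAt EM x).source, (mfderiv 𝓘(ℝ, EM) 𝓘(ℝ, EM) φ y).IsInvertible :=
    fun y hy => isInvertible_mfderiv_extChartAt (I := 𝓘(ℝ, EM)) (x := x) (by simpa using hy)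
  have hsymm : ∀ y ∈ (chartAt EM x).source, φ.symm (φ y) = y :=
    fun y hy => φ.left_inv (by simpa [φ] using hy)
  have hφs : ContMDiffAt 𝓘(ℝ, EM) 𝓘(ℝ, EM) ∞ φ.symm (φ x) :=
    (contMDiffOn_extChartAt_symm (I := 𝓘(ℝ, EM)) x).contMDiffAt
      (extChartAt_target_mem_nhds (I := 𝓘(ℝ, EM)) x)
  have hloc : ∀ Z : ∀ y : M, TM EM y, SecAt EM EM Z x → ContDiffAt ℝ ∞ (loc Z) (φ x) := by
    intro Z hZ
    rw [← contMDiffAt_iff_contDiffAt]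
    have h1 : ContMDiffAt 𝓘(ℝ, EM) 𝓘(ℝ, EM) ∞ (fun y => coordAt x y (Z y)) (φ.symm (φ x)) := by
      rw [hsymm x (mem_chart_source EM x)]
      exact secAt_iff_coordAt.1 hZ
    exact ContMDiffAt.comp (φ x) (g := fun y => coordAt x y (Z y)) h1 hφs
  have hd : ∀ Z : ∀ y : M, TM EM y, SecAt EM EM Z x → MDifferentiableAt 𝓘(ℝ, EM)
      (𝓘(ℝ, EM).prod 𝓘(ℝ, EM)) (fun z => (TotalSpace.mk' EM z (locT Z z) :
        TangentBundle 𝓘(ℝ, EM) EM)) (φ x) := fun Z hZ =>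
    (contMDiffAt_vectorSpace_iff_contDiffAt.2 (hloc Z hZ)).mdifferentiableAt (by simp)
  -- Near x each field is the pullback of its chart representative, so naturality of the bracket
  -- reduces the claim to the bracket on the model space.
  have hpull : ∀ Z : ∀ y : M, TM EM y,
      VectorField.mpullback 𝓘(ℝ, EM) 𝓘(ℝ, EM) φ (locT Z) =ᶠ[𝓝 x] Z := by
    intro Z
    filter_upwards [eventually_mem_chart (EM := EM) x] with y hy
    rw [VectorField.mpullback_apply]
    have h1 : locT Z (φ y) = mfderiv 𝓘(ℝ, EM) 𝓘(ℝ, EM) φ y (Z y) := by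
      have h2 : loc Z (φ y) = coordAt x y (Z y) := by
        simp only [loc]
        rw [hsymm y hy]
      exact h2
    rw [h1]
    exact (hinv y hy).inverse_apply_eq.2 rfl
  have hb := VectorField.mpullback_mlieBracket (hd X hX) (hd Y hY)
    (contMDiffAt_extChartAt (I := 𝓘(ℝ, EM)) (n := ∞) (x := x)) (by rw [minSmoothness_of_isRCLikeNormedField]; exact two_le_infty)
  rw [(hpull X).mlieBracket_vectorField_eq (hpull Y), VectorField.mpullback_apply] at hb
  have hval : coordAt x x (VectorField.mlieBracket 𝓘(ℝ, EM) X Y x)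
      = VectorField.lieBracket ℝ (loc X) (loc Y) (φ x) := by
    have h1 := (hinv x (mem_chart_source EM x)).inverse_apply_eq.1 hb
    refine Eq.trans (b := VectorField.mlieBracket 𝓘(ℝ, EM) (locT X) (locT Y) (φ x)) h1.symm ?_
    rw [← VectorField.mlieBracketWithin_univ,
      VectorField.mlieBracketWithin_eq_lieBracketWithin, VectorField.lieBracketWithin_univ]
  have hder : ∀ Z : ∀ y : M, TM EM y, SecAt EM EM Z x → ∀ v : TM EM x,
      mvfderiv 𝓘(ℝ, EM) (fun y => coordAt x y (Z y)) x v = fderiv ℝ (loc Z) (φ x) (coordAt x x v) := by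
    intro Z hZ v
    have h1 : (fun y => coordAt x y (Z y)) =ᶠ[𝓝 x] fun y => loc Z (φ y) := by
      filter_upwards [eventually_mem_chart (EM := EM) x] with y hy
      simp only [loc]
      rw [hsymm y hy]
    rw [mvfderiv_congr_eventually h1, mvfderiv_fderiv_comp v
      ((hloc Z hZ).differentiableAt (by simp)) (mdifferentiableAt_extChartAt (I := 𝓘(ℝ, EM)) (mem_chart_source EM x))]
    rfl
  rw [hval, hder X hX, hder Y hY, VectorField.lieBracket]
  simp only [loc]
  rw [hsymm x (mem_chart_source EM x)]

end Coordinates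

/-! ### The group action in charts -/

section ActionCoordinates

open scoped Topology

variable {EM : Type*} [NormedAddCommGroup EM] [NormedSpace ℝ EM]
  {M : Type*} [TopologicalSpace M] [ChartedSpace EM M]
  [IsManifold 𝓘(ℝ, EM) ∞ M]
  {W : Type*} [NormedAddCommGroup W] [NormedSpace ℝ W]
  {EG : Type*} [NormedAddCommGroup EG] [NormedSpace ℝ EG]
  {G : Type*} [TopologicalSpace G] [ChartedSpace EG G] [Group G] [IsManifold 𝓘(ℝ, EG) ∞ G]
  [MulAction G M] [ContMDiffSMul 𝓘(ℝ, EG) 𝓘(ℝ, EM) ∞ G M]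

theorem contMDiffAt_smul_point (x : M) (a : G) :
    ContMDiffAt 𝓘(ℝ, EG) 𝓘(ℝ, EM) ∞ (fun a : G => a • x) a :=
  ContMDiffAt.smul contMDiffAt_id contMDiffAt_const

theorem tendsto_smul_point (EM EG : Type*) [NormedAddCommGroup EM] [NormedSpace ℝ EM]
    [NormedAddCommGroup EG] [NormedSpace ℝ EG]
    {M : Type*} [TopologicalSpace M] [ChartedSpace EM M]
    {G : Type*} [TopologicalSpace G] [ChartedSpace EG G] [Group G]
    [MulAction G M] [ContMDiffSMul 𝓘(ℝ, EG) 𝓘(ℝ, EM) ∞ G M] (x : M) :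
    Filter.Tendsto (fun a : G => a • x) (𝓝 1) (𝓝 x) := by
  have h : ContMDiffAt 𝓘(ℝ, EG) 𝓘(ℝ, EM) ∞ (fun a : G => a • x) 1 :=
    ContMDiffAt.smul contMDiffAt_id contMDiffAt_const
  have := h.continuousAt.tendsto
  rwa [one_smul] at this

/-- Needed because `killing` contains a cast from the tangent space at 1 • x to the one at x. -/
theorem mvfderiv_transport {f : M → W} {x y : M} (hyx : y = x) (h : TM EM y = TM EM x)
    (v : TM EM y) : mvfderiv 𝓘(ℝ, EM) f x (cast h v) = mvfderiv 𝓘(ℝ, EM) f y v := by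
  subst hyx
  rfl

theorem mvfderiv_comp_map {EN : Type*} [NormedAddCommGroup EN] [NormedSpace ℝ EN]
    {N : Type*} [TopologicalSpace N] [ChartedSpace EN N] {f : M → W} {φ : N → M} {z : N}
    (v : TM EN z) (hf : MDifferentiableAt 𝓘(ℝ, EM) 𝓘(ℝ, W) f (φ z))
    (hφ : MDifferentiableAt 𝓘(ℝ, EN) 𝓘(ℝ, EM) φ z) :
    mvfderiv 𝓘(ℝ, EN) (fun y => f (φ y)) z v
      = mvfderiv 𝓘(ℝ, EM) f (φ z) (mfderiv 𝓘(ℝ, EN) 𝓘(ℝ, EM) φ z v) :=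
  DFunLike.congr_fun (mfderiv_comp z hf hφ) v

theorem mvfderiv_smul_point {f : M → W} {x : M}
    (hf : MDifferentiableAt 𝓘(ℝ, EM) 𝓘(ℝ, W) f x) (V : LieAlg EG G) :
    mvfderiv 𝓘(ℝ, EG) (fun a : G => f (a • x)) 1 V = mvfderiv 𝓘(ℝ, EM) f x (killing EM V x) := by
  rw [killing, mvfderiv_transport (one_smul G x)]
  exact mvfderiv_comp_map (φ := fun a : G => a • x) V (by rw [one_smul]; exact hf)
    ((contMDiffAt_smul_point (EM := EM) (EG := EG) x 1).mdifferentiableAt (by simp))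

/-- The action near `(1, x)` in charts. -/
def actionChart (EM EG G : Type*) [NormedAddCommGroup EM] [NormedSpace ℝ EM]
    [NormedAddCommGroup EG] [NormedSpace ℝ EG]
    {M : Type*} [TopologicalSpace M] [ChartedSpace EM M]
    [TopologicalSpace G] [ChartedSpace EG G] [Group G]
    [MulAction G M] (x : M) (z : EG × EM) : EM :=
  extChartAt 𝓘(ℝ, EM) x
    ((extChartAt 𝓘(ℝ, EG) (1 : G)).symm z.1 • (extChartAt 𝓘(ℝ, EM) x).symm z.2)

theorem actionChart_apply {x y : M} {a : G} (ha : a ∈ (chartAt EG (1 : G)).source)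
    (hy : y ∈ (chartAt EM x).source) :
    actionChart EM EG G x (extChartAt 𝓘(ℝ, EG) (1 : G) a, extChartAt 𝓘(ℝ, EM) x y)
      = extChartAt 𝓘(ℝ, EM) x (a • y) := by
  rw [actionChart, (extChartAt 𝓘(ℝ, EG) (1 : G)).left_inv (by simpa using ha),
    (extChartAt 𝓘(ℝ, EM) x).left_inv (by simpa using hy)]

theorem contDiffAt_actionChart (x : M) :
    ContDiffAt ℝ ∞ (actionChart EM EG G x)
      (extChartAt 𝓘(ℝ, EG) (1 : G) 1, extChartAt 𝓘(ℝ, EM) x x) := by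
  rw [← contMDiffAt_iff_contDiffAt]
  have h1 : ContMDiffAt 𝓘(ℝ, EG × EM) 𝓘(ℝ, EG) ∞
      (fun z : EG × EM => (extChartAt 𝓘(ℝ, EG) (1 : G)).symm z.1)
      (extChartAt 𝓘(ℝ, EG) (1 : G) 1, extChartAt 𝓘(ℝ, EM) x x) :=
    ContMDiffAt.comp (extChartAt 𝓘(ℝ, EG) (1 : G) 1, extChartAt 𝓘(ℝ, EM) x x) (g := (extChartAt 𝓘(ℝ, EG) (1 : G)).symm)
      ((contMDiffOn_extChartAt_symm (I := 𝓘(ℝ, EG)) (1 : G)).contMDiffAt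
        (extChartAt_target_mem_nhds (I := 𝓘(ℝ, EG)) (1 : G)))
      (contMDiffAt_iff_contDiffAt.2 contDiffAt_fst)
  have h2 : ContMDiffAt 𝓘(ℝ, EG × EM) 𝓘(ℝ, EM) ∞
      (fun z : EG × EM => (extChartAt 𝓘(ℝ, EM) x).symm z.2)
      (extChartAt 𝓘(ℝ, EG) (1 : G) 1, extChartAt 𝓘(ℝ, EM) x x) :=
    ContMDiffAt.comp (extChartAt 𝓘(ℝ, EG) (1 : G) 1, extChartAt 𝓘(ℝ, EM) x x) (g := (extChartAt 𝓘(ℝ, EM) x).symm)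
      ((contMDiffOn_extChartAt_symm (I := 𝓘(ℝ, EM)) x).contMDiffAt
        (extChartAt_target_mem_nhds (I := 𝓘(ℝ, EM)) x))
      (contMDiffAt_iff_contDiffAt.2 contDiffAt_snd)
  have h3 := ContMDiffAt.smul h1 h2
  refine ContMDiffAt.comp (extChartAt 𝓘(ℝ, EG) (1 : G) 1, extChartAt 𝓘(ℝ, EM) x x)
    (g := extChartAt 𝓘(ℝ, EM) x) ?_ h3
  have h4 : (extChartAt 𝓘(ℝ, EG) (1 : G)).symm (extChartAt 𝓘(ℝ, EG) (1 : G) 1) •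
      (extChartAt 𝓘(ℝ, EM) x).symm (extChartAt 𝓘(ℝ, EM) x x) = x := by
    simp
  have h5 : ContMDiffAt 𝓘(ℝ, EM) 𝓘(ℝ, EM) ∞ (extChartAt 𝓘(ℝ, EM) x)
      ((extChartAt 𝓘(ℝ, EG) (1 : G)).symm (extChartAt 𝓘(ℝ, EG) (1 : G) 1) •
      (extChartAt 𝓘(ℝ, EM) x).symm (extChartAt 𝓘(ℝ, EM) x x)) := by
    rw [h4]
    exact contMDiffAt_extChartAt
  exact h5

section Partial

variable {A B C : Type*} [NormedAddCommGroup A] [NormedSpace ℝ A]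
  [NormedAddCommGroup B] [NormedSpace ℝ B] [NormedAddCommGroup C] [NormedSpace ℝ C]
  {f : A × B → C} {a : A} {b : B}

theorem hasFDerivAt_partial_left {f' : A × B →L[ℝ] C} (hf : HasFDerivAt f f' (a, b)) :
    HasFDerivAt (fun a => f (a, b)) (f' ∘L ContinuousLinearMap.inl ℝ A B) a :=
  HasFDerivAt.comp (g := f) (f := fun a => (a, b)) a hf (hasFDerivAt_prodMk_left a b)

theorem hasFDerivAt_partial_right {f' : A × B →L[ℝ] C} (hf : HasFDerivAt f f' (a, b)) :
    HasFDerivAt (fun b => f (a, b)) (f' ∘L ContinuousLinearMap.inr ℝ A B) b :=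
  HasFDerivAt.comp (g := f) (f := fun b => (a, b)) b hf (hasFDerivAt_prodMk_right a b)

theorem mvfderiv_partial_left {φ : M → A} {x : M} {b : B} (hf : DifferentiableAt ℝ f (φ x, b))
    (hφ : MDifferentiableAt 𝓘(ℝ, EM) 𝓘(ℝ, A) φ x) (v : TM EM x) :
    mvfderiv 𝓘(ℝ, EM) (fun y => f (φ y, b)) x v
      = fderiv ℝ f (φ x, b) (mvfderiv 𝓘(ℝ, EM) φ x v, 0) := by
  have h1 := hasFDerivAt_partial_left hf.hasFDerivAt
  rw [mvfderiv_fderiv_comp (Φ := fun a => f (a, b)) v h1.differentiableAt hφ, h1.fderiv]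
  simp

theorem mvfderiv_partial_right {φ : M → B} {x : M} {a : A} (hf : DifferentiableAt ℝ f (a, φ x))
    (hφ : MDifferentiableAt 𝓘(ℝ, EM) 𝓘(ℝ, B) φ x) (v : TM EM x) :
    mvfderiv 𝓘(ℝ, EM) (fun y => f (a, φ y)) x v
      = fderiv ℝ f (a, φ x) (0, mvfderiv 𝓘(ℝ, EM) φ x v) := by
  have h1 := hasFDerivAt_partial_right hf.hasFDerivAt
  rw [mvfderiv_fderiv_comp (Φ := fun b => f (a, b)) v h1.differentiableAt hφ, h1.fderiv]
  simp

end Partial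

variable (x : M)

theorem eventually_differentiableAt_actionChart :
    ∀ᶠ z in 𝓝 (extChartAt 𝓘(ℝ, EG) (1 : G) 1, extChartAt 𝓘(ℝ, EM) x x),
      DifferentiableAt ℝ (actionChart EM EG G x) z := by
  have h : ContDiffAt ℝ 1 (actionChart EM EG G x) _ :=
    (contDiffAt_actionChart (EM := EM) (EG := EG) (G := G) x).of_le
      (WithTop.coe_le_coe.2 (le_top : (1 : ℕ∞) ≤ ⊤))
  exact (h.eventually (by simp)).mono fun z hz => hz.differentiableAt (by simp)

theorem tendsto_chart_right : Filter.Tendsto (fun y : M =>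
    (extChartAt 𝓘(ℝ, EG) (1 : G) 1, extChartAt 𝓘(ℝ, EM) x y)) (𝓝 x)
      (𝓝 (extChartAt 𝓘(ℝ, EG) (1 : G) 1, extChartAt 𝓘(ℝ, EM) x x)) :=
  tendsto_const_nhds.prodMk_nhds (continuousAt_extChartAt (I := 𝓘(ℝ, EM)) x)

theorem tendsto_chart_left : Filter.Tendsto (fun a : G =>
    (extChartAt 𝓘(ℝ, EG) (1 : G) a, extChartAt 𝓘(ℝ, EM) x x)) (𝓝 1)
      (𝓝 (extChartAt 𝓘(ℝ, EG) (1 : G) 1, extChartAt 𝓘(ℝ, EM) x x)) :=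
  (continuousAt_extChartAt (I := 𝓘(ℝ, EG)) (1 : G)).tendsto.prodMk_nhds tendsto_const_nhds

/-- In charts the generated field is the partial derivative of the action in the group direction,
taken along {1} × M. -/
theorem coordAt_killing (V : LieAlg EG G) : ∀ᶠ y in 𝓝 x, coordAt x y (killing EM V y)
    = fderiv ℝ (actionChart EM EG G x)
      (extChartAt 𝓘(ℝ, EG) (1 : G) 1, extChartAt 𝓘(ℝ, EM) x y)
      (coordAt (EM := EG) (1 : G) 1 V, 0) := by
  filter_upwards [eventually_mem_chart (EM := EM) x, (tendsto_chart_right (EG := EG) (G := G) x).eventually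
    (eventually_differentiableAt_actionChart (EM := EM) (EG := EG) (G := G) x)] with y hy hd
  have h1 := mvfderiv_smul_point (mdifferentiableAt_extChartAt (I := 𝓘(ℝ, EM)) hy) V
  have h2 : (fun a : G => extChartAt 𝓘(ℝ, EM) x (a • y)) =ᶠ[𝓝 1] fun a =>
      actionChart EM EG G x (extChartAt 𝓘(ℝ, EG) (1 : G) a, extChartAt 𝓘(ℝ, EM) x y) := by
    filter_upwards [eventually_mem_chart (EM := EG) (1 : G)] with a ha
    rw [actionChart_apply ha hy]
  rw [mvfderiv_congr_eventually h2, mvfderiv_partial_left hd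
    (mdifferentiableAt_extChartAt (I := 𝓘(ℝ, EG)) (mem_chart_source EG (1 : G)))] at h1
  exact h1.symm

/-- In charts the differential of the action of a is the partial derivative in the manifold
direction, taken along G × {x}. Its derivative in the group variable is thus a mixed second
derivative of `actionChart`, and so is the derivative of the generated field. -/
theorem coordAt_dAct (u : TM EM x) : ∀ᶠ a in 𝓝 (1 : G), coordAt x (a • x) (dAct EM a x u)
    = fderiv ℝ (actionChart EM EG G x)
      (extChartAt 𝓘(ℝ, EG) (1 : G) a, extChartAt 𝓘(ℝ, EM) x x) (0, coordAt x x u) := by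
  filter_upwards [eventually_mem_chart (EM := EG) (1 : G),
    (tendsto_smul_point EM EG x).eventually (eventually_mem_chart (EM := EM) x),
    (tendsto_chart_left (EM := EM) (EG := EG) x).eventually
    (eventually_differentiableAt_actionChart (EM := EM) (EG := EG) (G := G) x)] with a ha hax hd
  have h1 := mvfderiv_comp_map (φ := fun y : M => a • y) (f := extChartAt 𝓘(ℝ, EM) x) u
    (mdifferentiableAt_extChartAt (I := 𝓘(ℝ, EM)) hax)
    ((ContMDiffSMul.contMDiff_const_smul (I := 𝓘(ℝ, EG)) (I' := 𝓘(ℝ, EM)) (n := ∞)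
      a).mdifferentiableAt (by simp))
  have h2 : (fun y : M => extChartAt 𝓘(ℝ, EM) x (a • y)) =ᶠ[𝓝 x] fun y =>
      actionChart EM EG G x (extChartAt 𝓘(ℝ, EG) (1 : G) a, extChartAt 𝓘(ℝ, EM) x y) := by
    filter_upwards [eventually_mem_chart (EM := EM) x] with y hy
    exact (actionChart_apply ha hy).symm
  rw [mvfderiv_congr_eventually h2, mvfderiv_partial_right hd
    (mdifferentiableAt_extChartAt (I := 𝓘(ℝ, EM)) (mem_chart_source EM x))] at h1
  exact h1.symm

theorem contDiffAt_fderiv_actionChart : ContDiffAt ℝ ∞ (fderiv ℝ (actionChart EM EG G x))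
    (extChartAt 𝓘(ℝ, EG) (1 : G) 1, extChartAt 𝓘(ℝ, EM) x x) :=
  (contDiffAt_actionChart x).fderiv_right (by simp)

theorem secAt_killing (V : LieAlg EG G) : SecAt EM EM (fun y : M => killing EM V y) x := by
  rw [secAt_iff_coordAt]
  refine ContMDiffAt.congr_of_eventuallyEq ?_ (coordAt_killing x V)
  have h1 : ContDiffAt ℝ ∞ (fun z : EM => fderiv ℝ (actionChart EM EG G x)
      (extChartAt 𝓘(ℝ, EG) (1 : G) 1, z) (coordAt (EM := EG) (1 : G) 1 V, 0))
      (extChartAt 𝓘(ℝ, EM) x x) :=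
    (ContDiffAt.comp (extChartAt 𝓘(ℝ, EM) x x) (g := fderiv ℝ (actionChart EM EG G x))
      (contDiffAt_fderiv_actionChart x) (contDiffAt_const.prodMk contDiffAt_id)).clm_apply contDiffAt_const
  exact ContMDiffAt.comp x (contMDiffAt_iff_contDiffAt.2 h1) contMDiffAt_extChartAt

theorem contMDiffAt_coordAt_dAct (u : TM EM x) : ContMDiffAt 𝓘(ℝ, EG) 𝓘(ℝ, EM) ∞
    (fun a : G => coordAt x (a • x) (dAct EM a x u)) 1 := by
  refine ContMDiffAt.congr_of_eventuallyEq ?_ (coordAt_dAct (EG := EG) x u)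
  have h1 : ContDiffAt ℝ ∞ (fun α : EG => fderiv ℝ (actionChart EM EG G x)
      (α, extChartAt 𝓘(ℝ, EM) x x) (0, coordAt x x u)) (extChartAt 𝓘(ℝ, EG) (1 : G) 1) :=
    (ContDiffAt.comp (extChartAt 𝓘(ℝ, EG) (1 : G) 1) (g := fderiv ℝ (actionChart EM EG G x))
      (contDiffAt_fderiv_actionChart x) (contDiffAt_id.prodMk contDiffAt_const)).clm_apply contDiffAt_const
  exact ContMDiffAt.comp 1 (contMDiffAt_iff_contDiffAt.2 h1) contMDiffAt_extChartAt

/-- The derivative of the differential of the action, by the symmetry of second derivatives. -/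
theorem mvfderiv_coordAt_dAct (V : LieAlg EG G) (u : TM EM x) :
    mvfderiv 𝓘(ℝ, EG) (fun a : G => coordAt x (a • x) (dAct EM a x u)) 1 V
      = mvfderiv 𝓘(ℝ, EM) (fun y => coordAt x y (killing EM V y)) x u := by
  set z₀ := (extChartAt 𝓘(ℝ, EG) (1 : G) 1, extChartAt 𝓘(ℝ, EM) x x) with hz
  have hF := (contDiffAt_fderiv_actionChart (EM := EM) (EG := EG) (G := G) x).differentiableAt
    (by simp)
  have hsym := (contDiffAt_actionChart (EM := EM) (EG := EG) (G := G) x).isSymmSndFDerivAt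
    (by rw [minSmoothness_of_isRCLikeNormedField]; exact two_le_infty)
  have happ : ∀ w : EG × EM, DifferentiableAt ℝ (fun z => fderiv ℝ (actionChart EM EG G x) z w) z₀ :=
    fun w => hF.clm_apply (differentiableAt_const w)
  have hval : ∀ w v : EG × EM, fderiv ℝ (fun z => fderiv ℝ (actionChart EM EG G x) z w) z₀ v
      = fderiv ℝ (fderiv ℝ (actionChart EM EG G x)) z₀ v w := fun w v => by
    have h := (HasFDerivAt.clm_apply hF.hasFDerivAt (hasFDerivAt_const w z₀)).fderiv
    rw [h]
    simp [hz]
  rw [mvfderiv_congr_eventually (coordAt_dAct (EG := EG) x u),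
    mvfderiv_congr_eventually (coordAt_killing x V)]
  have h1 := mvfderiv_partial_left (φ := extChartAt 𝓘(ℝ, EG) (1 : G)) (happ (0, coordAt x x u))
    (mdifferentiableAt_extChartAt (I := 𝓘(ℝ, EG)) (mem_chart_source EG (1 : G))) V
  have h2 := mvfderiv_partial_right (φ := extChartAt 𝓘(ℝ, EM) x)
    (happ (coordAt (EM := EG) (1 : G) 1 V, 0))
    (mdifferentiableAt_extChartAt (I := 𝓘(ℝ, EM)) (mem_chart_source EM x)) u
  rw [h1, h2, hval, hval]
  exact hsym _ _

/-- The derivative of `da u` is the Lie bracket with the generating vector field. -/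
theorem mvfderiv_coordAt_dAct_eq_mlieBracket [CompleteSpace EM] (V : LieAlg EG G) (u : TM EM x) :
    mvfderiv 𝓘(ℝ, EG) (fun a : G => coordAt x (a • x) (dAct EM a x u)) 1 V
      = -coordAt x x (VectorField.mlieBracket 𝓘(ℝ, EM) (fun y => killing EM V y)
        (FiberBundle.extend EM u) x) := by
  rw [coordAt_mlieBracket (secAt_killing x V) (secAt_extendT u), mvfderiv_coordAt_dAct,
    mvfderiv_congr_eventually (coordAt_extend u), FiberBundle.extend_apply_self]
  -- The extension of u has constant coordinates, so only the derivative of the generated field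
  -- remains in the bracket.
  have h : mvfderiv 𝓘(ℝ, EM) (fun _ : M => coordAt x x u) x (killing EM V x) = 0 :=
    DFunLike.congr_fun (mvfderiv_const _) _
  rw [h]
  simp

end ActionCoordinates

/-! ### Multilinear maps on trivial bundles -/

section TrivialBundle

open scoped Topology

variable {EM : Type*} [NormedAddCommGroup EM] [NormedSpace ℝ EM]
  {M : Type*} [TopologicalSpace M] [ChartedSpace EM M]
  {W : Type*} [NormedAddCommGroup W] [NormedSpace ℝ W]

theorem secAt_trivial_iff {x : M} {w : M → W} :
    SecAt EM W (V := Bundle.Trivial M W) w x ↔ ContMDiffAt 𝓘(ℝ, EM) 𝓘(ℝ, W) ∞ w x :=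
  contMDiffAt_section x

theorem isDerivationAt_mvfderiv {x : M} (v : TM EM x) :
    IsDerivationAt W (V := Bundle.Trivial M W) v
      (fun w => (mvfderiv 𝓘(ℝ, EM) (w : M → W) x v : W)) where
  add hσ hτ := DFunLike.congr_fun (mvfderiv_add
    ((secAt_trivial_iff.1 hσ).mdifferentiableAt (by simp))
    ((secAt_trivial_iff.1 hτ).mdifferentiableAt (by simp))) v
  leibniz {f σ} hf hσ := by
    have h := DFunLike.congr_fun (mvfderiv_smul
      (ContMDiffAt.mdifferentiableAt hf (by simp))
      ((secAt_trivial_iff.1 hσ).mdifferentiableAt (by simp))) v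
    exact h

/-- Expanding the arguments in a fixed basis of the finite-dimensional model reduces smoothness to
constant arguments. -/
theorem smoothMultiAt_trivial {FV : Type*} [NormedAddCommGroup FV] [NormedSpace ℝ FV]
    [FiniteDimensional ℝ FV] {ι : Type*} [Fintype ι] [DecidableEq ι]
    {m : M → MultilinearMap ℝ (fun _ : ι => FV) W} {x : M}
    (hm : ∀ c : ι → FV, ContMDiffAt 𝓘(ℝ, EM) 𝓘(ℝ, W) ∞ (fun y => m y c) x) :
    SmoothMultiAt EM FV W (V := Bundle.Trivial M FV) (U := Bundle.Trivial M W) m x := by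
  intro w hw
  refine secAt_trivial_iff.2 ?_
  let b := Module.finBasis ℝ FV
  have h1 : (fun y => m y fun k => w k y) = fun y => ∑ κ : ι → Fin (Module.finrank ℝ FV),
      (∏ k, b.repr (w k y) (κ k)) • m y fun k => b (κ k) := by
    funext y
    conv_lhs =>
      arg 2
      ext k
      rw [← b.sum_repr (w k y)]
    rw [MultilinearMap.map_sum]
    exact Finset.sum_congr rfl fun κ _ => MultilinearMap.map_smul_univ _ _ _
  have h2 : ContMDiffAt 𝓘(ℝ, EM) 𝓘(ℝ, W) ∞ (fun y => ∑ κ : ι → Fin (Module.finrank ℝ FV),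
      (∏ k, b.repr (w k y) (κ k)) • m y fun k => b (κ k)) x := by
    have h3 : ∀ κ : ι → Fin (Module.finrank ℝ FV),
        FunAt EM (fun y => ∏ k, b.repr (w k y) (κ k)) x := fun κ => by
      refine ContMDiffAt.prod fun k _ => ?_
      have h4 : ContDiff ℝ ∞ (fun c : FV => b.repr c (κ k)) :=
        (LinearMap.toContinuousLinearMap (b.coord (κ k))).contDiff
      exact h4.contMDiff.contMDiffAt.comp x (secAt_trivial_iff.1 (hw k))
    exact ContMDiffAt.sum fun κ _ => ContMDiffAt.smul (h3 κ) (hm _)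
  rw [← h1] at h2
  exact h2

end TrivialBundle

/-! ### Differentiating pullbacks by the action -/

section Pullback

open scoped Topology

variable {EM : Type*} [NormedAddCommGroup EM] [NormedSpace ℝ EM] [FiniteDimensional ℝ EM]
  {M : Type*} [TopologicalSpace M] [ChartedSpace EM M]
  [IsManifold 𝓘(ℝ, EM) ∞ M]
  {W : Type*} [NormedAddCommGroup W] [NormedSpace ℝ W]
  {EG : Type*} [NormedAddCommGroup EG] [NormedSpace ℝ EG] [FiniteDimensional ℝ EG]
  {G : Type*} [TopologicalSpace G] [T2Space G] [ChartedSpace EG G] [Group G]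
  [IsManifold 𝓘(ℝ, EG) ∞ G]
  [MulAction G M] [ContMDiffSMul 𝓘(ℝ, EG) 𝓘(ℝ, EM) ∞ G M]

/-- The vector at `y` with given coordinates in the chart at `x`. -/
def ofCoord (x y : M) : EM →L[ℝ] TM EM y :=
  (trivializationAt EM (TangentSpace 𝓘(ℝ, EM)) x).symmL ℝ y

theorem ofCoord_apply {x y : M} (hy : y ∈ (chartAt EM x).source) (c : EM) :
    ofCoord x y c = (trivializationAt EM (TangentSpace 𝓘(ℝ, EM)) x).symm y c := by
  rw [ofCoord, Trivialization.symmL_apply]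
  simpa using hy

theorem ofCoord_coordAt {x y : M} (hy : y ∈ (chartAt EM x).source) (v : TM EM y) :
    ofCoord x y (coordAt x y v) = v := by
  rw [coordAt_eq hy, ofCoord_apply hy]
  exact Trivialization.symm_apply_apply_mk _ (by simpa using hy) v

theorem coordAt_ofCoord {x y : M} (hy : y ∈ (chartAt EM x).source) (c : EM) :
    coordAt x y (ofCoord x y c) = c := by
  rw [coordAt_eq hy, ofCoord_apply hy,
    Trivialization.apply_mk_symm _ (by simpa using hy)]

theorem secAt_ofCoord (x : M) (c : EM) : SecAt EM EM (fun y => ofCoord x y c) x := by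
  rw [secAt_iff_coordAt]
  exact (contMDiffAt_const (c := c)).congr_of_eventuallyEq
    ((eventually_mem_chart (EM := EM) x).mono fun y hy => coordAt_ofCoord hy c)

theorem extend_eq_ofCoord {x y : M} (hy : y ∈ (chartAt EM x).source) (u : TM EM x) :
    FiberBundle.extend EM u y = ofCoord x y (coordAt x x u) := by
  rw [coordAt_eq (mem_chart_source EM x), ofCoord_apply hy]
  rfl

theorem coordAt_dAct_one (x : M) (u : TM EM x) :
    coordAt x ((1 : G) • x) (dAct EM (1 : G) x u) = coordAt x x u := by
  have h := mvfderiv_comp_map (φ := fun y : M => (1 : G) • y) (f := extChartAt 𝓘(ℝ, EM) x) u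
    (mdifferentiableAt_extChartAt (I := 𝓘(ℝ, EM)) (by simp))
    (by simp only [one_smul]; exact mdifferentiableAt_id)
  simp only [one_smul] at h
  exact h.symm

variable {x : M} {ι : Type*} [Fintype ι] [DecidableEq ι] {U : M → Type*}
  [∀ y, AddCommGroup (U y)] [∀ y, Module ℝ (U y)]
  {m : ∀ y : M, MultilinearMap ℝ (fun _ : ι => TM EM y) (U y)}
  {R : ∀ a : G, U (a • x) →ₗ[ℝ] W} {R₀ : U x →ₗ[ℝ] W}

/-- The derivative of the pull back of a field of multilinear maps by the action of `G`. Here `R a`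
brings the values of the multilinear maps back to a fixed vector space. -/
theorem mvfderiv_pullback (hR : ∀ σ : ∀ y : M, U y, R 1 (σ ((1 : G) • x)) = R₀ (σ x))
    (hm : ∀ Y : ι → ∀ y : M, TM EM y, (∀ k, SecAt EM EM (Y k) x) →
      ContMDiffAt 𝓘(ℝ, EG) 𝓘(ℝ, W) ∞ (fun a : G => R a (m (a • x) fun k => Y k (a • x))) 1)
    (Y : ι → TM EM x) (V : LieAlg EG G) :
    mvfderiv 𝓘(ℝ, EG) (fun a : G => R a (m (a • x) fun k => dAct EM a x (Y k))) 1 V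
      = mvfderiv 𝓘(ℝ, EG)
          (fun a : G => R a (m (a • x) fun k => FiberBundle.extend EM (Y k) (a • x))) 1 V
        - ∑ k, R₀ (m x (Function.update Y k (VectorField.mlieBracket 𝓘(ℝ, EM)
          (fun y => killing EM V y) (FiberBundle.extend EM (Y k)) x))) := by
  -- In coordinates everything lives on trivial bundles over G, where the product rule for
  -- multilinear maps applies at 1.
  let m' : G → MultilinearMap ℝ (fun _ : ι => EM) W := fun a =>
    (R a).compMultilinearMap ((m (a • x)).compLinearMap fun _ => (ofCoord x (a • x)).toLinearMap)
  have hm' : SmoothMultiAt EG EM W (V := Bundle.Trivial G EM) (U := Bundle.Trivial G W) m' 1 :=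
    smoothMultiAt_trivial fun c => hm (fun k y => ofCoord x y (c k)) fun k => secAt_ofCoord x (c k)
  obtain ⟨F, hF⟩ := exists_mderiv (isDerivationAt_mvfderiv (EM := EG) (W := EM) (x := (1 : G)) V)
    (isDerivationAt_mvfderiv (EM := EG) (W := W) (x := (1 : G)) V) hm'
  -- The arguments da Y_k and the extensions of Y_k have the same coordinates at a = 1. The
  -- derivative of m' is therefore the same form evaluated on the same vectors, and the two total
  -- derivatives differ only by the derivatives of the arguments, which are brackets for the first
  -- family and zero for the second.
  let w : ι → G → EM := fun k a => coordAt x (a • x) (dAct EM a x (Y k))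
  let w₀ : ι → G → EM := fun k _ => coordAt x x (Y k)
  have h1 := hF w fun k => secAt_trivial_iff.2 (contMDiffAt_coordAt_dAct x (Y k))
  have h2 := hF w₀ fun k => secAt_trivial_iff.2 contMDiffAt_const
  have hw : (fun k => w k 1) = fun k => w₀ k 1 := funext fun k => coordAt_dAct_one x (Y k)
  rw [hw, ← h2] at h1
  simp only [mderiv] at h1
  have h3 : ∀ k, mvfderiv 𝓘(ℝ, EG) (w₀ k) 1 V = 0 := fun k =>
    DFunLike.congr_fun (mvfderiv_const _) V
  have h4 : ∀ k, mvfderiv 𝓘(ℝ, EG) (w k) 1 V = _ := fun k =>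
    mvfderiv_coordAt_dAct_eq_mlieBracket x V (Y k)
  have h5 : ∀ k, m' 1 (Function.update (fun k => w₀ k 1) k (mvfderiv 𝓘(ℝ, EG) (w₀ k) 1 V)) = 0 :=
    fun k => by
      rw [h3]
      exact MultilinearMap.map_update_zero _ _ _
  have h6 : ∀ k, m' 1 (Function.update (fun k => w k 1) k (mvfderiv 𝓘(ℝ, EG) (w k) 1 V))
      = -R₀ (m x (Function.update Y k (VectorField.mlieBracket 𝓘(ℝ, EM)
          (fun y => killing EM V y) (FiberBundle.extend EM (Y k)) x))) := fun k => by
    rw [h4, hw, MultilinearMap.map_update_neg]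
    have h7 := hR fun y => m y fun l => ofCoord x y (Function.update (fun k => w₀ k 1) k
      (coordAt x x (VectorField.mlieBracket 𝓘(ℝ, EM)
          (fun y => killing EM V y) (FiberBundle.extend EM (Y k)) x)) l)
    refine congrArg Neg.neg (h7.trans (congrArg (fun Z => R₀ (m x Z)) (funext fun l => ?_)))
    rcases eq_or_ne l k with rfl | hl
    · simp only [Function.update_self]
      exact ofCoord_coordAt (mem_chart_source EM x) _
    · simp only [Function.update_of_ne hl]
      exact ofCoord_coordAt (mem_chart_source EM x) _
  have h8 : (fun a : G => R a (m (a • x) fun k => dAct EM a x (Y k)))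
      =ᶠ[𝓝 1] fun a => m' a fun k => w k a := by
    filter_upwards [(tendsto_smul_point EM EG x).eventually (eventually_mem_chart (EM := EM) x)]
      with a ha
    exact congrArg (fun Z => R a (m (a • x) Z)) (funext fun k => (ofCoord_coordAt ha _).symm)
  have h9 : (fun a : G => R a (m (a • x) fun k => FiberBundle.extend EM (Y k) (a • x)))
      =ᶠ[𝓝 1] fun a => m' a fun k => w₀ k a := by
    filter_upwards [(tendsto_smul_point EM EG x).eventually (eventually_mem_chart (EM := EM) x)]
      with a ha
    exact congrArg (fun Z => R a (m (a • x) Z)) (funext fun k => extend_eq_ofCoord ha _)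
  rw [mvfderiv_congr_eventually h8, mvfderiv_congr_eventually h9]
  rw [Finset.sum_congr rfl fun k _ => h6 k, Finset.sum_congr rfl fun k _ => h5 k,
    Finset.sum_const_zero, sub_zero, Finset.sum_neg_distrib, sub_neg_eq_add] at h1
  exact eq_sub_of_add_eq h1

end Pullback

/-! ### The infinitesimal action on sections and forms -/

section FibreCoord

open scoped Topology

variable {M : Type*} [TopologicalSpace M]
  {F : Type*} [NormedAddCommGroup F] [NormedSpace ℂ F]
  {E : M → Type*} [TopologicalSpace (TotalSpace F E)]
  [∀ x, AddCommGroup (E x)] [∀ x, Module ℂ (E x)] [∀ x, TopologicalSpace (E x)]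
  [FiberBundle F E] [VectorBundle ℝ F E]
  {EG : Type*} [NormedAddCommGroup EG] [NormedSpace ℝ EG]
  {G : Type*} [TopologicalSpace G] [ChartedSpace EG G] [Group G]

/-- The fibre at `x`, identified with the model fibre by the preferred trivialization. -/
def fibreCoord (F : Type*) [NormedAddCommGroup F] [NormedSpace ℂ F]
    {E : M → Type*} [TopologicalSpace (TotalSpace F E)]
    [∀ x, AddCommGroup (E x)] [∀ x, Module ℂ (E x)] [∀ x, TopologicalSpace (E x)]
    [FiberBundle F E] [VectorBundle ℝ F E] (x : M) : E x ≃L[ℝ] F :=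
  (trivializationAt F E x).continuousLinearEquivAt ℝ x
    (FiberBundle.mem_baseSet_trivializationAt' x)

theorem fibreCoord_fibreDeriv {x : M} (f : G → E x) (V : LieAlg EG G) :
    fibreCoord F x (fibreDeriv F f V) = mvfderiv 𝓘(ℝ, EG) (fun a => fibreCoord F x (f a)) 1 V :=
  ContinuousLinearEquiv.apply_symm_apply _ _

theorem fibreCoord_complex_smul [VectorBundle ℂ F E] {x : M} (z : ℂ) (v : E x) :
    fibreCoord F x (z • v) = z • fibreCoord F x v :=
  ((trivializationAt F E x).linear ℂ (FiberBundle.mem_baseSet_trivializationAt' x)).map_smul z v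

end FibreCoord

section LieDerivative

open scoped Topology

variable {EM : Type*} [NormedAddCommGroup EM] [NormedSpace ℝ EM] [FiniteDimensional ℝ EM]
  {M : Type*} [TopologicalSpace M] [T2Space M] [ChartedSpace EM M]
  [IsManifold 𝓘(ℝ, EM) ∞ M]
  {F : Type*} [NormedAddCommGroup F] [NormedSpace ℂ F]
  {E : M → Type*} [TopologicalSpace (TotalSpace F E)]
  [∀ x, AddCommGroup (E x)] [∀ x, Module ℂ (E x)] [∀ x, TopologicalSpace (E x)]
  [FiberBundle F E] [∀ x, IsTopologicalAddGroup (E x)]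
  [∀ x, ContinuousSMul ℝ (E x)] [VectorBundle ℝ F E] [VectorBundle ℂ F E]
  [ContMDiffVectorBundle ∞ F E 𝓘(ℝ, EM)]
  {h : ∀ x : M, E x →ₗ⋆[ℂ] E x →ₗ[ℂ] ℂ} {covE : CovariantDerivative 𝓘(ℝ, EM) F E}
  {EG : Type*} [NormedAddCommGroup EG] [NormedSpace ℝ EG] [FiniteDimensional ℝ EG]
  {G : Type*} [TopologicalSpace G] [T2Space G] [ChartedSpace EG G] [Group G]
  [LieGroup 𝓘(ℝ, EG) ∞ G] [MulAction G M] [ContMDiffSMul 𝓘(ℝ, EG) 𝓘(ℝ, EM) ∞ G M]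
  {ρ : ∀ (a : G) (x : M), E x ≃ₗ[ℂ] E (a • x)}

theorem IsLift.symm_one_apply (hρ : IsLift EG h covE ρ) (x : M) (σ : ∀ y : M, E y) :
    (ρ 1 x).symm (σ ((1 : G) • x)) = σ x := by
  rw [LinearEquiv.symm_apply_eq]
  have h1 := hρ.one x (σ x)
  have h2 : ∀ y : M, y = x → ∀ w : E y, TotalSpace.mk' F y w = TotalSpace.mk' F x (σ x) →
      σ y = w := by
    rintro y rfl w hw
    exact (TotalSpace.mk_injective _ hw).symm
  exact h2 _ (one_smul G x) _ h1

/-- The inverse of the lift of a is the lift of a⁻¹, stated in the total space because a⁻¹ • a • x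
is only propositionally x. It turns a ↦ a⁻¹ σ(a x) into a composition of smooth maps. -/
theorem IsLift.mk_symm (hρ : IsLift EG h covE ρ) (x : M) (a : G) (w : E (a • x)) :
    TotalSpace.mk' F x ((ρ a x).symm w)
      = TotalSpace.mk' F (a⁻¹ • a • x) (ρ a⁻¹ (a • x) w) := by
  have h1 : ∀ c : G, c = 1 → ∀ u : E x,
      TotalSpace.mk' F (c • x) (ρ c x u) = TotalSpace.mk' F x u := by
    rintro c rfl u
    exact hρ.one x u
  rw [← h1 _ (inv_mul_cancel a), hρ.mul, LinearEquiv.apply_symm_apply]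

theorem IsLift.contMDiffAt_symm (hρ : IsLift EG h covE ρ) {x : M} {σ : ∀ y : M, E y}
    (hσ : SecAt EM F σ x) : ContMDiffAt 𝓘(ℝ, EG) 𝓘(ℝ, F) ∞
      (fun a : G => fibreCoord F x ((ρ a x).symm (σ (a • x)))) 1 := by
  have h1 : ContMDiffAt 𝓘(ℝ, EG) (𝓘(ℝ, EM).prod 𝓘(ℝ, F)) ∞
      (fun a : G => TotalSpace.mk' F (a • x) (σ (a • x))) 1 :=
    ContMDiffAt.comp_of_eq (g := fun y => TotalSpace.mk' F y (σ y)) (f := fun a : G => a • x)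
      hσ (contMDiffAt_smul_point x 1) (one_smul G x)
  have h2 : ContMDiffAt 𝓘(ℝ, EG) (𝓘(ℝ, EG).prod (𝓘(ℝ, EM).prod 𝓘(ℝ, F))) ∞
      (fun a : G => (a⁻¹, TotalSpace.mk' F (a • x) (σ (a • x)))) 1 :=
    ((contMDiff_inv 𝓘(ℝ, EG) ∞).contMDiffAt).prodMk h1
  have h3 := (hρ.smooth.contMDiffAt).comp (1 : G) h2
  have h4 : ContMDiffAt 𝓘(ℝ, EG) (𝓘(ℝ, EM).prod 𝓘(ℝ, F)) ∞
      (fun a : G => TotalSpace.mk' F x ((ρ a x).symm (σ (a • x)))) 1 :=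
    h3.congr_of_eventuallyEq (Filter.Eventually.of_forall fun a => hρ.mk_symm x a _)
  exact (Bundle.contMDiffAt_totalSpace.1 h4).2

/-- The values of a section, brought back to the fibre at `x` by the lifted action. -/
def pullCoord (F : Type*) [NormedAddCommGroup F] [NormedSpace ℂ F]
    {E : M → Type*} [TopologicalSpace (TotalSpace F E)]
    [∀ x, AddCommGroup (E x)] [∀ x, Module ℂ (E x)] [∀ x, TopologicalSpace (E x)]
    [FiberBundle F E] [VectorBundle ℝ F E] (ρ : ∀ (a : G) (x : M), E x ≃ₗ[ℂ] E (a • x))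
    (x : M) (a : G) : E (a • x) →ₗ[ℝ] F :=
  (fibreCoord F x).toLinearEquiv.toLinearMap ∘ₗ (ρ a x).symm.toLinearMap.restrictScalars ℝ

/-- In the fixed fibre at x this is the product rule on G; the function a ↦ f(a x) has derivative
df(V) at 1, which identifies the direction of the derivation. -/
theorem isComplexDerivation_lieE (hρ : IsLift EG h covE ρ) (V : LieAlg EG G) (x : M) :
    IsComplexDerivation F (killing EM V x) (fun σ => lieE F ρ V σ x) where
  add {σ τ} hσ hτ := by
    refine (fibreCoord F x).injective ?_
    have h1 := DFunLike.congr_fun (mvfderiv_add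
      ((hρ.contMDiffAt_symm hσ).mdifferentiableAt (by simp))
      ((hρ.contMDiffAt_symm hτ).mdifferentiableAt (by simp))) V
    simp only [lieE, fibreCoord_fibreDeriv, map_add]
    exact h1
  leibniz {f σ} hf hσ := by
    refine (fibreCoord F x).injective ?_
    have hf' : MDifferentiableAt 𝓘(ℝ, EM) 𝓘(ℝ, ℝ) f x := hf.mdifferentiableAt (by simp)
    have h1 := DFunLike.congr_fun (mvfderiv_smul (a := fun a : G => f (a • x))
      (MDifferentiableAt.comp_of_eq (x := (1 : G)) (g := f) (f := fun a : G => a • x) hf'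
        ((contMDiffAt_smul_point x (1 : G)).mdifferentiableAt (by simp)) (one_smul G x))
      ((hρ.contMDiffAt_symm hσ).mdifferentiableAt (by simp))) V
    have h2 := mvfderiv_smul_point (G := G) hf' V
    have h3 : ∀ a : G, fibreCoord F x ((ρ a x).symm (f (a • x) • σ (a • x)))
        = f (a • x) • fibreCoord F x ((ρ a x).symm (σ (a • x))) := fun a => by
      rw [← Complex.coe_smul, map_smul, Complex.coe_smul, map_smul]
    simp only [lieE, fibreCoord_fibreDeriv, map_add, map_smul, h3]
    refine h1.trans ?_
    rw [← h2]
    simp only [add_apply, FunLike.coe_smul, Pi.smul_apply, ContinuousLinearMap.smulRight_apply,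
      hρ.symm_one_apply]
    rw [one_smul]
  map_I σ hσ := by
    refine (fibreCoord F x).injective ?_
    have h3 : ∀ a : G, fibreCoord F x ((ρ a x).symm (Complex.I • σ (a • x)))
        = Complex.I • fibreCoord F x ((ρ a x).symm (σ (a • x))) := fun a => by
      rw [map_smul, fibreCoord_complex_smul]
    have h1 := mvfderiv_fderiv_comp (Φ := (Complex.I • ContinuousLinearMap.id ℝ F : F →L[ℝ] F)) V
      (ContinuousLinearMap.differentiableAt _)
      ((hρ.contMDiffAt_symm hσ).mdifferentiableAt (by simp))
    simp only [lieE, fibreCoord_fibreDeriv, h3, fibreCoord_complex_smul]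
    refine h1.trans ?_
    rw [ContinuousLinearMap.fderiv]
    rfl

theorem isDerivationAt_mlieBracket {K : ∀ y : M, TM EM y} {x : M} :
    IsDerivationAt EM (K x) (fun Y => VectorField.mlieBracket 𝓘(ℝ, EM) K Y x) where
  add {σ τ} hσ hτ := VectorField.mlieBracket_add_right
    (ContMDiffAt.mdifferentiableAt hσ (by simp)) (ContMDiffAt.mdifferentiableAt hτ (by simp))
  leibniz {f σ} hf hσ := by
    have h1 := VectorField.mlieBracket_smul_right (V := K)
      (ContMDiffAt.mdifferentiableAt hf (by simp)) (ContMDiffAt.mdifferentiableAt hσ (by simp))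
    exact h1.trans (add_comm _ _)

variable {p : ℕ} {s : ∀ y : M, Forms (TM EM y) (E y) p}

/-- The infinitesimal action on forms is the derivative defined by the Lie bracket and the
infinitesimal action on `E`. -/
theorem hasFormDeriv_lieForms (hρ : IsLift EG h covE ρ) (V : LieAlg EG G) (x : M)
    (hs : ∀ q, SmoothBiformAt F (fun y => s y q) x) (q : ℕ) :
    HasFormDeriv F (fun Y => VectorField.mlieBracket 𝓘(ℝ, EM) (fun y => killing EM V y) Y x)
      (fun σ => lieE F ρ V σ x) (fun y => s y q) (lieForms F ρ V s x q) := by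
  choose θ hθ using fun q => exists_hasFormDeriv isDerivationAt_mlieBracket
    (isComplexDerivation_lieE hρ V x).toIsDerivationAt (hs q)
  have key : ∀ (q : ℕ) (Y : Fin p → TM EM x) (Z : Fin q → TM EM x),
      fibreDeriv F (fun a : G => (ρ a x).symm
        (s (a • x) q (fun i => dAct EM a x (Y i)) (fun j => dAct EM a x (Z j)))) V = θ q Y Z := by
    intro q Y Z
    have h1 := hθ q (fun i => FiberBundle.extend EM (Y i)) (fun j => FiberBundle.extend EM (Z j))
      (fun _ => secAt_extendT _) fun _ => secAt_extendT _
    simp only [FiberBundle.extend_apply_self] at h1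
    rw [h1]
    refine (fibreCoord F x).injective ?_
    have h2 := mvfderiv_pullback (x := x) (m := fun y => toMultilinear (s y q))
      (R := pullCoord F ρ x) (R₀ := (fibreCoord F x).toLinearEquiv.toLinearMap)
      (fun σ => congrArg (fibreCoord F x) (hρ.symm_one_apply x σ))
      (fun W hW => hρ.contMDiffAt_symm ((hs q).toMulti W hW)) (Sum.elim Y Z) V
    simp only [Fintype.sum_sum_type, toMultilinear_apply, Sum.elim_inl, Sum.elim_inr,
      Sum.update_elim_inl, Sum.update_elim_inr, Sum.elim_comp_inl, Sum.elim_comp_inr, ← sub_sub] at h2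
    simp only [map_sub, map_sum, lieE, fibreCoord_fibreDeriv]
    exact h2
  have h0 : lieForms F ρ V s x q = θ q := by
    ext Y Z
    rw [lieForms, ofValues_apply (fun q => toMultilinear (θ q))
      fun q => isBialternating_toMultilinear (θ q)]
    · exact key q Y Z
    · intro q Y Z
      rw [toMultilinear_apply, Sum.elim_comp_inl, Sum.elim_comp_inr, key]
  rw [h0]
  exact hθ q

end LieDerivative

/-- A bilinear form as a multilinear map of two variables. -/
def bilinMultilinear {T : Type*} [AddCommGroup T] [Module ℝ T] (β : T →ₗ[ℝ] T →ₗ[ℝ] ℝ) :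
    MultilinearMap ℝ (fun _ : Fin 2 => T) ℝ where
  toFun w := β (w 0) (w 1)
  map_update_add' := by
    intro _ w i u v
    fin_cases i <;> simp
  map_update_smul' := by
    intro _ w i r v
    fin_cases i <;> simp

/-! ### Consequences of the invariance of g and J -/

section Invariance

open scoped Topology

variable {EM : Type*} [NormedAddCommGroup EM] [NormedSpace ℝ EM] [FiniteDimensional ℝ EM]
  {M : Type*} [TopologicalSpace M] [T2Space M] [ChartedSpace EM M]
  [IsManifold 𝓘(ℝ, EM) ∞ M]
  {Ω : ∀ x : M, TM EM x →L[ℝ] TM EM x →L[ℝ] ℝ} {J : ∀ x : M, TM EM x →L[ℝ] TM EM x}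
  {nab : AffineConn EM M}
  {EG : Type*} [NormedAddCommGroup EG] [NormedSpace ℝ EG] [FiniteDimensional ℝ EG]
  {G : Type*} [TopologicalSpace G] [T2Space G] [ChartedSpace EG G] [Group G]
  [LieGroup 𝓘(ℝ, EG) ∞ G] [MulAction G M] [ContMDiffSMul 𝓘(ℝ, EG) 𝓘(ℝ, EM) ∞ G M]

/-- The Lie derivative of an invariant bilinear form vanishes. -/
theorem mvfderiv_killing_bilin {β : ∀ y : M, TM EM y →ₗ[ℝ] TM EM y →ₗ[ℝ] ℝ} {x : M}
    (hβ : ∀ Y Z : ∀ y : M, TM EM y, SecAt EM EM Y x → SecAt EM EM Z x →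
      FunAt EM (fun y => β y (Y y) (Z y)) x)
    (hinv : ∀ (a : G) (u v : TM EM x), β (a • x) (dAct EM a x u) (dAct EM a x v) = β x u v)
    (V : LieAlg EG G) (u v : TM EM x) :
    mvfderiv 𝓘(ℝ, EM) (fun y => β y (FiberBundle.extend EM u y) (FiberBundle.extend EM v y)) x
        (killing EM V x)
      = β x (VectorField.mlieBracket 𝓘(ℝ, EM) (fun y => killing EM V y)
          (FiberBundle.extend EM u) x) v
        + β x u (VectorField.mlieBracket 𝓘(ℝ, EM) (fun y => killing EM V y)
          (FiberBundle.extend EM v) x) := by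
  have hu := secAt_extendT u
  have hv := secAt_extendT v
  have h1 := mvfderiv_pullback (G := G) (x := x) (U := fun _ => ℝ)
    (m := fun y => bilinMultilinear (β y)) (R := fun _ => LinearMap.id) (R₀ := LinearMap.id)
    (fun σ => congrArg σ (one_smul G x))
    (fun W hW => ContMDiffAt.comp_of_eq (g := fun y => β y (W 0 y) (W 1 y))
      (f := fun a : G => a • x) (hβ _ _ (hW 0) (hW 1)) (contMDiffAt_smul_point x 1) (one_smul G x))
    ![u, v] V
  have h2 := mvfderiv_smul_point (G := G) ((hβ _ _ hu hv).mdifferentiableAt (by simp)) V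
  -- By invariance the pulled back form is constant in the group variable, so the two sides of the
  -- pullback formula balance.
  have h3 : mvfderiv 𝓘(ℝ, EG) (fun a : G => β (a • x) (dAct EM a x u) (dAct EM a x v)) 1 V = 0 := by
    simp only [hinv]
    exact mvfderiv_const_apply _ V
  have h4 := h3.symm.trans h1
  rw [← h2]
  refine (eq_of_sub_eq_zero h4.symm).trans ?_
  rw [Fin.sum_univ_two]
  simp [bilinMultilinear]

variable (hΩ : IsSymplectic Ω) (hJ : IsCompatible Ω J)
  (hnab : IsLeviCivita (metric Ω J) nab)

theorem IsInvariant.metric (hG : IsInvariant G Ω J) (a : G) (x : M) (u v : TM EM x) :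
    metric Ω J (a • x) (dAct EM a x u) (dAct EM a x v) = metric Ω J x u v := by
  rw [metric_apply, hG.complexStructure, hG.symplectic, metric_apply]

include hΩ hJ hnab

/-- On a vector field generated by the action, the projected connection and the Lie bracket differ
by a skew-Hermitian endomorphism. -/
theorem exists_nablaJ_sub_mlieBracket (hG : IsInvariant G Ω J) (V : LieAlg EG G) (x : M) :
    ∃ S : TM EM x →ₗ[ℝ] TM EM x,
      (∀ Y, SecAt EM EM Y x → nablaJ nab J Y x (killing EM V x)
        = VectorField.mlieBracket 𝓘(ℝ, EM) (fun y => killing EM V y) Y x + S (Y x)) ∧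
      (∀ u, nab (fun y => killing EM V y) x u = S u + diffB nab J x (killing EM V x) u) ∧
      (∀ u v, metric Ω J x (S u) v = -metric Ω J x u (S v)) ∧
      (∀ u, S (J x u) = J x (S u)) := by
  obtain ⟨B, hB⟩ := exists_diffB hΩ hJ hnab x
  have hK := secAt_killing (EM := EM) (EG := EG) x V
  -- Vanishing torsion gives ∇_V Y - [V, Y] = ∇_Y V. Subtracting B_V Y replaces ∇ by the projected
  -- connection, which dictates S = ∇V - B_V.
  let S : TM EM x →ₗ[ℝ] TM EM x :=
    (nab (fun y => killing EM V y) x).toLinearMap - B (killing EM V x)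
  have hS : ∀ u, S u = nab (fun y => killing EM V y) x u - diffB nab J x (killing EM V x) u :=
    fun u => by rw [← hB]; rfl
  have h1 : ∀ Y, SecAt EM EM Y x → nablaJ nab J Y x (killing EM V x)
      = VectorField.mlieBracket 𝓘(ℝ, EM) (fun y => killing EM V y) Y x + S (Y x) := by
    intro Y hY
    rw [← hnab.torsionFree x _ _ hK hY, hS, ← diffB_eq hΩ hJ hnab _ hY]
    abel
  have hd := isHermitianDerivation_nablaJ hΩ hJ hnab (killing EM V x)
  have hH := isSmoothHermitian hΩ hJ
  -- The projected connection and the Lie bracket both differentiate g(u, v) by the product rule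
  -- along V; comparing them leaves the skewness of S.
  have h2 : ∀ u v, metric Ω J x (S u) v = -metric Ω J x u (S v) := by
    intro u v
    have hu := secAt_extendT u
    have hv := secAt_extendT v
    have e1 := hd.metric _ _ hu hv
    have e2 := mvfderiv_killing_bilin (β := metric Ω J) (fun Y Z hY hZ => hH.smooth_g x Y Z hY hZ)
      (fun a u v => hG.metric a x u v) V u v
    rw [e2, h1 _ hu, h1 _ hv] at e1
    simp only [FiberBundle.extend_apply_self, map_add, LinearMap.add_apply] at e1
    linarith
  -- The same comparison for the invariant form g(J·, ·) shows, with skewness, that S commutes with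
  -- J.
  have h3 : ∀ u v, metric Ω J x (J x (S u)) v = -metric Ω J x (J x u) (S v) := by
    intro u v
    have hu := secAt_extendT u
    have hv := secAt_extendT v
    have e1 := hd.metric _ _ (hJ.smooth x _ hu) hv
    have e2 := mvfderiv_killing_bilin
      (β := fun y => (metric Ω J y) ∘ₗ (J y).toLinearMap)
      (fun Y Z hY hZ => hH.smooth_g x _ Z (hH.smooth_J x Y hY) hZ)
      (fun a u v => by
        simp only [LinearMap.comp_apply, ContinuousLinearMap.coe_coe]
        rw [hG.complexStructure, hG.metric]) V u v
    simp only [LinearMap.comp_apply, ContinuousLinearMap.coe_coe] at e2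
    rw [e2, hd.map_J _ hu, h1 _ hu, h1 _ hv] at e1
    simp only [FiberBundle.extend_apply_self, map_add, LinearMap.add_apply] at e1
    linarith
  refine ⟨S, h1, fun u => by rw [hS]; abel, h2, fun u => eq_of_metric hJ fun z => ?_⟩
  rw [h2, h3]

end Invariance

/-! ### The covariant derivative along a generated vector field -/

section LieForms

open scoped Topology

variable {EM : Type*} [NormedAddCommGroup EM] [NormedSpace ℝ EM] [FiniteDimensional ℝ EM]
  {M : Type*} [TopologicalSpace M] [T2Space M] [ChartedSpace EM M]
  [IsManifold 𝓘(ℝ, EM) ∞ M]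
  {Ω : ∀ x : M, TM EM x →L[ℝ] TM EM x →L[ℝ] ℝ} {J : ∀ x : M, TM EM x →L[ℝ] TM EM x}
  {nab : AffineConn EM M}
  {F : Type*} [NormedAddCommGroup F] [NormedSpace ℂ F] [FiniteDimensional ℂ F]
  {E : M → Type*} [TopologicalSpace (TotalSpace F E)]
  [∀ x, AddCommGroup (E x)] [∀ x, Module ℂ (E x)] [∀ x, TopologicalSpace (E x)]
  [FiberBundle F E] [∀ x, IsTopologicalAddGroup (E x)]
  [∀ x, ContinuousSMul ℝ (E x)] [VectorBundle ℝ F E] [VectorBundle ℂ F E]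
  [ContMDiffVectorBundle ∞ F E 𝓘(ℝ, EM)]
  {h : ∀ x : M, E x →ₗ⋆[ℂ] E x →ₗ[ℂ] ℂ} {covE : CovariantDerivative 𝓘(ℝ, EM) F E}
  {EG : Type*} [NormedAddCommGroup EG] [NormedSpace ℝ EG] [FiniteDimensional ℝ EG]
  {G : Type*} [TopologicalSpace G] [T2Space G] [ChartedSpace EG G] [Group G]
  [LieGroup 𝓘(ℝ, EG) ∞ G] [MulAction G M] [ContMDiffSMul 𝓘(ℝ, EG) 𝓘(ℝ, EM) ∞ G M]
  {ρ : ∀ (a : G) (x : M), E x ≃ₗ[ℂ] E (a • x)}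
  {p : ℕ} {s : ∀ y : M, Forms (TM EM y) (E y) p}
  {m : ℕ} {e : ∀ x : M, Module.Basis (Fin m) ℝ (TM EM x)}

/-- The operator `L_V - ∇_V` on sections of `E` is an endomorphism. -/
theorem exists_rE_linear (hcovE : IsHermitianConnection h covE) (hρ : IsLift EG h covE ρ)
    (V : LieAlg EG G) (x : M) : ∃ L : E x →ₗ[ℝ] E x, (∀ v, rE covE ρ V v = L v) ∧
      ∀ σ, SecAt EM F σ x → lieE F ρ V σ x = covE σ x (killing EM V x) + L (σ x) := by
  have h1 := isComplexDerivation_lieE (F := F) hρ V x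
  have h2 := isComplexDerivation_covE (F := F) hcovE (killing EM V x)
  have : FiniteDimensional ℝ F := FiniteDimensional.complexToReal F
  have h3 : SmoothTensorialAt EM F
      (fun σ => lieE F ρ V σ x - covE σ x (killing EM V x)) x :=
    { add := fun {σ τ} hσ hτ => by
        rw [h1.add hσ hτ, h2.add hσ hτ]
        abel
      smul := fun {f σ} hf hσ => by
        rw [h1.leibniz hf hσ, h2.leibniz hf hσ]
        module }
  obtain ⟨L, hL⟩ := exists_linear_of_tensorial h3
  refine ⟨L, fun v => ?_, fun σ hσ => ?_⟩
  · rw [rE, hL _ (secAt_extend v), FiberBundle.extend_apply_self]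
  · rw [← hL σ hσ]
    abel

theorem rEForms_apply {V : LieAlg EG G} {x : M} {L : E x →ₗ[ℝ] E x}
    (hL : ∀ v, rE covE ρ V v = L v) (η : Forms (TM EM x) (E x) p) (q : ℕ)
    (Y : Fin p → TM EM x) (Z : Fin q → TM EM x) :
    rEForms covE ρ V η q Y Z = L (η q Y Z) := by
  rw [rEForms, ofValues_apply (fun q => L.compMultilinearMap (toMultilinear (η q)))
    (fun q => ⟨fun i j hij W hW => ?_, fun i j hij W hW => ?_⟩), hL]
  · intro q Y Z
    rw [hL]
    rfl
  · rw [LinearMap.compMultilinearMap_apply,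
      (isBialternating_toMultilinear (η q)).left i j hij W hW, map_zero]
  · rw [LinearMap.compMultilinearMap_apply,
      (isBialternating_toMultilinear (η q)).right i j hij W hW, map_zero]

/-- The projected trace is the complex trace of v ↦ `nablaJ` of X along v. The remaining part v ↦
B_v X of ∇X anticommutes with J by `diffB_J_left`, hence has no trace; closedness of Ω enters here.
-/
theorem traceNabla10_eq (hΩ : IsSymplectic Ω) (hJ : IsCompatible Ω J)
    (hnab : IsLeviCivita (metric Ω J) nab) {X : ∀ y : M, TM EM y} {x : M} (hX : SecAt EM EM X x) :
    traceNabla10 hJ nab X x = traceJ (J x).toLinearMap (nab X x).toLinearMap := by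
  obtain ⟨B, hB⟩ := exists_diffB hΩ hJ hnab x
  have : FiniteDimensional ℝ (TM EM x) := inferInstanceAs (FiniteDimensional ℝ EM)
  have h1 : traceNabla10 hJ nab X x = traceJ (J x).toLinearMap ((1 / 2 : ℝ) • ((nab X x).toLinearMap
      - (J x).toLinearMap ∘ₗ (nab (fun y => J y (X y)) x).toLinearMap)) :=
    trace10_eq (hJ.sq x) _ _
  have h2 : (nab X x).toLinearMap = (1 / 2 : ℝ) • ((nab X x).toLinearMap
      - (J x).toLinearMap ∘ₗ (nab (fun y => J y (X y)) x).toLinearMap) + B.flip (X x) := by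
    ext v
    rw [LinearMap.add_apply, LinearMap.flip_apply, hB, ← diffB_eq hΩ hJ hnab v hX]
    simp [nablaJ]
  rw [h1]
  conv_rhs => rw [h2, traceJ_add]
  rw [traceJ_eq_zero_of_anticomm (hJ.sq x) (β := B.flip (X x)) fun v => ?_, add_zero]
  simp only [LinearMap.flip_apply, hB]
  exact diffB_J_left hΩ hJ hnab x v (X x)

variable (hΩ : IsSymplectic Ω) (hJ : IsCompatible Ω J)
  (hnab : IsLeviCivita (metric Ω J) nab) (hcovE : IsHermitianConnection h covE)

include hΩ hJ hnab hcovE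

/-- The covariant derivative along a vector field generated by the action, in terms of the
infinitesimal action. -/
theorem cov_killing (he : ∀ x i j, metric Ω J x (e x i) (e x j) = if i = j then 1 else 0)
    (hG : IsInvariant G Ω J) (hρ : IsLift EG h covE ρ) (hs : IsSmoothForm F J s)
    (V : LieAlg EG G) (x : M) :
    cov Ω J nab e covE s x (killing EM V x) = lieForms F ρ V s x - rEForms covE ρ V (s x)
      - ∑ j, opA (metric Ω J x) (J x).toLinearMap (e x j)
          (nab (fun y => killing EM V y) x (e x j)) (s x)
      + (1 / 4 : ℂ) • ∑ j, cl Ω J (e x j) (cl Ω J (nab (fun y => killing EM V y) x (e x j)) (s x))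
      + (1 / 2 * traceNabla10 hJ nab (fun y => killing EM V y) x) • s x := by
  obtain ⟨B, hB⟩ := exists_diffB hΩ hJ hnab x
  obtain ⟨S, hS, hSnab, hSskew, hSJ⟩ := exists_nablaJ_sub_mlieBracket hΩ hJ hnab hG V x
  obtain ⟨L, hL, hLσ⟩ := exists_rE_linear hcovE hρ V x
  have hp := (isSmoothHermitian hΩ hJ).pair x
  have ht := hs.isType x
  have hK := secAt_killing (EM := EM) (EG := EG) x V
  -- On a generated field ∇V = S + B_V, and B_V anticommutes with J, so only S contributes to the
  -- complex trace.
  have h1 : traceNabla10 hJ nab (fun y => killing EM V y) x = traceJ (J x).toLinearMap S := by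
    have h2 : (nab (fun y => killing EM V y) x).toLinearMap = S + B (killing EM V x) := by
      ext v
      rw [LinearMap.add_apply, hB, ← hSnab]
      rfl
    rw [traceNabla10_eq hΩ hJ hnab hK, h2, traceJ_add,
      traceJ_eq_zero_of_anticomm (hJ.sq x) (β := B (killing EM V x)) fun v => ?_, add_zero]
    simp only [hB]
    exact diffB_J hΩ hJ hnab x _ v
  have h3 : ∑ j, cl Ω J (e x j) (cl Ω J (nab (fun y => killing EM V y) x (e x j)) (s x))
      = ∑ j, cl Ω J (e x j) (cl Ω J (S (e x j)) (s x))
        + ∑ j, cl Ω J (e x j) (cl Ω J (diffB nab J x (killing EM V x) (e x j)) (s x)) := by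
    simp only [hSnab, map_add, LinearMap.add_apply, Finset.sum_add_distrib]
  -- Both sides are evaluated on extended vectors. Replacing the projected connection by bracket
  -- plus S and ∇^E by L^E - r^E leaves the insertions of S. Those in the (1,0) arguments are the
  -- A-sum; those in the (0,1) arguments are the Clifford sum and half the trace.
  have h4 : cov0 nab J covE s x (killing EM V x) = lieForms F ρ V s x - rEForms covE ρ V (s x)
      - ∑ j, opA (metric Ω J x) (J x).toLinearMap (e x j)
          (nab (fun y => killing EM V y) x (e x j)) (s x)
      + (1 / 4 : ℂ) • ∑ j, cl Ω J (e x j) (cl Ω J (S (e x j)) (s x))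
      + (1 / 2 * traceJ (J x).toLinearMap S) • s x := by
    refine Forms.ext fun q Y Z => ?_
    have e1 := hasFormDeriv_cov0 hΩ hJ hnab hcovE hs x (killing EM V x) q
      (fun i => FiberBundle.extend EM (Y i)) (fun j => FiberBundle.extend EM (Z j))
      (fun _ => secAt_extendT _) fun _ => secAt_extendT _
    have e2 := hasFormDeriv_lieForms hρ V x (hs.biform x) q
      (fun i => FiberBundle.extend EM (Y i)) (fun j => FiberBundle.extend EM (Z j))
      (fun _ => secAt_extendT _) fun _ => secAt_extendT _
    have e3 := hLσ _ (hs.biform x q (fun i => FiberBundle.extend EM (Y i))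
      (fun j => FiberBundle.extend EM (Z j)) (fun _ => secAt_extendT _) fun _ => secAt_extendT _)
    simp only [hS _ (secAt_extendT _), FiberBundle.extend_apply_self] at e1 e2 e3
    have e4 := ht.sum_cliffF hp (he x) S hSskew hSJ q Y Z
    have e5 : (∑ j, opA (metric Ω J x) (J x).toLinearMap (e x j)
        (nab (fun y => killing EM V y) x (e x j)) (s x)) q Y Z
        = ∑ k, s x q (Function.update Y k (S (Y k))) Z := by
      have e6 := ht.sum_opA hp (he x) (nab (fun y => killing EM V y) x).toLinearMap q Y Z
      refine e6.trans (Finset.sum_congr rfl fun k _ => ?_)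
      -- This is the part of ∇V = S + B_V commuting with J: S is kept and B_V drops out.
      have e7 : (1 / 2 : ℝ) • (nab (fun y => killing EM V y) x (Y k)
          - J x (nab (fun y => killing EM V y) x (J x (Y k)))) = S (Y k) := by
        simp only [hSnab, hSJ, diffB_J hΩ hJ hnab, map_add, map_neg, hJ.sq]
        module
      rw [← e7]
      rfl
    change cov0 nab J covE s x (killing EM V x) q Y Z = lieForms F ρ V s x q Y Z
      - rEForms covE ρ V (s x) q Y Z - (∑ j, opA (metric Ω J x) (J x).toLinearMap (e x j)
          (nab (fun y => killing EM V y) x (e x j)) (s x)) q Y Z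
      + (1 / 4 : ℂ) • (∑ j, cl Ω J (e x j) (cl Ω J (S (e x j)) (s x))) q Y Z
      + (1 / 2 * traceJ (J x).toLinearMap S) • s x q Y Z
    rw [e1, e2, e3, e5, rEForms_apply hL, e4]
    simp only [AlternatingMap.map_update_add, AlternatingMap.add_apply, Finset.sum_add_distrib]
    module
  -- The Clifford sums of S and of B_V add up to the one of ∇V.
  rw [cov_eq, h4, h3, h1]
  module

end LieForms

theorem sharp_eq {T : Type*} [AddCommGroup T] [Module ℝ T] {b : T →ₗ[ℝ] T →ₗ[ℝ] ℝ}
    (hb : ∀ u, (∀ w, b u w = 0) → u = 0) {ξ : T →ₗ[ℝ] ℝ} {u : T} (hu : ∀ w, b u w = ξ w) :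
    sharp b ξ = u := by
  have h1 : ∀ w, b (sharp b ξ) w = ξ w :=
    Classical.epsilon_spec (p := fun u => ∀ w, b u w = ξ w) ⟨u, hu⟩
  refine sub_eq_zero.1 (hb _ fun w => ?_)
  rw [LinearMap.map_sub₂, h1, hu, sub_self]

/-! ### The Hamiltonian vector field of the squared moment map -/

section MomentMap

open scoped Topology

variable {EM : Type*} [NormedAddCommGroup EM] [NormedSpace ℝ EM] [FiniteDimensional ℝ EM]
  {M : Type*} [TopologicalSpace M] [T2Space M] [ChartedSpace EM M]
  [IsManifold 𝓘(ℝ, EM) ∞ M]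
  {Ω : ∀ x : M, TM EM x →L[ℝ] TM EM x →L[ℝ] ℝ} {J : ∀ x : M, TM EM x →L[ℝ] TM EM x}
  {nab : AffineConn EM M}
  {EG : Type*} [NormedAddCommGroup EG] [NormedSpace ℝ EG] [FiniteDimensional ℝ EG]
  {G : Type*} [TopologicalSpace G] [T2Space G] [ChartedSpace EG G] [Group G]
  [LieGroup 𝓘(ℝ, EG) ∞ G] [MulAction G M] [ContMDiffSMul 𝓘(ℝ, EG) 𝓘(ℝ, EM) ∞ G M]
  {b : LieAlg EG G →ₗ[ℝ] LieAlg EG G →ₗ[ℝ] ℝ} {μ : M → LieAlg EG G →ₗ[ℝ] ℝ}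
  {r : ℕ} {V : Module.Basis (Fin r) ℝ (LieAlg EG G)}

theorem normSqMoment_eq (hb : IsAdInvariantMetric b)
    (hV : ∀ i j, b (V i) (V j) = if i = j then 1 else 0) (x : M) :
    normSqMoment b μ x = ∑ i, μ x (V i) * μ x (V i) := by
  have h1 : sharp b (μ x) = ∑ i, μ x (V i) • V i := by
    refine sharp_eq (fun u hu => ?_) fun w => ?_
    · by_contra hne
      exact (hb.pos u hne).ne' (hu u)
    · conv_rhs => rw [← sum_inner_smul hV w, map_sum]
      simp only [map_sum, LinearMap.sum_apply, map_smul, LinearMap.smul_apply, smul_eq_mul]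
      exact Finset.sum_congr rfl fun i _ => mul_comm _ _
  rw [normSqMoment, h1]
  simp only [map_sum, LinearMap.sum_apply, map_smul, LinearMap.smul_apply, smul_eq_mul, hV,
    mul_ite, mul_one, mul_zero, Finset.sum_ite_eq', Finset.mem_univ, if_true]

/-- d|μ|² = 2 ∑ μ_i dμ_i, and dμ_i is the contraction of Ω with V_i; nondegeneracy of Ω identifies
the field. -/
theorem hamField_normSqMoment (hΩ : IsSymplectic Ω) (hb : IsAdInvariantMetric b)
    (hV : ∀ i j, b (V i) (V j) = if i = j then 1 else 0) (hμ : IsMomentMap Ω μ) :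
    hamField Ω (normSqMoment b μ)
      = fun x => ∑ i, (2 * μ x (V i)) • killing EM (V i) x := by
  funext x
  refine sharp_eq (fun u hu => hΩ.nondegenerate x u hu) fun w => ?_
  have h1 : normSqMoment b μ = fun y => ∑ i, μ y (V i) * μ y (V i) :=
    funext fun y => normSqMoment_eq hb hV y
  have hs : ∀ i, SecAt EM ℝ (V := Bundle.Trivial M ℝ) (fun y => μ y (V i)) x := fun i =>
    secAt_trivial_iff.2 (hμ.smooth (V i)).contMDiffAt
  have hD := isDerivationAt_mvfderiv (W := ℝ) w
  have h2 := hD.sum (s := Finset.univ) (σ := fun i y => μ y (V i) • μ y (V i))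
    fun i _ => (hs i).smul (hμ.smooth (V i)).contMDiffAt
  have h3 : ∀ i, mvfderiv 𝓘(ℝ, EM) (fun y => μ y (V i) • μ y (V i)) x w
      = (2 * μ x (V i)) * Ω x (killing EM (V i) x) w := fun i => by
    have h4 := hD.leibniz (f := fun y => μ y (V i)) (hμ.smooth (V i)).contMDiffAt (hs i)
    refine Eq.trans h4 ?_
    rw [hμ.deriv]
    simp only [smul_eq_mul]
    ring
  rw [ContinuousLinearMap.coe_coe, h1]
  refine Eq.trans ?_ (h2.trans (Finset.sum_congr rfl fun i _ => h3 i)).symm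
  simp [map_sum]

theorem secAt_momentField (hμ : IsMomentMap Ω μ) (x : M) :
    SecAt EM EM (fun x => ∑ i, (2 * μ x (V i)) • killing EM (V i) x) x :=
  SecAt.sum fun i _ => SecAt.smul (FunAt.const_mul 2 (hμ.smooth (V i)).contMDiffAt)
    (secAt_killing x (V i))

/-- The product rule with dμ_i = Ω(V_i, ·) = g(JV_i, ·). The second summand is the origin of all
terms quadratic in the V_i. -/
theorem nab_momentField (hΩ : IsSymplectic Ω) (hJ : IsCompatible Ω J) (hμ : IsMomentMap Ω μ)
    (x : M) (v : TM EM x) :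
    nab (fun x => ∑ i, (2 * μ x (V i)) • killing EM (V i) x) x v
      = ∑ i, ((2 * μ x (V i)) • nab (fun y => killing EM (V i) y) x v
        + (2 * metric Ω J x (J x (killing EM (V i) x)) v) • killing EM (V i) x) := by
  have hD := isDerivationAt_covariantDerivative nab v
  have h1 : ∀ i, FunAt EM (fun y => 2 * μ y (V i)) x := fun i =>
    FunAt.const_mul 2 (hμ.smooth (V i)).contMDiffAt
  have hK : ∀ i, SecAt EM EM (fun y => killing EM (V i) y) x := fun i => secAt_killing x (V i)
  refine (hD.sum (s := Finset.univ) fun i _ => (hK i).smul (h1 i)).trans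
    (Finset.sum_congr rfl fun i _ => (hD.leibniz (h1 i) (hK i)).trans ?_)
  rw [mvfderiv_const_mul 2 (hμ.smooth (V i)).contMDiffAt, hμ.deriv, omega_eq_metric hΩ hJ]

/-- The rank-one endomorphism v ↦ g(JV, v) V has real trace g(JV, V) = 0, and after composition with
J it has trace |JV|² = |V|². Its complex trace is -√-1 |V|²/2, which the coefficient 2 doubles. -/
theorem traceNabla10_momentField (hΩ : IsSymplectic Ω) (hJ : IsCompatible Ω J)
    (hnab : IsLeviCivita (metric Ω J) nab) (hμ : IsMomentMap Ω μ) (x : M) :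
    traceNabla10 hJ nab (fun x => ∑ i, (2 * μ x (V i)) • killing EM (V i) x) x
      = ∑ i, (((2 * μ x (V i) : ℝ) : ℂ) * traceNabla10 hJ nab (fun y => killing EM (V i) y) x
        - Complex.I * (metric Ω J x (killing EM (V i) x) (killing EM (V i) x) : ℝ)) := by
  have : FiniteDimensional ℝ (TM EM x) := inferInstanceAs (FiniteDimensional ℝ EM)
  let K : Fin r → TM EM x := fun i => killing EM (V i) x
  have h1 : (nab (fun x => ∑ i, (2 * μ x (V i)) • killing EM (V i) x) x).toLinearMap
      = ∑ i, ((2 * μ x (V i)) • (nab (fun y => killing EM (V i) y) x).toLinearMap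
        + (2 : ℝ) • (metric Ω J x (J x (K i))).smulRight (K i)) := by
    ext v
    refine (nab_momentField hΩ hJ hμ x v).trans ?_
    simp [LinearMap.sum_apply, smul_smul, K]
  have h2 : ∀ u, traceJ (J x).toLinearMap ((metric Ω J x (J x u)).smulRight u)
      = -(1 / 2) * Complex.I * (metric Ω J x u u : ℝ) := by
    intro u
    have hp := (isSmoothHermitian hΩ hJ).pair x
    have h3 : (J x).toLinearMap ∘ₗ (metric Ω J x (J x u)).smulRight u
        = (metric Ω J x (J x u)).smulRight (J x u) := by
      ext v
      simp
    have h4 : metric Ω J x (J x u) u = 0 := by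
      have := hp.skew u u
      rw [hp.symm] at this
      simp only [ContinuousLinearMap.coe_coe] at this
      linarith
    have h5 : metric Ω J x (J x u) (J x u) = metric Ω J x u u := hp.orth u u
    rw [traceJ, h3, LinearMap.trace_smulRight, LinearMap.trace_smulRight, h4, h5]
    push_cast
    ring
  rw [traceNabla10_eq hΩ hJ hnab (secAt_momentField hμ x), h1, traceJ_sum]
  refine Finset.sum_congr rfl fun i _ => ?_
  rw [traceJ_add, traceJ_smul, traceJ_smul, h2,
    traceNabla10_eq hΩ hJ hnab (secAt_killing (EM := EM) (EG := EG) x (V i))]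
  push_cast
  ring

end MomentMap

/-! ### Contracting the derivative of the moment field -/

section Combination

variable {T : Type*} [AddCommGroup T] [Module ℝ T] {N : Type*} [AddCommGroup N] [Module ℂ N]
  {g : T →ₗ[ℝ] T →ₗ[ℝ] ℝ} {J : T →ₗ[ℝ] T} {p m : ℕ} {e : Module.Basis (Fin m) ℝ T}
  {ι : Type*}

theorem sum_cliffF_inner (hp : IsHermitianPair g J)
    (he : ∀ i j, g (e i) (e j) = if i = j then 1 else 0) (u : T) (η : Forms T N p) :
    ∑ j, (g u (e j) : ℂ) • cliffF g J (e j) η = cliffF g J u η := by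
  conv_rhs => rw [← sum_inner_smul he u]
  rw [map_sum, LinearMap.sum_apply]
  refine Finset.sum_congr rfl fun j _ => ?_
  rw [map_smul, LinearMap.smul_apply, hp.symm]
  exact Complex.coe_smul _ (cliffF g J (e j) η)

/-- The rank-one summands contract to c(u_i) c(w_i), because ∑ g(u, e_j) c(e_j) = c(u). In the
application u_i = JV_i and w_i = V_i. -/
theorem sum_cliffF_combination (hp : IsHermitianPair g J)
    (he : ∀ i j, g (e i) (e j) = if i = j then 1 else 0) (t : Finset ι) (a : ι → ℝ)
    (f : ι → T → T) (u w : ι → T) (η : Forms T N p) :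
    ∑ j, cliffF g J (e j)
        (cliffF g J (∑ i ∈ t, (a i • f i (e j) + (2 * g (u i) (e j)) • w i)) η)
      = ∑ i ∈ t, ((a i : ℂ) • ∑ j, cliffF g J (e j) (cliffF g J (f i (e j)) η)
        + (2 : ℂ) • cliffF g J (u i) (cliffF g J (w i) η)) := by
  have hr : ∀ (r : ℝ) (η : Forms T N p), r • η = (r : ℂ) • η :=
    fun r η => (Complex.coe_smul r η).symm
  simp only [map_sum, map_add, map_smul, LinearMap.sum_apply, LinearMap.add_apply,
    LinearMap.smul_apply, hr]
  rw [Finset.sum_comm]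
  refine Finset.sum_congr rfl fun i _ => ?_
  rw [Finset.sum_add_distrib, ← sum_cliffF_inner hp he (u i)]
  refine congrArg₂ _ Finset.smul_sum.symm ?_
  rw [Finset.smul_sum]
  refine Finset.sum_congr rfl fun j _ => ?_
  rw [smul_smul]
  push_cast
  rfl

theorem IsTypeP.sum_opA_combination {η : Forms T N p} (h : IsTypeP J η)
    (hp : IsHermitianPair g J)
    (he : ∀ i j, g (e i) (e j) = if i = j then 1 else 0) (t : Finset ι) (a : ι → ℝ)
    (f : ι → T → T) (u w : ι → T) :
    ∑ j, opA g J (e j) (∑ i ∈ t, (a i • f i (e j) + (2 * g (u i) (e j)) • w i)) η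
      = ∑ i ∈ t, ((a i : ℂ) • ∑ j, opA g J (e j) (f i (e j)) η
        + (2 : ℂ) • opA g J (u i) (w i) η) := by
  simp only [h.opA_sum_right, h.opA_add_right, h.opA_smul_right]
  rw [Finset.sum_comm]
  refine Finset.sum_congr rfl fun i _ => ?_
  rw [Finset.sum_add_distrib, ← h.sum_opA_inner hp he (u i)]
  refine congrArg₂ _ Finset.smul_sum.symm ?_
  rw [Finset.smul_sum]
  refine Finset.sum_congr rfl fun j _ => ?_
  rw [h.opA_smul_right, smul_smul]
  push_cast
  rfl

end Combination

end TwistedSpinc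

end

open TwistedSpinc in
/-- The Bochner-type formula for the square of the deformed operator `D_t`. -/
theorem theorem1p4
    -- the closed symplectic manifold `(M, Ω)`
    {EM : Type*} [NormedAddCommGroup EM] [NormedSpace ℝ EM] [FiniteDimensional ℝ EM]
    {M : Type*} [TopologicalSpace M] [T2Space M] [CompactSpace M] [ChartedSpace EM M]
    [IsManifold 𝓘(ℝ, EM) ∞ M]
    (Ω : ∀ x : M, TM EM x →L[ℝ] TM EM x →L[ℝ] ℝ) (hΩ : IsSymplectic Ω)
    (J : ∀ x : M, TM EM x →L[ℝ] TM EM x) (hJ : IsCompatible Ω J)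
    -- its Levi-Civita connection
    (nab : AffineConn EM M) (hnab : IsLeviCivita (metric Ω J) nab)
    -- the Hermitian vector bundle `E` with its Hermitian connection
    {F : Type*} [NormedAddCommGroup F] [NormedSpace ℂ F] [FiniteDimensional ℂ F]
    {E : M → Type*} [TopologicalSpace (Bundle.TotalSpace F E)]
    [∀ x, AddCommGroup (E x)] [∀ x, Module ℂ (E x)] [∀ x, TopologicalSpace (E x)]
    [∀ x, IsTopologicalAddGroup (E x)] [∀ x, ContinuousSMul ℝ (E x)]
    [FiberBundle F E] [VectorBundle ℝ F E] [VectorBundle ℂ F E]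
    [ContMDiffVectorBundle ∞ F E 𝓘(ℝ, EM)]
    (h : ∀ x : M, E x →ₗ⋆[ℂ] E x →ₗ[ℂ] ℂ) (hh : IsHermitianMetric EM F h)
    (covE : CovariantDerivative 𝓘(ℝ, EM) F E) (hcovE : IsHermitianConnection h covE)
    -- the compact connected Lie group `G`, with an `Ad G`-invariant metric on its Lie algebra
    {EG : Type*} [NormedAddCommGroup EG] [NormedSpace ℝ EG] [FiniteDimensional ℝ EG]
    {G : Type*} [TopologicalSpace G] [T2Space G] [CompactSpace G] [ConnectedSpace G]
    [ChartedSpace EG G] [Group G] [LieGroup 𝓘(ℝ, EG) ∞ G]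
    (b : LieAlg EG G →ₗ[ℝ] LieAlg EG G →ₗ[ℝ] ℝ) (hb : IsAdInvariantMetric b)
    -- its Hamiltonian action on `M`, lifted to `E`
    [MulAction G M] [ContMDiffSMul 𝓘(ℝ, EG) 𝓘(ℝ, EM) ∞ G M]
    (hG : IsInvariant G Ω J)
    (μ : M → LieAlg EG G →ₗ[ℝ] ℝ) (hμ : IsMomentMap Ω μ)
    (ρ : ∀ (a : G) (x : M), E x ≃ₗ[ℂ] E (a • x)) (hρ : IsLift EG h covE ρ)
    -- the orthonormal basis `V_i` of the Lie algebra, dual to `h_i`; then `μ_i = μ · (V i)`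
    {r : ℕ} (V : Module.Basis (Fin r) ℝ (LieAlg EG G))
    (hV : ∀ i j, b (V i) (V j) = if i = j then 1 else 0)
    -- an orthonormal basis `e_j` of each tangent space
    {m : ℕ} (e : ∀ x : M, Module.Basis (Fin m) ℝ (TM EM x))
    (he : ∀ x i j, metric Ω J x (e x i) (e x j) = if i = j then 1 else 0)
    (p : ℕ) (t : ℝ) (s : ∀ x : M, Forms (TM EM x) (E x) p) (hs : IsSmoothForm F J s) :
    let X : ∀ x : M, TM EM x := hamField Ω (normSqMoment b μ)
    let g := metric Ω J
    let c : ∀ {x : M}, TM EM x → Forms (TM EM x) (E x) p → Forms (TM EM x) (E x) p :=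
      fun {x} Y => cliff (g x) (J x).toLinearMap Y
    let A : ∀ {x : M}, TM EM x → TM EM x → Forms (TM EM x) (E x) p → Forms (TM EM x) (E x) p :=
      fun {x} Y Z => opA (g x) (J x).toLinearMap Y Z
    let D := dirac Ω J nab e covE (p := p)
    let D_t := diracT Ω J nab e covE X t (p := p)
    let K : ∀ (i : Fin r) (x : M), TM EM x := fun i x => killing EM (V i) x
    IsSmoothForm F J (D s) ∧ IsSmoothForm F J (D_t s) ∧
    ∀ x : M, D_t (D_t s) x =
      D (D s) x
      - (2 * Complex.I * t) • ∑ i, (μ x (V i) : ℂ) • lieForms F ρ (V i) s x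
      - (Complex.I * t / 2 * traceNabla10 hJ nab X x) • s x
      + (2 * Complex.I * t) • ∑ i, (μ x (V i) : ℂ) • rEForms covE ρ (V i) (s x)
      + (t / 2 : ℂ) • ∑ i, (Complex.I • c (J x (K i x)) (c (K i x) (s x))
          + (g x (K i x) (K i x) : ℂ) • s x
          - (4 * Complex.I) • A (J x (K i x)) (K i x) (s x))
      + (Complex.I * t / 4) • ∑ j, (c (e x j) (c (nab X x (e x j)) (s x))
          + (4 : ℂ) • A (e x j) (nab X x (e x j)) (s x))
      + ((t ^ 2 / 4 * g x (X x) (X x) : ℝ) : ℂ) • s x := by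
  have hX : hamField Ω (normSqMoment b μ) = fun y => ∑ i, (2 * μ y (V i)) • killing EM (V i) y :=
    hamField_normSqMoment hΩ hb hV hμ
  have hXs : ∀ y, SecAt EM EM (hamField Ω (normSqMoment b μ)) y := fun y => by
    rw [hX]
    exact secAt_momentField hμ y
  have hDs := isSmoothForm_dirac hΩ hJ hnab hcovE he hs
  refine ⟨hDs, isSmoothForm_diracT hΩ hJ hnab hcovE he hs hXs t, fun x => ?_⟩
  refine (diracT_diracT hΩ hJ hnab hcovE he hs hDs hXs t x).trans ?_
  have hp := (isSmoothHermitian hΩ hJ).pair x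
  obtain ⟨L, hL⟩ := exists_cov_linear (e := e) hΩ hJ hnab hcovE hs x
  have hr : ∀ (r : ℝ) (η : Forms (TM EM x) (E x) p), r • η = (r : ℂ) • η :=
    fun r η => (Complex.coe_smul r η).symm
  have hnX : ∀ v, nab (hamField Ω (normSqMoment b μ)) x v
      = ∑ i, ((2 * μ x (V i)) • nab (fun y => killing EM (V i) y) x v
        + (2 * metric Ω J x (J x (killing EM (V i) x)) v) • killing EM (V i) x) := fun v => by
    rw [hX]
    exact nab_momentField hΩ hJ hμ x v
  have hC := sum_cliffF_combination hp (he x) Finset.univ (fun i => 2 * μ x (V i))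
    (fun i v => nab (fun y => killing EM (V i) y) x v) (fun i => J x (killing EM (V i) x))
    (fun i => killing EM (V i) x) (s x)
  have hA := (hs.isType x).sum_opA_combination hp (he x) Finset.univ (fun i => 2 * μ x (V i))
    (fun i v => nab (fun y => killing EM (V i) y) x v) (fun i => J x (killing EM (V i) x))
    (fun i => killing EM (V i) x)
  -- Read backwards, these identities express the contractions of ∇V_i weighted by 2μ_i as the
  -- contraction of ∇X minus the rank-one terms.
  simp only [← hnX] at hC hA
  have hcov : cov Ω J nab e covE s x (hamField Ω (normSqMoment b μ) x)
      = ∑ i, ((2 * μ x (V i) : ℝ) : ℂ) • cov Ω J nab e covE s x (killing EM (V i) x) := by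
    rw [congrFun hX x]
    simp only [hL, map_sum, map_smul, hr]
  have hT : traceNabla10 hJ nab (hamField Ω (normSqMoment b μ)) x
      = ∑ i, (((2 * μ x (V i) : ℝ) : ℂ) * traceNabla10 hJ nab (fun y => killing EM (V i) y) x
        - Complex.I * (metric Ω J x (killing EM (V i) x) (killing EM (V i) x) : ℝ)) := by
    rw [hX]
    exact traceNabla10_momentField hΩ hJ hnab hμ x
  -- X is a pointwise combination of the generated fields and the covariant derivative is linear in
  -- its direction, so ∇_X reduces to the derivatives along the V_i.
  simp only [cov_killing hΩ hJ hnab hcovE he hG hρ hs] at hcov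
  simp only [Complex.ofReal_mul, Complex.ofReal_ofNat, mul_smul, smul_add, smul_sub, mul_assoc,
    Finset.sum_add_distrib, Finset.sum_sub_distrib, ← Finset.smul_sum, ← Finset.mul_sum] at hC hA hcov hT
  have hsc : ∀ f : Fin r → ℂ, ∑ i, (μ x (V i) : ℂ) • (1 / 2 : ℂ) • f i • s x
      = ((1 / 2) * ∑ i, (μ x (V i) : ℂ) * f i) • s x := fun f => by
    rw [Finset.mul_sum, Finset.sum_smul]
    exact Finset.sum_congr rfl fun i _ => by module
  have hcomm : ∀ f : Fin r → Forms (TM EM x) (E x) p,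
      ∑ i, (μ x (V i) : ℂ) • (1 / 4 : ℂ) • f i = (1 / 4 : ℂ) • ∑ i, (μ x (V i) : ℂ) • f i :=
    fun f => by
      rw [Finset.smul_sum]
      exact Finset.sum_congr rfl fun i _ => smul_comm _ _ _
  rw [hsc, hcomm] at hcov
  -- The factor √-1 T/2 turns -√-1 |V_i|² into T|V_i|²/2, the norm term of the formula.
  have hT' : Complex.I * t / 2 * traceNabla10 hJ nab (hamField Ω (normSqMoment b μ)) x
      = Complex.I * t * ∑ i, (μ x (V i) : ℂ) * traceNabla10 hJ nab (fun y => killing EM (V i) y) x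
        + t / 2 * ∑ i, ((metric Ω J x (killing EM (V i) x) (killing EM (V i) x) : ℝ) : ℂ) := by
    rw [hT]
    linear_combination (-(t / 2 : ℂ) * ∑ i,
      ((metric Ω J x (killing EM (V i) x) (killing EM (V i) x) : ℝ) : ℂ)) * Complex.I_mul_I
  -- With all finite sums separated, the claim becomes a linear identity between them in the module
  -- of forms at x.
  simp only [cliff_eq_cliffF, Finset.sum_add_distrib, Finset.sum_sub_distrib, ← Finset.smul_sum,
    ← Finset.sum_smul]
  rw [hT', hC, hA, hcov]
  module
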